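/- **Conventions.** For $i\in\mathbb N$ let $j^i=j$ if $j<i$ and $j^i=j+1$ if $j\ge i$; for $j\neq i$ let $j_i=j$ if $j<i$ and $j_i=j-1$ if $j>i$. Let $\mathbb T_n$ be the free monoid on $T_1,\dots,T_{n-1}$, with length $l$. Permutations act on the right, $k\cdot(\sigma\tau)=(k\cdot\sigma)\cdot\tau$; $\tau_i\in S_n$ is the transposition of $i$ and $i+1$, and $u\mapsto\bar u$ is the morphism of monoids $\mathbb T_n\to S_n$ with $\bar T_i=\tau_i$; it presents $S_n$ by the relations $T_iT_i=1$, $T_iT_{i+1}T_i=T_{i+1}T_iT_{i+1}$ and $T_iT_j=T_jT_i$ for $|i-j|\ge2$. Put $k\cdot u=k\cdot\bar u$. For $n\ge1$ and $1\le i\le n$ the string-deletion map $\partial_i:\mathbb T_n\to\mathbb T_{n-1}$ is defined by $\partial_i1=1$, $\partial_iT_j=1$ if $i\in\{j,j+1\}$, $\partial_iT_j=T_{j_i}$ otherwise, and $\partial_i(uv)=\partial_iu\cdot\partial_{i\cdot u}v$. Cubical $\omega$-categories (and $n$-categories, with cells only up to dimension $n$) are strict, with connections, in the sense of Al-Agl,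 Brown and Steiner: sets $\mathbf C_k$ of $k$-cells, faces $\partial_i^\alpha$ ($\alpha=\pm$), degeneracies $\epsilon_i$, connections $\Gamma_i^\alpha$, and compositions $A\star_iB$ defined exactly if $\partial_i^+A=\partial_i^-B$; here $\partial_i^\alpha\Gamma_i^\alpha=\partial_{i+1}^\alpha\Gamma_i^\alpha=\mathrm{id}$. An $n$-cell $A$ ($n\ge1$) is *$R_1$-invertible* if there is $B$ with $A\star_1B=\epsilon_1\partial_1^-A$ and $B\star_1A=\epsilon_1\partial_1^+A$; it is *invertible* if $\psi_1\cdots\psi_{n-1}A$ is $R_1$-invertible, where $\psi_iA=\Gamma_i^+\partial_{i+1}^-A\star_{i+1}A\star_{i+1}\Gamma_i^-\partial_{i+1}^+A$. For $1\le i<n$, an $n$-cell $B$ is the *$T_i$-inverse* $T_iA$ of the $n$-cell $A$ (which is then *$T_i$-invertible*) if $\partial_i^\alpha A=\partial_{i+1}^\alpha B$ and $\partial_{i+1}^\alpha A=\partial_i^\alpha B$ for $\alpha=\pm$, and $$(\Gamma_i^+\partial_{i+1}^-A\star_iB)\star_{i+1}(A\star_i\Gamma_i^-\partial_i^+A)=\Gamma_i^-\partial_i^-A\star_i\Gamma_i^+\partial_{i+1}^+A,$$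 and the same equation holds with $A$ and $B$ exchanged. Every $n$-cell is $1$-invertible, with $1\cdot A=A$; it is $(T_iu)$-invertible if it is $u$-invertible and $u\cdot A$ is $T_i$-invertible, and then $(T_iu)\cdot A=T_i(u\cdot A)$. For $\sigma\in S_n$, an $n$-cell $A$ is *$\sigma$-invertible* if it is $u$-invertible for some word $u$ of minimal length with $\bar u=\sigma$, and then $\sigma\cdot A=u\cdot A$. For a cubical $n$-category $\mathbf C$, $\Box\mathbf C$ is the cubical $(n+1)$-category that coincides with $\mathbf C$ up to dimension $n$ and whose $(n+1)$-cells are the *shells*: the families $A=(A_i^\alpha)$ ($1\le i\le n+1$, $\alpha=\pm$) of $n$-cells with $\partial_{i_j}^\alpha A_j^\beta=\partial_{j_i}^\beta A_i^\alpha$ for $i\ne j$, with $\partial_i^\alpha A=A_i^\alpha$ and the operations that the axioms force. The shell $\boldsymbol\partial A=(\partial_i^\alpha A)$ of an $(n+1)$-cell $A$ of a cubical $\omega$-category $\mathbf C$ is an $(n+1)$-cell of $\Box\,\mathrm{tr}_n\mathbf C$, where $\mathrm{tr}_n$ is truncation. **Proposition.** (1) For $n\ge1$ and $1\le i\le n$,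 the composite of $\partial_i:\mathbb T_n\to\mathbb T_{n-1}$ with the projection $\mathbb T_{n-1}\to S_{n-1}$ is compatible with the above relations of $S_n$. Hence there are unique maps $\partial_i:S_n\to S_{n-1}$ with $\partial_i\bar u=\overline{\partial_iu}$ for all $u\in\mathbb T_n$. They satisfy $\partial_i1=1$, $\partial_i\tau_j=1$ if $i\in\{j,j+1\}$ and $\partial_i\tau_j=\tau_{j_i}$ otherwise, and $\partial_i(\sigma\tau)=\partial_i\sigma\cdot\partial_{i\cdot\sigma}\tau$. Moreover $\partial_i\sigma$ is the unique permutation such that for all $1\le j\le n-1$ $$j\cdot\partial_i\sigma=(j^i\cdot\sigma)_{i\cdot\sigma}.$$ (2) Let $n\ge0$, $\mathbf C$ a cubical $n$-category, $\sigma\in S_{n+1}$ and $A$ an $(n+1)$-cell of $\Box\mathbf C$. Then $A$ is $\sigma$-invertible if and only if for all $1\le j\le n+1$ and $\alpha=\pm$ the $n$-cell $A_{j\cdot\sigma}^\alpha$ is $\partial_j\sigma$-invertible; and in that case $\partial_j^\alpha(\sigma\cdot A)=\partial_j\sigma\cdot A_{j\cdot\sigma}^\alpha$ for all $j$ and $\alpha$.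 (3) Let $\mathbf C$ be a cubical $\omega$-category, $n\ge1$, and $1\ne\sigma\in S_n$. An $n$-cell $A$ of $\mathbf C$ is $\sigma$-invertible if and only if $A$ is invertible and its shell $\boldsymbol\partial A$ is $\sigma$-invertible in $\Box\,\mathrm{tr}_{n-1}\mathbf C$. -/

import Mathlib

universe u

namespace Cubical

/-! ## Indices

Directions are numbered from `0`: the indices `1, …, n` are the elements of `Fin n`. The index
`j^i` (skip the value `i`) is `Fin.succAbove i j`. -/

/-- The index `j_i` (for `j ≠ i`): it is `j` if `j < i` and `j - 1` if `j > i`. -/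
def low {n : ℕ} (j i : Fin (n + 1)) (h : j ≠ i) : Fin n :=
  ⟨if j < i then j else j - 1, by
    have := j.2; have := i.2
    have h' : (j : ℕ) ≠ i := fun e => h (Fin.ext e)
    split_ifs with hlt
    · have : (j : ℕ) < i := hlt
      omega
    · have : ¬ ((j : ℕ) < i) := hlt
      omega⟩

/-- The index `j_i` for `i ≠ j, j + 1`, where `j` is an index of a connection or of a transposition
and so has both `j` and `j + 1` as directions: it is `j` if `j < i` and `j - 1` if `j > i`. -/
def lowGen {n : ℕ} (j : Fin n) (i : Fin (n + 1)) (h : ¬ (i = j.castSucc ∨ i = j.succ)) :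
    Fin (n - 1) :=
  ⟨if (j : ℕ) < i then j else j - 1, by
    have := j.2; have := i.2
    have h1 : (i : ℕ) ≠ j := fun e => h (Or.inl (Fin.ext e))
    have h2 : (i : ℕ) ≠ j + 1 := fun e => h (Or.inr (Fin.ext e))
    split_ifs <;> omega⟩

/-! ## Words and permutations -/

/-- The free monoid on the letters `T_1, …, T_{n-1}`. -/
abbrev Word (n : ℕ) : Type := FreeMonoid (Fin (n - 1))

/-- The symmetric group `S_n`, whose product `σ * τ` means "first `σ`, then `τ`", so that it acts
on the right on `{1, …, n}`. -/
abbrev SymGroup (n : ℕ) : Type := (Equiv.Perm (Fin n))ᵐᵒᵖ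

/-- The right action `j · σ`. -/
def ract {n : ℕ} (j : Fin n) (σ : SymGroup n) : Fin n := σ.unop j

/-- The transposition `τ_j` of `j` and `j + 1`. -/
def transp {n : ℕ} (j : Fin (n - 1)) : SymGroup n :=
  MulOpposite.op (Equiv.swap ⟨j, by have := j.2; omega⟩ ⟨j + 1, by have := j.2; omega⟩)

/-- The projection `u ↦ ū` from words to permutations. -/
def bar {n : ℕ} : Word n →* SymGroup n := FreeMonoid.lift transp

/-- `u` is a representative of minimal length of `σ`. -/
def IsMinRep {n : ℕ} (u : Word n) (σ : SymGroup n) : Prop :=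
  bar u = σ ∧ ∀ v : Word n, bar v = σ → u.length ≤ v.length

/-- The defining relations of `S_n` as a quotient of the monoid of words. -/
inductive CoxeterRel (n : ℕ) : Word n → Word n → Prop
  | sq (i : Fin (n - 1)) : CoxeterRel n (FreeMonoid.of i * FreeMonoid.of i) 1
  | braid (i j : Fin (n - 1)) (h : (j : ℕ) = i + 1) :
      CoxeterRel n (FreeMonoid.of i * FreeMonoid.of j * FreeMonoid.of i)
        (FreeMonoid.of j * FreeMonoid.of i * FreeMonoid.of j)
  | comm (i j : Fin (n - 1)) (h : (i : ℕ) + 2 ≤ j ∨ (j : ℕ) + 2 ≤ i) :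
      CoxeterRel n (FreeMonoid.of i * FreeMonoid.of j) (FreeMonoid.of j * FreeMonoid.of i)

/-- `∂_i T_j`. -/
def genFace {n : ℕ} (i : Fin (n + 1)) (j : Fin n) : Word n :=
  if h : i = j.castSucc ∨ i = j.succ then 1 else FreeMonoid.of (lowGen j i h)

/-- `∂_i` on lists of letters: `∂_i 1 = 1` and `∂_i (T_j · u) = ∂_i T_j · ∂_{i · T_j} u`. -/
def listFace {n : ℕ} : Fin (n + 1) → List (Fin n) → Word n
  | _, [] => 1
  | i, j :: u => genFace i j * listFace (ract i (transp (n := n + 1) j)) u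

/-- The map `∂_i` from words on `n + 1` strings to words on `n` strings. -/
def wordFace {n : ℕ} (i : Fin (n + 1)) (u : Word (n + 1)) : Word n :=
  listFace i u.toList

theorem wordFace_one {n : ℕ} (i : Fin (n + 1)) : wordFace i (1 : Word (n + 1)) = 1 := rfl

theorem wordFace_of {n : ℕ} (i : Fin (n + 1)) (j : Fin n) :
    wordFace i (FreeMonoid.of j : Word (n + 1)) = genFace i j :=
  mul_one _

theorem wordFace_mul {n : ℕ} (i : Fin (n + 1)) (u v : Word (n + 1)) :
    wordFace i (u * v) = wordFace i u * wordFace (ract i (bar u)) v := by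
  induction u using FreeMonoid.recOn generalizing i with
  | one => simp [wordFace_one, ract]
  | of_mul j u ih =>
    have h1 (w : Word (n + 1)) : wordFace i (FreeMonoid.of j * w)
        = genFace i j * wordFace (ract i (transp (n := n + 1) j)) w := rfl
    rw [mul_assoc, h1, h1, ih, mul_assoc]
    simp [bar, ract]

theorem ract_ne {n : ℕ} (i : Fin (n + 1)) (σ : SymGroup (n + 1)) (j : Fin n) :
    ract (i.succAbove j) σ ≠ ract i σ :=
  fun h => Fin.succAbove_ne i j (σ.unop.injective h)

/-! ## Cubical categories

Signs are Booleans: `false` is `-` and `true` is `+`. -/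

/-- The operations of a cubical category between the set `X` of `k`-cells and the set `Y` of
`(k + 1)`-cells: faces `∂_i^α`, degeneracies `ε_i`, connections `Γ_i^α`, and the compositions
`⋆_i` of `(k + 1)`-cells, `A ⋆_i B` being defined exactly if `∂_i^+ A = ∂_i^- B`. -/
structure Layer (k : ℕ) (X Y : Type u) where
  face : Fin (k + 1) → Bool → Y → X
  deg : Fin (k + 1) → X → Y
  conn : Fin k → Bool → X → Y
  comp : (i : Fin (k + 1)) → (A B : Y) → face i true A = face i false B → Y

namespace Layer

variable {k : ℕ} {X Y Z : Type u}

/-- `A ⋆_i B` is defined and equal to `P`. -/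
def IsComp (L : Layer k X Y) (i : Fin (k + 1)) (A B P : Y) : Prop :=
  ∃ h : L.face i true A = L.face i false B, L.comp i A B h = P

/-- `(A ⋆_i B) ⋆_j (C ⋆_i D)` is defined and equal to `P`. -/
def IsComp₂ (L : Layer k X Y) (i j : Fin (k + 1)) (A B C D P : Y) : Prop :=
  ∃ Q R : Y, L.IsComp i A B Q ∧ L.IsComp i C D R ∧ L.IsComp j Q R P

/-- The axioms of a cubical category that involve only cells of dimensions `k` and `k + 1`. -/
structure Laws (L : Layer k X Y) : Prop where
  face_deg_self : ∀ i α A, L.face i α (L.deg i A) = A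
  face_conn_castSucc : ∀ (i : Fin k) α A, L.face i.castSucc α (L.conn i α A) = A
  face_conn_succ : ∀ (i : Fin k) α A, L.face i.succ α (L.conn i α A) = A
  face_comp_false : ∀ i A B P, L.IsComp i A B P → L.face i false P = L.face i false A
  face_comp_true : ∀ i A B P, L.IsComp i A B P → L.face i true P = L.face i true B
  exchange : ∀ i j A B C D P Q R S W, i ≠ j →
    L.IsComp i A B P → L.IsComp i C D Q → L.IsComp j A C R → L.IsComp j B D S →
    L.IsComp j P Q W → L.IsComp i R S W
  assoc : ∀ i A B C P Q W, L.IsComp i A B P → L.IsComp i B C Q →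
    (L.IsComp i A Q W ↔ L.IsComp i P C W)
  comp_deg : ∀ i A, L.IsComp i A (L.deg i (L.face i true A)) A
  deg_comp : ∀ i A, L.IsComp i (L.deg i (L.face i false A)) A A
  conn_comp_castSucc : ∀ (i : Fin k) A,
    L.IsComp i.castSucc (L.conn i true A) (L.conn i false A) (L.deg i.succ A)
  conn_comp_succ : ∀ (i : Fin k) A,
    L.IsComp i.succ (L.conn i true A) (L.conn i false A) (L.deg i.castSucc A)

/-- The axioms of a cubical category that involve cells of dimensions `k`, `k + 1` and `k + 2`. -/
structure Laws₂ (L : Layer k X Y) (M : Layer (k + 1) Y Z) : Prop where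
  face_face : ∀ (i j : Fin (k + 2)) (h : i ≠ j) α β A,
    L.face (low i j h) α (M.face j β A) = L.face (low j i h.symm) β (M.face i α A)
  face_deg : ∀ (i j : Fin (k + 2)) (h : i ≠ j) α A,
    M.face i α (M.deg j A) = L.deg (low j i h.symm) (L.face (low i j h) α A)
  face_conn : ∀ (i : Fin (k + 2)) (j : Fin (k + 1)) (h : ¬ (i = j.castSucc ∨ i = j.succ)) α β A,
    M.face i α (M.conn j β A) =
      L.conn (lowGen j i h) β (L.face (low i j.castSucc fun e => h (Or.inl e)) α A)
  face_conn_castSucc_not : ∀ (j : Fin (k + 1)) α A,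
    M.face j.castSucc α (M.conn j (!α) A) = L.deg j (L.face j α A)
  face_conn_succ_not : ∀ (j : Fin (k + 1)) α A,
    M.face j.succ α (M.conn j (!α) A) = L.deg j (L.face j α A)
  deg_deg : ∀ (i j : Fin (k + 2)) (h : i ≠ j) A,
    M.deg i (L.deg (low j i h.symm) A) = M.deg j (L.deg (low i j h) A)
  conn_conn : ∀ (i j : Fin k) α β A, i ≠ j →
    M.conn (j.castSucc.succAbove i) α (L.conn j β A) =
      M.conn (i.castSucc.succAbove j) β (L.conn i α A)
  conn_conn_self : ∀ (i : Fin k) α A,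
    M.conn i.succ α (L.conn i α A) = M.conn i.castSucc α (L.conn i α A)
  conn_deg : ∀ (i j : Fin (k + 1)) (h : i ≠ j) α A,
    M.conn i α (L.deg j A) = M.deg (i.castSucc.succAbove j) (L.conn (low i j h) α A)
  conn_deg_self : ∀ (i : Fin (k + 1)) α A,
    M.conn i α (L.deg i A) = M.deg i.castSucc (L.deg i A)
  face_comp : ∀ (i j : Fin (k + 2)) (h : i ≠ j) α A B P, M.IsComp j A B P →
    L.IsComp (low j i h.symm) (M.face i α A) (M.face i α B) (M.face i α P)
  deg_comp : ∀ (i : Fin (k + 2)) (j : Fin (k + 1)) A B P, L.IsComp j A B P →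
    M.IsComp (i.succAbove j) (M.deg i A) (M.deg i B) (M.deg i P)
  conn_comp : ∀ (i j : Fin (k + 1)) α A B P, i ≠ j → L.IsComp j A B P →
    M.IsComp (i.castSucc.succAbove j) (M.conn i α A) (M.conn i α B) (M.conn i α P)
  conn_comp_false : ∀ (i : Fin (k + 1)) A B P, L.IsComp i A B P →
    M.IsComp₂ i.castSucc i.succ (M.conn i false A) (M.deg i.succ B)
      (M.deg i.castSucc B) (M.conn i false B) (M.conn i false P)
  conn_comp_true : ∀ (i : Fin (k + 1)) A B P, L.IsComp i A B P →
    M.IsComp₂ i.castSucc i.succ (M.conn i true A) (M.deg i.castSucc A)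
      (M.deg i.succ A) (M.conn i true B) (M.conn i true P)

/-! ### Invertibility of the `(k + 1)`-cells -/

/-- `A` is `R_i`-invertible. -/
def RInvertible (L : Layer k X Y) (i : Fin (k + 1)) (A : Y) : Prop :=
  ∃ B : Y, L.IsComp i A B (L.deg i (L.face i false A)) ∧
    L.IsComp i B A (L.deg i (L.face i true A))

/-- The folding operation
`ψ_i A = Γ_i^+ ∂_{i+1}^- A ⋆_{i+1} A ⋆_{i+1} Γ_i^- ∂_{i+1}^+ A`. -/
def psi (L : Layer k X Y) (hL : L.Laws) (i : Fin k) (A : Y) : Y :=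
  L.comp i.succ
    (L.comp i.succ (L.conn i true (L.face i.succ false A)) A (hL.face_conn_succ i true _))
    (L.conn i false (L.face i.succ true A))
    ((hL.face_comp_true i.succ _ _ _ ⟨_, rfl⟩).trans (hL.face_conn_succ i false _).symm)

/-- `A` is (plainly) invertible: `ψ_1 ⋯ ψ_k A` is `R_1`-invertible. -/
def Invertible (L : Layer k X Y) (hL : L.Laws) (A : Y) : Prop :=
  L.RInvertible 0 ((List.finRange k).foldr (L.psi hL) A)

/-- The equation
`(Γ_i^+ ∂_{i+1}^- A ⋆_i B) ⋆_{i+1} (A ⋆_i Γ_i^- ∂_i^+ A) = Γ_i^- ∂_i^- A ⋆_i Γ_i^+ ∂_{i+1}^+ A`,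
both sides being defined. -/
def TEquation (L : Layer k X Y) (i : Fin k) (A B : Y) : Prop :=
  ∃ P : Y,
    L.IsComp₂ i.castSucc i.succ
      (L.conn i true (L.face i.succ false A)) B
      A (L.conn i false (L.face i.castSucc true A)) P ∧
    L.IsComp i.castSucc
      (L.conn i false (L.face i.castSucc false A)) (L.conn i true (L.face i.succ true A)) P

/-- `B` is the `T_i`-inverse of `A`. -/
def IsTInverse (L : Layer k X Y) (i : Fin k) (A B : Y) : Prop :=
  (∀ α, L.face i.castSucc α A = L.face i.succ α B) ∧
  (∀ α, L.face i.succ α A = L.face i.castSucc α B) ∧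
  L.TEquation i A B ∧ L.TEquation i B A

/-- The partial map `A ↦ T_i A`, defined on the `T_i`-invertible cells. -/
noncomputable def tMap (L : Layer k X Y) (i : Fin k) : Y →. Y :=
  fun A => ⟨∃ B, L.IsTInverse i A B, fun h => h.choose⟩

end Layer

/-! ### The partial action of words and permutations -/

/-- The partial map `A ↦ u · A` for a word `u`, given the partial maps `T_i`: `1 · A = A` and
`(T_i · u) · A = T_i (u · A)`. -/
def listAct {m : ℕ} {X : Type u} (t : Fin m → X →. X) : List (Fin m) → X →. X
  | [], A => Part.some A
  | i :: u, A => (listAct t u A).bind (t i)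

/-- The partial map `A ↦ u · A`; its domain is the set of `u`-invertible elements. -/
def wordAct {n : ℕ} {X : Type u} (t : Fin (n - 1) → X →. X) (u : Word n) : X →. X :=
  listAct t u.toList

/-- The partial map `A ↦ σ · A`, defined if `A` is `u`-invertible for some representative `u` of
minimal length of `σ`, and then equal to `u · A`. -/
noncomputable def permAct {n : ℕ} {X : Type u} (t : Fin (n - 1) → X →. X) (σ : SymGroup n) : X →. X :=
  fun A => ⟨∃ w, IsMinRep w σ ∧ (wordAct t w A).Dom,
    fun h => (wordAct t h.choose A).get h.choose_spec.2⟩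

/-- Cubical `N`-categories (with connections) for `N ≤ ω`. Only the sets `cell k` with `k ≤ N`
matter; the others carry no structure. -/
structure CubicalCategory (N : ℕ∞) where
  cell : ℕ → Type u
  layer : ∀ k : ℕ, (k : ℕ∞) < N → Layer k (cell k) (cell (k + 1))
  laws : ∀ (k : ℕ) (h : (k : ℕ∞) < N), (layer k h).Laws
  laws₂ : ∀ (k : ℕ) (h : (k : ℕ∞) < N) (h' : ((k + 1 : ℕ) : ℕ∞) < N),
    (layer k h).Laws₂ (layer (k + 1) h')

/-- Cubical `ω`-categories. -/
abbrev CubicalOmegaCategory := CubicalCategory.{u} ⊤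

theorem coe_lt_succ (n : ℕ) : (n : ℕ∞) < ((n + 1 : ℕ) : ℕ∞) := by
  exact_mod_cast Nat.lt_succ_self n

namespace CubicalCategory

variable {N : ℕ∞}

/-- The partial maps `T_i` on the `k`-cells. -/
noncomputable def tMap (C : CubicalCategory.{u} N) :
    (k : ℕ) → (k : ℕ∞) ≤ N → Fin (k - 1) → C.cell k →. C.cell k
  | 0, _, i => i.elim0
  | k + 1, h, i => (C.layer k ((coe_lt_succ k).trans_le h)).tMap i

/-- The partial map `A ↦ σ · A` on `k`-cells, for `σ ∈ S_k`. -/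
noncomputable def act (C : CubicalCategory.{u} N) (k : ℕ) (h : (k : ℕ∞) ≤ N) (σ : SymGroup k) :
    C.cell k →. C.cell k :=
  permAct (C.tMap k h) σ

/-- The truncation `tr_n`. -/
def tr (C : CubicalCategory.{u} N) (n : ℕ) (h : (n : ℕ∞) ≤ N) : CubicalCategory.{u} (n : ℕ∞) where
  cell := C.cell
  layer k hk := C.layer k (hk.trans_le h)
  laws k hk := C.laws k (hk.trans_le h)
  laws₂ k hk hk' := C.laws₂ k (hk.trans_le h) (hk'.trans_le h)

/-- The families `(A_i^α)` of `n`-cells with `∂_{i_j}^α A_j^β = ∂_{j_i}^β A_i^α` for `i ≠ j`. -/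
def IsShell : (n : ℕ) → (C : CubicalCategory.{u} (n : ℕ∞)) →
    (Fin (n + 1) → Bool → C.cell n) → Prop
  | 0, _, _ => True
  | n + 1, C, A => ∀ (i j : Fin (n + 2)) (h : i ≠ j) (α β : Bool),
      (C.layer n (coe_lt_succ n)).face (low i j h) α (A j β) =
        (C.layer n (coe_lt_succ n)).face (low j i h.symm) β (A i α)

/-- The set of `(n + 1)`-cells of `□C`, for a cubical `n`-category `C`. -/
def BoxCell {n : ℕ} (C : CubicalCategory.{u} (n : ℕ∞)) : Type u :=
  {A : Fin (n + 1) → Bool → C.cell n // IsShell n C A}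

theorem low_ne {n : ℕ} (a b c : Fin (n + 1)) (h₁ : a ≠ b) (h₂ : a ≠ c) (h₃ : b ≠ c) :
    low a c h₂ ≠ low b c h₃ := by
  have h₁' : (a : ℕ) ≠ b := fun e => h₁ (Fin.ext e)
  have h₂' : (a : ℕ) ≠ c := fun e => h₂ (Fin.ext e)
  have h₃' : (b : ℕ) ≠ c := fun e => h₃ (Fin.ext e)
  intro h
  have := congrArg Fin.val h
  simp only [low, Fin.lt_def] at this
  split_ifs at this <;> omega

theorem low_low {n : ℕ} (a b c : Fin (n + 2)) (h₁ : a ≠ b) (h₂ : a ≠ c) (h₃ : b ≠ c) :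
    low (low a c h₂) (low b c h₃) (low_ne a b c h₁ h₂ h₃) =
      low (low a b h₁) (low c b h₃.symm) (low_ne a c b h₂ h₁ h₃.symm) := by
  have h₁' : (a : ℕ) ≠ b := fun e => h₁ (Fin.ext e)
  have h₂' : (a : ℕ) ≠ c := fun e => h₂ (Fin.ext e)
  have h₃' : (b : ℕ) ≠ c := fun e => h₃ (Fin.ext e)
  ext
  simp only [low, Fin.lt_def]
  split_ifs <;> omega

/-- The family `ε_i A`. -/
def degFamily {k : ℕ} {X Y : Type u} (L : Layer k X Y) (i : Fin (k + 2)) (A : Y) :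
    Fin (k + 2) → Bool → Y := fun j β =>
  if h : j = i then A else L.deg (low i j (Ne.symm h)) (L.face (low j i h) β A)

/-- The family `Γ_i^α A`. -/
def connFamily {k : ℕ} {X Y : Type u} (L : Layer k X Y) (i : Fin (k + 1)) (α : Bool) (A : Y) :
    Fin (k + 2) → Bool → Y := fun j β =>
  if h : j = i.castSucc ∨ j = i.succ then
    if β = α then A else L.deg i (L.face i β A)
  else L.conn (lowGen i j h) α (L.face (low j i.castSucc fun e => h (Or.inl e)) β A)

theorem isShell_deg {m : ℕ} (C : CubicalCategory.{u} ((m + 1 : ℕ) : ℕ∞)) (i : Fin (m + 2))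
    (A : C.cell (m + 1)) :
    IsShell (m + 1) C (degFamily (C.layer m (coe_lt_succ m)) i A) := by
  intro a b h α β
  have hL := C.laws m (coe_lt_succ m)
  by_cases ha : a = i
  · subst ha
    simp [degFamily, h.symm, hL.face_deg_self]
  by_cases hb : b = i
  · subst hb
    simp [degFamily, h, hL.face_deg_self]
  cases m with
  | zero => omega
  | succ m =>
    have hM := C.laws₂ m ((coe_lt_succ m).trans (coe_lt_succ (m + 1))) (coe_lt_succ (m + 1))
    simp only [degFamily, ha, hb, dif_neg, not_false_eq_true]
    rw [hM.face_deg _ _ (low_ne a i b ha h (Ne.symm hb)),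
      hM.face_deg _ _ (low_ne b i a hb h.symm (Ne.symm ha))]
    rw [low_low i a b (Ne.symm ha) (Ne.symm hb) h]
    congr 1
    simp only [low_low a i b ha h (Ne.symm hb), low_low b i a hb h.symm (Ne.symm ha)]
    exact hM.face_face _ _ _ _ _ _

theorem isShell_conn_aux {m : ℕ} (C : CubicalCategory.{u} ((m + 1 : ℕ) : ℕ∞)) (i : Fin (m + 1))
    (γ : Bool) (A : C.cell (m + 1)) (a b : Fin (m + 2)) (h : a ≠ b) (α β : Bool)
    (ha : a = i.castSucc ∨ a = i.succ) :
    (C.layer m (coe_lt_succ m)).face (low a b h) α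
        (connFamily (C.layer m (coe_lt_succ m)) i γ A b β) =
      (C.layer m (coe_lt_succ m)).face (low b a h.symm) β
        (connFamily (C.layer m (coe_lt_succ m)) i γ A a α) := by
  have hL := C.laws m (coe_lt_succ m)
  have h' : (a : ℕ) ≠ b := fun e => h (Fin.ext e)
  have ha' : (a : ℕ) = i ∨ (a : ℕ) = i + 1 := by
    rcases ha with rfl | rfl <;> simp
  by_cases hb : b = i.castSucc ∨ b = i.succ
  · have hb' : (b : ℕ) = i ∨ (b : ℕ) = i + 1 := by
      rcases hb with rfl | rfl <;> simp
    have e1 : low a b h = i := by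
      ext; simp only [low, Fin.lt_def]; split_ifs <;> omega
    have e2 : low b a h.symm = i := by
      ext; simp only [low, Fin.lt_def]; split_ifs <;> omega
    simp only [connFamily, ha, hb, dif_pos, e1, e2]
    cases α <;> cases β <;> cases γ <;> simp [hL.face_deg_self]
  · have hb1 : (b : ℕ) ≠ i := fun e => hb (Or.inl (Fin.ext e))
    have hb2 : (b : ℕ) ≠ i + 1 := fun e => hb (Or.inr (Fin.ext e))
    cases m with
    | zero => omega
    | succ m =>
      have hM := C.laws₂ m ((coe_lt_succ m).trans (coe_lt_succ (m + 1))) (coe_lt_succ (m + 1))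
      have hn : low b i.castSucc (fun e => hb (Or.inl e)) = low b a h.symm := by
        ext; simp only [low, Fin.lt_def, Fin.val_castSucc]; split_ifs <;> omega
      have hl : low a b h = Fin.castSucc (n := m + 1) (lowGen i b hb) ∨
          low a b h = Fin.succ (n := m + 1) (lowGen i b hb) := by
        rcases ha' with ha' | ha'
        · left; ext; simp only [low, lowGen, Fin.lt_def, Fin.val_castSucc]; split_ifs <;> omega
        · right; ext; simp only [low, lowGen, Fin.lt_def, Fin.val_succ]; split_ifs <;> omega
      simp only [connFamily, ha, hb, dif_pos, dif_neg, not_false_eq_true]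
      by_cases hα : α = γ
      · subst hα
        rcases hl with hl | hl
        · rw [hl, hn]; simpa using hL.face_conn_castSucc (lowGen i b hb) α _
        · rw [hl, hn]; simpa using hL.face_conn_succ (lowGen i b hb) α _
      · obtain rfl : γ = !α := by cases α <;> cases γ <;> simp_all
        have hi : low b a h.symm ≠ i := by
          intro e
          have := congrArg Fin.val e
          simp only [low, Fin.lt_def] at this
          split_ifs at this <;> omega
        have e3 : low i (low b a h.symm) hi.symm = lowGen i b hb := by
          ext; simp only [low, lowGen, Fin.lt_def]; split_ifs <;> omega
        have key : (C.layer (m + 1) (coe_lt_succ (m + 1))).face (low a b h) α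
            ((C.layer (m + 1) (coe_lt_succ (m + 1))).conn (lowGen i b hb) (!α)
              ((C.layer (m + 1) (coe_lt_succ (m + 1))).face (low b a h.symm) β A)) =
            (C.layer m ((coe_lt_succ m).trans (coe_lt_succ (m + 1)))).deg (lowGen i b hb)
              ((C.layer m ((coe_lt_succ m).trans (coe_lt_succ (m + 1)))).face (lowGen i b hb) α
                ((C.layer (m + 1) (coe_lt_succ (m + 1))).face (low b a h.symm) β A)) := by
          rcases hl with hl | hl
          · rw [hl]; exact hM.face_conn_castSucc_not _ _ _
          · rw [hl]; exact hM.face_conn_succ_not _ _ _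
        rw [if_neg hα, hn, hM.face_deg _ _ hi, e3, hM.face_face _ _ hi, e3]
        exact key

theorem isShell_conn {m : ℕ} (C : CubicalCategory.{u} ((m + 1 : ℕ) : ℕ∞)) (i : Fin (m + 1))
    (γ : Bool) (A : C.cell (m + 1)) :
    IsShell (m + 1) C (connFamily (C.layer m (coe_lt_succ m)) i γ A) := by
  intro a b h α β
  by_cases ha : a = i.castSucc ∨ a = i.succ
  · exact isShell_conn_aux C i γ A a b h α β ha
  by_cases hb : b = i.castSucc ∨ b = i.succ
  · exact (isShell_conn_aux C i γ A b a h.symm β α hb).symm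
  have h' : (a : ℕ) ≠ b := fun e => h (Fin.ext e)
  have ha1 : (a : ℕ) ≠ i := fun e => ha (Or.inl (Fin.ext e))
  have ha2 : (a : ℕ) ≠ i + 1 := fun e => ha (Or.inr (Fin.ext e))
  have hb1 : (b : ℕ) ≠ i := fun e => hb (Or.inl (Fin.ext e))
  have hb2 : (b : ℕ) ≠ i + 1 := fun e => hb (Or.inr (Fin.ext e))
  cases m with
  | zero => omega
  | succ m =>
    have hM := C.laws₂ m ((coe_lt_succ m).trans (coe_lt_succ (m + 1))) (coe_lt_succ (m + 1))
    have hab : ¬ (low a b h = Fin.castSucc (n := m + 1) (lowGen i b hb) ∨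
        low a b h = Fin.succ (n := m + 1) (lowGen i b hb)) := by
      rintro (e | e) <;>
      · have := congrArg Fin.val e
        simp only [low, lowGen, Fin.lt_def, Fin.val_castSucc, Fin.val_succ] at this
        split_ifs at this <;> omega
    have hba : ¬ (low b a h.symm = Fin.castSucc (n := m + 1) (lowGen i a ha) ∨
        low b a h.symm = Fin.succ (n := m + 1) (lowGen i a ha)) := by
      rintro (e | e) <;>
      · have := congrArg Fin.val e
        simp only [low, lowGen, Fin.lt_def, Fin.val_castSucc, Fin.val_succ] at this
        split_ifs at this <;> omega
    simp only [connFamily, ha, hb, dif_neg, not_false_eq_true]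
    refine (hM.face_conn _ _ hab _ _ _).trans (Eq.trans ?_ (hM.face_conn _ _ hba _ _ _).symm)
    have e0 : lowGen (lowGen i b hb) (low a b h) hab = lowGen (lowGen i a ha) (low b a h.symm) hba := by
      ext; simp only [low, lowGen, Fin.lt_def]; split_ifs <;> omega
    have e1 : ∀ h₁ h₂, low (low a b h) (Fin.castSucc (n := m + 1) (lowGen i b hb)) h₁ =
        low (low a i.castSucc fun e => ha (Or.inl e)) (low b i.castSucc fun e => hb (Or.inl e)) h₂ := by
      intro h₁ h₂
      ext; simp only [low, lowGen, Fin.lt_def, Fin.val_castSucc]; split_ifs <;> omega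
    have e2 : ∀ h₁ h₂, low (low b a h.symm) (Fin.castSucc (n := m + 1) (lowGen i a ha)) h₁ =
        low (low b i.castSucc fun e => hb (Or.inl e)) (low a i.castSucc fun e => ha (Or.inl e)) h₂ := by
      intro h₁ h₂
      ext; simp only [low, lowGen, Fin.lt_def, Fin.val_castSucc]; split_ifs <;> omega
    have hne := low_ne a b i.castSucc h (fun e => ha (Or.inl e)) (fun e => hb (Or.inl e))
    rw [e0, e1 _ hne, e2 _ hne.symm]
    congr 1
    exact hM.face_face _ _ hne _ _ _

/-- The family `A ⋆_i B`. -/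
def compFamily {k : ℕ} {X Y : Type u} (L : Layer k X Y) (i : Fin (k + 2))
    (A B : Fin (k + 2) → Bool → Y)
    (h : ∀ j (h : j ≠ i) α, L.face (low i j h.symm) true (A j α) =
      L.face (low i j h.symm) false (B j α)) :
    Fin (k + 2) → Bool → Y := fun j α =>
  if hj : j = i then (if α then B i true else A i false)
  else L.comp (low i j (Ne.symm hj)) (A j α) (B j α) (h j hj α)

theorem compFamily_aux {m : ℕ} (C : CubicalCategory.{u} ((m + 1 : ℕ) : ℕ∞)) (i : Fin (m + 2))
    (A B : BoxCell C) (h : A.1 i true = B.1 i false) (j : Fin (m + 2)) (hj : j ≠ i) (α : Bool) :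
    (C.layer m (coe_lt_succ m)).face (low i j hj.symm) true (A.1 j α) =
      (C.layer m (coe_lt_succ m)).face (low i j hj.symm) false (B.1 j α) := by
  rw [A.2 i j hj.symm true α, B.2 i j hj.symm false α, h]

theorem isShell_comp_aux {m : ℕ} (C : CubicalCategory.{u} ((m + 1 : ℕ) : ℕ∞)) (i : Fin (m + 2))
    (A B : BoxCell C) (h : A.1 i true = B.1 i false) (b : Fin (m + 2)) (hb : i ≠ b) (α β : Bool) :
    (C.layer m (coe_lt_succ m)).face (low i b hb) α
        (compFamily (C.layer m (coe_lt_succ m)) i A.1 B.1 (compFamily_aux C i A B h) b β) =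
      (C.layer m (coe_lt_succ m)).face (low b i hb.symm) β
        (compFamily (C.layer m (coe_lt_succ m)) i A.1 B.1 (compFamily_aux C i A B h) i α) := by
  have hL := C.laws m (coe_lt_succ m)
  simp only [compFamily, hb.symm, dif_neg, not_false_eq_true, dif_pos]
  cases α with
  | true =>
    rw [hL.face_comp_true _ _ _ _ ⟨_, rfl⟩]
    exact B.2 i b hb true β
  | false =>
    rw [hL.face_comp_false _ _ _ _ ⟨_, rfl⟩]
    exact A.2 i b hb false β

theorem isShell_comp {m : ℕ} (C : CubicalCategory.{u} ((m + 1 : ℕ) : ℕ∞)) (i : Fin (m + 2))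
    (A B : BoxCell C) (h : A.1 i true = B.1 i false) :
    IsShell (m + 1) C
      (compFamily (C.layer m (coe_lt_succ m)) i A.1 B.1 (compFamily_aux C i A B h)) := by
  intro a b hab α β
  by_cases ha : a = i
  · subst ha
    exact isShell_comp_aux C a A B h b hab α β
  by_cases hb : b = i
  · subst hb
    exact (isShell_comp_aux C b A B h a hab.symm β α).symm
  cases m with
  | zero => omega
  | succ m =>
    have hM := C.laws₂ m ((coe_lt_succ m).trans (coe_lt_succ (m + 1))) (coe_lt_succ (m + 1))
    simp only [compFamily, ha, hb, dif_neg, not_false_eq_true]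
    obtain ⟨h₁, e₁⟩ := hM.face_comp _ _ (low_ne a i b ha hab (Ne.symm hb)) α _ _ _
      ⟨compFamily_aux C i A B h b hb β, rfl⟩
    obtain ⟨h₂, e₂⟩ := hM.face_comp _ _ (low_ne b i a hb hab.symm (Ne.symm ha)) β _ _ _
      ⟨compFamily_aux C i A B h a ha α, rfl⟩
    rw [← e₁, ← e₂]
    have e3 := low_low i a b (Ne.symm ha) (Ne.symm hb) hab
    have e4 := A.2 a b hab α β
    have e5 := B.2 a b hab α β
    congr 1

/-- The structure of the `(n + 1)`-category `□C` between dimensions `n` and `n + 1`, for a cubical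
`n`-category `C`; in dimensions up to `n`, `□C` is `C`. -/
def boxLayer : (n : ℕ) → (C : CubicalCategory.{u} (n : ℕ∞)) → Layer n (C.cell n) (BoxCell C)
  | 0, _ =>
    { face := fun i α A => A.1 i α
      deg := fun _ A => ⟨fun _ _ => A, trivial⟩
      conn := fun i => i.elim0
      comp := fun i A B _ => ⟨fun _ α => if α then B.1 i true else A.1 i false, trivial⟩ }
  | _ + 1, C =>
    { face := fun i α A => A.1 i α
      deg := fun i A => ⟨_, isShell_deg C i A⟩
      conn := fun i α A => ⟨_, isShell_conn C i α A⟩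
      comp := fun i A B h => ⟨_, isShell_comp C i A B h⟩ }

/-- The partial map `A ↦ σ · A` on the `(n + 1)`-cells of `□C`, for `σ ∈ S_{n+1}`. -/
noncomputable def boxAct {n : ℕ} (C : CubicalCategory.{u} (n : ℕ∞)) (σ : SymGroup (n + 1)) :
    BoxCell C →. BoxCell C :=
  permAct (boxLayer n C).tMap σ

end CubicalCategory

namespace CubicalOmegaCategory

/-- An `(n + 1)`-cell is (plainly) invertible. -/
def Invertible (C : CubicalOmegaCategory.{u}) {n : ℕ} (A : C.cell (n + 1)) : Prop :=
  (C.layer n (ENat.natCast_lt_top n)).Invertible (C.laws n (ENat.natCast_lt_top n)) A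

/-- The shell `∂A = (∂_i^α A)` of an `(n + 1)`-cell `A`, as an `(n + 1)`-cell of `□ tr_n C`. -/
def shell (C : CubicalOmegaCategory.{u}) {n : ℕ} (A : C.cell (n + 1)) :
    (C.tr n le_top).BoxCell :=
  ⟨fun i α => (C.layer n (ENat.natCast_lt_top n)).face i α A, by
    cases n with
    | zero => trivial
    | succ n =>
      intro i j h α β
      exact (C.laws₂ n (ENat.natCast_lt_top n) (ENat.natCast_lt_top (n + 1))).face_face i j h α β A⟩

end CubicalOmegaCategory

end Cubical

open Cubical

open Cubical

namespace Cubical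

/-! ## Permutations and reduced words -/

/-! A word is a diagram of strings, and `∂_i` erases the string that starts at `i`. The permutation
of the remaining diagram is `j ↦ (j^i · σ)_{i · σ}`, which depends on the word only through its
permutation `σ` (`ract_bar_wordFace`). This gives all of (1) without a check of the relations.
Erasing a string also keeps words reduced, because two strings cross at most once in a reduced word
(`reduced_listFace`).

The directions `i` and `i + 1` of a cubical category form a double category with connections. There
a square is determined by its faces and its folding `ψ_i A`, and every folding with compatible faces
can be unfolded. Hence `A` and `B` are `T_i`-inverse exactly if their faces are exchanged and `ψ_i
A`, `ψ_i B` are inverse for `⋆_i` (`DCat.T.iff`). So `A` is `T_i`-invertible exactly if `ψ_i A` is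
`R_i`-invertible. Moreover `R_{i+1}`-invertible cells are `T_i`-invertible, with a converse when the
faces in direction `i` are `R_i`-invertible.

For one letter, (3) says that `A` is `T_i`-invertible exactly if it is invertible and its faces in
the other directions have the induced `T`-inverses (`hasT_iff`). The proof moves along the iterated
foldings `ψ_m ⋯ ψ_{n-1} A`. It needs `T_i`-invertibility to pass through `ψ_j` for `j > i` in both
directions. The hard point is that `Γ_{i+1}^α y` is `T_i`-invertible if `y` is, with `T_{i+1} T_i
Γ_{i+1}^α y = Γ_i^α T_i y` (`exists_isT_cn`). This relies on thin cells, whose double folding is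
degenerate: they are closed under composition and determined by their faces. The same formula lets
`T_{i+1} T_i` carry `ψ_{i+1}` to `ψ_i`, whence the braid relation for the `T_i`.

An equation between shells is tested on faces. So a `T_i`-inverse of a shell has two pairs of faces
exchanged and the other faces transposed (`box_isTInverse_iff`), and by induction on words the faces
of `u · A` are the `∂_j u · A_{j · u}^α`. This gives (2) for words, and lifting one letter at a time
gives (3) for words.

Passing from words to permutations requires that all reduced words of `σ` act alike
(`act_of_reduced`). This goes by induction on the dimension: invertibility depends on `σ` only, by
(3) and by the shell case one dimension lower, and the values agree by Matsumoto's argument from the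
commutation and braid relations. -/

theorem ract_mul {n : ℕ} (k : Fin n) (σ τ : SymGroup n) : ract k (σ * τ) = ract (ract k σ) τ := rfl

theorem ract_one {n : ℕ} (k : Fin n) : ract k (1 : SymGroup n) = k := rfl

theorem symGroup_ext {n : ℕ} {σ τ : SymGroup n} (h : ∀ k, ract k σ = ract k τ) : σ = τ :=
  MulOpposite.unop_injective (Equiv.ext h)

/-- The direction `j` as an index of `{1, …, n}`. -/
def lft {n : ℕ} (j : Fin (n - 1)) : Fin n := ⟨j, by have := j.2; omega⟩

/-- The direction `j + 1` as an index of `{1, …, n}`. -/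
def rgt {n : ℕ} (j : Fin (n - 1)) : Fin n := ⟨j + 1, by have := j.2; omega⟩

theorem ract_transp_val {n : ℕ} (k : Fin n) (j : Fin (n - 1)) :
    (ract k (transp j) : ℕ) =
      if (k : ℕ) = j then (j : ℕ) + 1 else if (k : ℕ) = j + 1 then (j : ℕ) else k := by
  simp only [ract, transp, MulOpposite.unop_op, Equiv.swap_apply_def, Fin.ext_iff]
  split_ifs <;> rfl

theorem ract_lft {n : ℕ} (j : Fin (n - 1)) : ract (lft j) (transp j) = rgt j := by
  ext; simp [ract_transp_val, lft, rgt]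

theorem ract_rgt {n : ℕ} (j : Fin (n - 1)) : ract (rgt j) (transp j) = lft j := by
  ext; simp [ract_transp_val, lft, rgt]

theorem transp_mul_transp {n : ℕ} (j : Fin (n - 1)) : transp j * transp j = (1 : SymGroup n) := by
  apply symGroup_ext
  intro k
  ext
  simp only [ract_mul, ract_transp_val, ract_one]
  split_ifs <;> omega

theorem transp_mul_cancel {n : ℕ} (j : Fin (n - 1)) (σ : SymGroup n) :
    transp j * (transp j * σ) = σ := by
  rw [← mul_assoc, transp_mul_transp, one_mul]

theorem ract_transp_of_ne {n : ℕ} (k : Fin n) (j : Fin (n - 1)) (h : (k : ℕ) ≠ j)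
    (h' : (k : ℕ) ≠ j + 1) : ract k (transp j) = k := by
  ext; rw [ract_transp_val, if_neg h, if_neg h']

theorem transp_braid {n : ℕ} (i j : Fin (n - 1)) (h : (j : ℕ) = i + 1) :
    transp i * transp j * transp i = (transp j * transp i * transp j : SymGroup n) := by
  have e : rgt i = lft j := by ext; simp [rgt, lft, h]
  have hi : ract (rgt j) (transp i) = rgt j :=
    ract_transp_of_ne _ _ (by simp [rgt, h]; omega) (by simp [rgt, h])
  have hj : ract (lft i) (transp j) = lft i :=
    ract_transp_of_ne _ _ (by simp [lft, h]) (by simp [lft, h]; omega)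
  have hi1 := ract_lft i
  have hi2 := ract_rgt i
  have hj1 := ract_lft j
  have hj2 := ract_rgt j
  rw [e] at hi1 hi2
  apply symGroup_ext
  intro k
  simp only [ract_mul]
  by_cases h1 : k = lft i
  · rw [h1, hi1, hj1, hi, hj, hi1, hj1]
  by_cases h2 : k = lft j
  · rw [h2, hi2, hj, hi1, hj1, hi, hj2]
  by_cases h3 : k = rgt j
  · rw [h3, hi, hj2, hi2, hj]
  simp only [lft, rgt, Fin.ext_iff] at h1 h2 h3
  have e1 := ract_transp_of_ne k i h1 (by omega)
  have e2 := ract_transp_of_ne k j h2 (by omega)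
  rw [e1, e2, e1, e2]

theorem transp_comm {n : ℕ} (i j : Fin (n - 1)) (h : (i : ℕ) + 2 ≤ j ∨ (j : ℕ) + 2 ≤ i) :
    transp i * transp j = (transp j * transp i : SymGroup n) := by
  apply symGroup_ext
  intro k
  ext
  simp only [ract_mul, ract_transp_val]
  split_ifs <;> omega

/-- The permutation of a list of letters. -/
def listBar {n : ℕ} (l : List (Fin (n - 1))) : SymGroup n := bar (FreeMonoid.ofList l)

theorem listBar_cons {n : ℕ} (i : Fin (n - 1)) (l : List (Fin (n - 1))) :
    listBar (i :: l) = transp i * listBar l := by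
  simp [listBar, bar, FreeMonoid.ofList_cons]

theorem bar_eq_of_conGen {n : ℕ} {v w : Word n} (h : conGen (CoxeterRel n) v w) :
    bar v = bar w := by
  have : conGen (CoxeterRel n) ≤ Con.ker bar := by
    rw [Con.conGen_le]
    intro a b hab
    rw [Con.ker_rel]
    cases hab with
    | sq i => simpa [bar] using transp_mul_transp i
    | braid i j h => simpa [bar] using transp_braid i j h
    | comm i j h => simpa [bar] using transp_comm i j h
  exact this h

/-! ### Faces of words -/

theorem low_val {n : ℕ} (j i : Fin (n + 1)) (h : j ≠ i) :
    (low j i h : ℕ) = if (j : ℕ) < i then (j : ℕ) else j - 1 := rfl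

theorem succAbove_val {n : ℕ} (i : Fin (n + 1)) (j : Fin n) :
    (i.succAbove j : ℕ) = if (j : ℕ) < i then (j : ℕ) else j + 1 := by
  simp only [Fin.succAbove, Fin.lt_def, Fin.val_castSucc]
  split_ifs <;> rfl

theorem succAbove_low {n : ℕ} (j i : Fin (n + 1)) (h : j ≠ i) : i.succAbove (low j i h) = j := by
  have h' : (j : ℕ) ≠ i := fun e => h (Fin.ext e)
  ext
  simp only [succAbove_val, low_val]
  split_ifs <;> omega

theorem low_lt_low {n : ℕ} {a b i : Fin (n + 1)} (ha : a ≠ i) (hb : b ≠ i) (h : a < b) :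
    low a i ha < low b i hb := by
  have ha' : (a : ℕ) ≠ i := fun e => ha (Fin.ext e)
  have hb' : (b : ℕ) ≠ i := fun e => hb (Fin.ext e)
  rw [Fin.lt_def] at h ⊢
  simp only [low_val]
  split_ifs <;> omega

theorem bar_genFace {n : ℕ} (i : Fin (n + 1)) (t : Fin n) :
    bar (genFace i t) =
      if h : i = t.castSucc ∨ i = t.succ then 1 else transp (lowGen t i h) := by
  unfold genFace
  split_ifs <;> simp [bar]

theorem ract_bar_genFace {n : ℕ} (i : Fin (n + 1)) (t : Fin n) (j : Fin n) :
    ract j (bar (genFace i t)) =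
      low (ract (i.succAbove j) (transp (n := n + 1) t)) (ract i (transp (n := n + 1) t))
        (ract_ne _ _ _) := by
  rw [bar_genFace]
  ext
  split_ifs with h
  · have : (i : ℕ) = t ∨ (i : ℕ) = t + 1 := by rcases h with rfl | rfl <;> simp
    simp only [ract_one, low_val, ract_transp_val, succAbove_val]
    split_ifs <;> omega
  · have h1 : (i : ℕ) ≠ t := fun e => h (Or.inl (Fin.ext e))
    have h2 : (i : ℕ) ≠ t + 1 := fun e => h (Or.inr (Fin.ext e))
    simp only [low_val, ract_transp_val, succAbove_val, lowGen]
    split_ifs <;> omega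

theorem low_congr {n : ℕ} {a a' b b' : Fin (n + 1)} (ha : a = a') (hb : b = b') (h : a ≠ b) :
    low a b h = low a' b' (ha ▸ hb ▸ h) := by
  subst ha hb; rfl

theorem listFace_cons {n : ℕ} (i : Fin (n + 1)) (t : Fin n) (l : List (Fin n)) :
    listFace i (t :: l) = genFace i t * listFace (ract i (transp (n := n + 1) t)) l := rfl

/-- The formula is stable under concatenation because `succAbove` undoes `low`: the positions left
after erasing a string are renumbered and then numbered back. -/
theorem ract_bar_listFace {n : ℕ} (l : List (Fin n)) : ∀ (i : Fin (n + 1)) (j : Fin n),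
    ract j (bar (listFace i l)) =
      low (ract (i.succAbove j) (listBar (n := n + 1) l)) (ract i (listBar (n := n + 1) l))
        (ract_ne _ _ _) := by
  induction l with
  | nil =>
    intro i j
    ext
    rw [show listBar (n := n + 1) [] = 1 from rfl]
    simp only [listFace, map_one, ract_one, low_val, succAbove_val]
    split_ifs <;> omega
  | cons t l ih =>
    intro i j
    rw [listFace_cons, map_mul, ract_mul, ih, ract_bar_genFace]
    apply low_congr
    · rw [succAbove_low, listBar_cons (n := n + 1) t l, ract_mul]
    · rw [listBar_cons (n := n + 1) t l, ract_mul]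

theorem ract_bar_wordFace {n : ℕ} (w : Word (n + 1)) (i : Fin (n + 1)) (j : Fin n) :
    ract j (bar (wordFace i w)) =
      low (ract (i.succAbove j) (bar w)) (ract i (bar w)) (ract_ne _ _ _) :=
  ract_bar_listFace w.toList i j

/-- The right-hand side of `ract_bar_wordFace` involves the word only through `bar`. Compatibility
with every relation of the symmetric group follows at once. -/
theorem bar_wordFace_congr {n : ℕ} (i : Fin (n + 1)) {v w : Word (n + 1)} (h : bar v = bar w) :
    bar (wordFace i v) = bar (wordFace i w) := by
  apply symGroup_ext
  intro j
  rw [ract_bar_wordFace, ract_bar_wordFace]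
  exact low_congr (by rw [h]) (by rw [h]) _

/-! ### Inversions and reduced words -/

/-- The set of inversions of a permutation. -/
def inversions {n : ℕ} (σ : SymGroup n) : Finset (Fin n × Fin n) :=
  Finset.univ.filter fun p => p.1 < p.2 ∧ ract p.2 σ < ract p.1 σ

theorem mem_inversions {n : ℕ} (σ : SymGroup n) (a b : Fin n) :
    (a, b) ∈ inversions σ ↔ a < b ∧ ract b σ < ract a σ := by
  simp [inversions]

/-- Relabelling pairs by the transposition carries the inversions of `σ` injectively to inversions
of the product. The only new one is the pair `(i, i + 1)` itself. -/
theorem card_inversions_of_lt {n : ℕ} (i : Fin (n - 1)) (σ : SymGroup n)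
    (h : ract (lft i) σ < ract (rgt i) σ) :
    (inversions (transp i * σ)).card = (inversions σ).card + 1 := by
  have hs (k : Fin n) : ract (ract k (transp i)) (transp i) = k := by
    rw [← ract_mul, transp_mul_transp, ract_one]
  have hinj : Function.Injective fun p : Fin n × Fin n =>
      (ract p.1 (transp i), ract p.2 (transp i)) := by
    rintro ⟨a, b⟩ ⟨c, d⟩ e
    simp only [Prod.mk.injEq] at e
    rw [Prod.mk.injEq, ← hs a, ← hs b, e.1, e.2, hs, hs]
    exact ⟨rfl, rfl⟩
  have key : inversions (transp i * σ) = insert (lft i, rgt i) ((inversions σ).image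
      fun p : Fin n × Fin n => (ract p.1 (transp i), ract p.2 (transp i))) := by
    ext ⟨a, b⟩
    simp only [mem_inversions, ract_mul,
      Finset.mem_insert, Finset.mem_image, Prod.mk.injEq, Prod.exists]
    constructor
    · rintro ⟨h1, h2⟩
      by_cases hab : a = lft i ∧ b = rgt i
      · exact Or.inl hab
      · refine Or.inr ⟨_, _, ⟨?_, h2⟩, hs a, hs b⟩
        rw [Fin.lt_def] at h1 ⊢
        simp only [Fin.ext_iff, lft, rgt] at hab
        simp only [ract_transp_val]
        split_ifs <;> omega
    · rintro (⟨rfl, rfl⟩ | ⟨c, d, ⟨h1, h2⟩, rfl, rfl⟩)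
      · rw [ract_lft, ract_rgt]
        refine ⟨?_, h⟩
        simp [lft, rgt, Fin.lt_def]
      · rw [hs, hs]
        refine ⟨?_, h2⟩
        have hcd : ¬ (c = lft i ∧ d = rgt i) := by
          rintro ⟨rfl, rfl⟩; exact absurd h2 h.asymm
        rw [Fin.lt_def] at h1 ⊢
        simp only [Fin.ext_iff, lft, rgt] at hcd
        simp only [ract_transp_val]
        split_ifs <;> omega
  rw [key, Finset.card_insert_of_notMem, Finset.card_image_of_injective _ hinj]
  simp only [mem_inversions, Finset.mem_image,
    Prod.mk.injEq, Prod.exists, not_exists]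
  rintro c d ⟨⟨h1, h2⟩, h3, h4⟩
  have h5 : c = rgt i := by rw [← hs c, h3, ract_lft]
  have h6 : d = lft i := by rw [← hs d, h4, ract_rgt]
  subst h5 h6
  simp [lft, rgt, Fin.lt_def] at h1

theorem card_inversions_of_gt {n : ℕ} (i : Fin (n - 1)) (σ : SymGroup n)
    (h : ract (rgt i) σ < ract (lft i) σ) :
    (inversions (transp i * σ)).card + 1 = (inversions σ).card := by
  have := card_inversions_of_lt i (transp i * σ) (by
    rwa [ract_mul, ract_mul, ract_lft, ract_rgt])
  rw [transp_mul_cancel] at this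
  exact this.symm

theorem lft_ne_rgt {n : ℕ} (i : Fin (n - 1)) : lft i ≠ rgt i := by
  simp [lft, rgt, Fin.ext_iff]

theorem ract_lft_ne {n : ℕ} (i : Fin (n - 1)) (σ : SymGroup n) :
    ract (lft i) σ ≠ ract (rgt i) σ :=
  fun h => lft_ne_rgt i (σ.unop.injective h)

/-- A list of letters is reduced if each letter, read from the right, creates an inversion. -/
def Reduced {n : ℕ} : List (Fin (n - 1)) → Prop
  | [] => True
  | i :: l => Reduced l ∧ ract (lft i) (listBar l) < ract (rgt i) (listBar l)

theorem card_inversions_le {n : ℕ} (l : List (Fin (n - 1))) :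
    (inversions (listBar l)).card ≤ l.length := by
  induction l with
  | nil =>
    rw [List.length_nil, Nat.le_zero, Finset.card_eq_zero, Finset.eq_empty_iff_forall_notMem]
    rintro ⟨a, b⟩ h
    rw [mem_inversions] at h
    exact h.1.asymm h.2
  | cons i l ih =>
    rw [listBar_cons, List.length_cons]
    rcases lt_or_gt_of_ne (ract_lft_ne i (listBar l)) with h | h
    · rw [card_inversions_of_lt _ _ h]; omega
    · have := card_inversions_of_gt _ _ h; omega

/-- Each letter changes the number of inversions by one, so the length is attained only if every
letter creates an inversion. -/
theorem reduced_iff {n : ℕ} (l : List (Fin (n - 1))) :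
    Reduced l ↔ (inversions (listBar l)).card = l.length := by
  induction l with
  | nil => exact ⟨fun _ => Nat.le_zero.1 (card_inversions_le []), fun _ => trivial⟩
  | cons i l ih =>
    rw [Reduced, ih, listBar_cons, List.length_cons]
    rcases lt_or_gt_of_ne (ract_lft_ne i (listBar l)) with h | h
    · rw [card_inversions_of_lt _ _ h]; simp [h]
    · have := card_inversions_of_gt _ _ h
      have := card_inversions_le l
      constructor
      · exact fun h' => absurd h'.2 h.asymm
      · omega

/-- Without descents `σ` is a strictly increasing bijection of a finite chain, and a finite chain
has no automorphism but the identity. -/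
theorem eq_one_of_no_descent {n : ℕ} (σ : SymGroup n)
    (h : ∀ i : Fin (n - 1), ract (lft i) σ < ract (rgt i) σ) : σ = 1 := by
  cases n with
  | zero => exact symGroup_ext fun k => k.elim0
  | succ n =>
    have hm : StrictMono fun k => ract k σ := by
      rw [Fin.strictMono_iff_lt_succ]
      exact fun i => h i
    apply symGroup_ext
    intro k
    have := (hm.orderIsoOfSurjective _ σ.unop.surjective)
    have e : this = OrderIso.refl _ := Subsingleton.elim _ _
    have h2 : (hm.orderIsoOfSurjective _ σ.unop.surjective) = OrderIso.refl _ :=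
      Subsingleton.elim _ _
    exact congrArg (fun f => f k) h2

theorem exists_reduced {n : ℕ} (σ : SymGroup n) : ∃ l, listBar l = σ ∧ Reduced l := by
  induction hN : (inversions σ).card using Nat.strong_induction_on generalizing σ with
  | _ N ih =>
    by_cases h : ∀ i : Fin (n - 1), ract (lft i) σ < ract (rgt i) σ
    · exact ⟨[], (eq_one_of_no_descent σ h).symm, trivial⟩
    · push Not at h
      obtain ⟨i, hi⟩ := h
      have hi' := lt_of_le_of_ne hi (ract_lft_ne i σ).symm
      have hc := card_inversions_of_gt _ _ hi'
      obtain ⟨l, hlσ, hl⟩ := ih _ (by omega) (transp i * σ) rfl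
      refine ⟨i :: l, ?_, hl, ?_⟩
      · rw [listBar_cons, hlσ, transp_mul_cancel]
      · rwa [hlσ, ract_mul, ract_mul, ract_lft, ract_rgt]

/-- The minimal length is the number of inversions. This replaces minimality among all words by a
condition that is recursive on letters. -/
theorem isMinRep_iff {n : ℕ} (u : Word n) (σ : SymGroup n) :
    IsMinRep u σ ↔ bar u = σ ∧ Reduced u.toList := by
  have hlen (v : Word n) (hv : bar v = σ) : (inversions σ).card ≤ v.length := by
    rw [← hv]; exact card_inversions_le v.toList
  constructor
  · rintro ⟨h1, h2⟩
    refine ⟨h1, (reduced_iff _).2 ?_⟩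
    obtain ⟨l, h3, h4⟩ := exists_reduced σ
    have h5 := (reduced_iff _).1 h4
    rw [h3] at h5
    have h6 : u.length ≤ l.length := h2 (FreeMonoid.ofList l) h3
    have h7 : u.length = u.toList.length := rfl
    have h8 := hlen u h1
    have h9 : listBar u.toList = σ := h1
    rw [h9]; omega
  · rintro ⟨h1, h2⟩
    refine ⟨h1, fun v hv => ?_⟩
    have h3 := (reduced_iff _).1 h2
    have h9 : listBar u.toList = σ := h1
    have h7 : u.length = u.toList.length := rfl
    rw [h7, ← h3, h9]
    exact hlen v hv

theorem bar_surjective {n : ℕ} : Function.Surjective (bar : Word n → SymGroup n) := fun σ => by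
  obtain ⟨l, h, -⟩ := exists_reduced σ
  exact ⟨FreeMonoid.ofList l, h⟩

/-- A crossing that survives the deletion involves two strings other than the deleted one. Their
relative order is unchanged, since `low` is increasing. -/
theorem reduced_listFace {n : ℕ} (l : List (Fin n)) : ∀ (i : Fin (n + 1)),
    Reduced (n := n + 1) l → Reduced (listFace i l).toList := by
  induction l with
  | nil => exact fun _ _ => trivial
  | cons t l ih =>
    rintro i ⟨h1, h2⟩
    rw [listFace_cons]
    unfold genFace
    split_ifs with h
    · rw [one_mul]; exact ih _ h1
    · have hi1 : (i : ℕ) ≠ t := fun e => h (Or.inl (Fin.ext e))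
      have hi2 : (i : ℕ) ≠ t + 1 := fun e => h (Or.inr (Fin.ext e))
      have hi : ract i (transp (n := n + 1) t) = i := by
        ext; rw [ract_transp_val, if_neg hi1, if_neg hi2]
      rw [hi]
      refine ⟨ih _ h1, ?_⟩
      have e (k : Fin n) : ract k (listBar (listFace i l).toList) =
        low (ract (i.succAbove k) (listBar (n := n + 1) l)) (ract i (listBar (n := n + 1) l))
          (ract_ne _ _ _) := ract_bar_listFace l i k
      show ract _ (listBar (listFace i l).toList) < ract _ (listBar (listFace i l).toList)
      rw [e, e]
      apply low_lt_low
      have e1 : i.succAbove (lft (lowGen t i h)) = lft (n := n + 1) t := by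
        ext; simp only [succAbove_val, lft, lowGen]; split_ifs <;> omega
      have e2 : i.succAbove (rgt (lowGen t i h)) = rgt (n := n + 1) t := by
        ext; simp only [succAbove_val, rgt, lowGen]; split_ifs <;> omega
      rw [e1, e2]
      exact h2

/-! ### The induced maps on permutations -/

/-- The map `∂_i` on permutations. -/
noncomputable def permFace (n : ℕ) (i : Fin (n + 1)) (σ : SymGroup (n + 1)) : SymGroup n :=
  bar (wordFace i (bar_surjective σ).choose)

theorem permFace_bar (n : ℕ) (i : Fin (n + 1)) (w : Word (n + 1)) :
    permFace n i (bar w) = bar (wordFace i w) :=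
  bar_wordFace_congr i (bar_surjective (bar w)).choose_spec

theorem ract_permFace (n : ℕ) (i : Fin (n + 1)) (σ : SymGroup (n + 1)) (j : Fin n) :
    ract j (permFace n i σ) =
      low (ract (i.succAbove j) σ) (ract i σ) (ract_ne i σ j) := by
  obtain ⟨w, rfl⟩ := bar_surjective σ
  rw [permFace_bar, ract_bar_wordFace]


/-! ## Double categories with connections -/

/-- The operations of an edge-symmetric double category with connections: objects `O`, edges `E`
and squares `S`. The faces, degeneracies and compositions of squares in the two directions are
`f1`, `d1`, `v` and `f2`, `d2`, `h`; compositions are total, with irrelevant values where the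
faces do not match. -/
structure DCat (O E S : Type u) where
  b : Bool → E → O
  e : O → E
  m : E → E → E
  f1 : Bool → S → E
  f2 : Bool → S → E
  d1 : E → S
  d2 : E → S
  g : Bool → E → S
  v : S → S → S
  h : S → S → S

namespace DCat

/-- The axioms of an edge-symmetric double category with connections. -/
class Laws {O E S : Type u} (D : DCat O E S) : Prop where
  b_e : ∀ α o, D.b α (D.e o) = o
  b_m_false : ∀ x y, D.b true x = D.b false y → D.b false (D.m x y) = D.b false x
  b_m_true : ∀ x y, D.b true x = D.b false y → D.b true (D.m x y) = D.b true y
  m_assoc : ∀ x y z, D.b true x = D.b false y → D.b true y = D.b false z →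
    D.m (D.m x y) z = D.m x (D.m y z)
  -- The unit laws keep the degenerate part as a variable with an equation, so that they can be
  -- matched before that equation is proved.
  e_m : ∀ x o, o = D.b false x → D.m (D.e o) x = x
  m_e : ∀ x o, o = D.b true x → D.m x (D.e o) = x
  b_f1 : ∀ α β A, D.b α (D.f1 β A) = D.b β (D.f2 α A)
  f1_v_false : ∀ A B, D.f1 true A = D.f1 false B → D.f1 false (D.v A B) = D.f1 false A
  f1_v_true : ∀ A B, D.f1 true A = D.f1 false B → D.f1 true (D.v A B) = D.f1 true B
  f2_v : ∀ α A B, D.f1 true A = D.f1 false B → D.f2 α (D.v A B) = D.m (D.f2 α A) (D.f2 α B)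
  f2_h_false : ∀ A B, D.f2 true A = D.f2 false B → D.f2 false (D.h A B) = D.f2 false A
  f2_h_true : ∀ A B, D.f2 true A = D.f2 false B → D.f2 true (D.h A B) = D.f2 true B
  f1_h : ∀ α A B, D.f2 true A = D.f2 false B → D.f1 α (D.h A B) = D.m (D.f1 α A) (D.f1 α B)
  f1_d1 : ∀ α x, D.f1 α (D.d1 x) = x
  f2_d1 : ∀ α x, D.f2 α (D.d1 x) = D.e (D.b α x)
  f2_d2 : ∀ α x, D.f2 α (D.d2 x) = x
  f1_d2 : ∀ α x, D.f1 α (D.d2 x) = D.e (D.b α x)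
  v_assoc : ∀ A B C, D.f1 true A = D.f1 false B → D.f1 true B = D.f1 false C →
    D.v (D.v A B) C = D.v A (D.v B C)
  h_assoc : ∀ A B C, D.f2 true A = D.f2 false B → D.f2 true B = D.f2 false C →
    D.h (D.h A B) C = D.h A (D.h B C)
  d1_v : ∀ A x, x = D.f1 false A → D.v (D.d1 x) A = A
  v_d1 : ∀ A x, x = D.f1 true A → D.v A (D.d1 x) = A
  d2_h : ∀ A x, x = D.f2 false A → D.h (D.d2 x) A = A
  h_d2 : ∀ A x, x = D.f2 true A → D.h A (D.d2 x) = A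
  d1_m : ∀ x y, D.b true x = D.b false y → D.d1 (D.m x y) = D.h (D.d1 x) (D.d1 y)
  d1_e : ∀ o, D.d1 (D.e o) = D.d2 (D.e o)
  exch : ∀ A B C E, D.f1 true A = D.f1 false B → D.f1 true C = D.f1 false E →
    D.f2 true A = D.f2 false C → D.f2 true B = D.f2 false E →
    D.h (D.v A B) (D.v C E) = D.v (D.h A C) (D.h B E)
  f1_g : ∀ α x, D.f1 α (D.g α x) = x
  f2_g : ∀ α x, D.f2 α (D.g α x) = x
  f1_g_true : ∀ x, D.f1 false (D.g true x) = D.e (D.b false x)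
  f1_g_false : ∀ x, D.f1 true (D.g false x) = D.e (D.b true x)
  f2_g_true : ∀ x, D.f2 false (D.g true x) = D.e (D.b false x)
  f2_g_false : ∀ x, D.f2 true (D.g false x) = D.e (D.b true x)
  g_e : ∀ α o, D.g α (D.e o) = D.d2 (D.e o)
  v_g : ∀ x, D.v (D.g true x) (D.g false x) = D.d2 x
  h_g : ∀ x, D.h (D.g true x) (D.g false x) = D.d1 x
  g_m_true : ∀ x y, D.b true x = D.b false y →
    D.g true (D.m x y) = D.h (D.v (D.g true x) (D.d1 x)) (D.v (D.d2 x) (D.g true y))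
  g_m_false : ∀ x y, D.b true x = D.b false y →
    D.g false (D.m x y) = D.h (D.v (D.g false x) (D.d2 y)) (D.v (D.d1 y) (D.g false y))

namespace Laws

attribute [simp] b_e b_m_false b_m_true e_m m_e b_f1 f1_v_false f1_v_true f2_v f2_h_false f2_h_true
  f1_h f1_d1 f2_d1 f2_d2 f1_d2 d1_v v_d1 d2_h h_d2 d1_e f1_g f2_g f1_g_true f1_g_false f2_g_true
  f2_g_false g_e v_g h_g

end Laws

/-- The folding operation. -/
def psi {O E S : Type u} (D : DCat O E S) (A : S) : S :=
  D.h (D.h (D.g true (D.f2 false A)) A) (D.g false (D.f2 true A))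

/-- The square with faces `p`, `q`, `r`, `s` and folding `x`. -/
def unf {O E S : Type u} (D : DCat O E S) (p q r s : E) (x : S) : S :=
  D.v (D.v (D.h (D.d1 p) (D.g true s)) x) (D.h (D.g false r) (D.d1 q))

open Laws

variable {O E S : Type u} (D : DCat O E S) [D.Laws]

/-! ### Folding and unfolding squares in a double category with connections. -/

section Folding

@[simp] theorem d2e_v (A : S) (o : O) (h : D.e o = D.f1 false A) : D.v (D.d2 (D.e o)) A = A := by
  rw [← d1_e, d1_v _ _ h]

@[simp] theorem v_d2e (A : S) (o : O) (h : D.e o = D.f1 true A) : D.v A (D.d2 (D.e o)) = A := by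
  rw [← d1_e, v_d1 _ _ h]

theorem f1_psi_false (A : S) : D.f1 false (D.psi A) = D.m (D.f1 false A) (D.f2 true A) := by
  -- Every law has composability conditions, which are proved by other laws with conditions of their
  -- own; hence the larger discharge depth.
  simp (maxDischargeDepth := 9) [psi]

theorem f1_psi_true (A : S) : D.f1 true (D.psi A) = D.m (D.f2 false A) (D.f1 true A) := by
  simp (maxDischargeDepth := 9) [psi]

theorem f2_psi_false (A : S) : D.f2 false (D.psi A) = D.e (D.b false (D.f2 false A)) := by
  simp (maxDischargeDepth := 9) [psi]

theorem f2_psi_true (A : S) : D.f2 true (D.psi A) = D.e (D.b true (D.f2 true A)) := by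
  simp (maxDischargeDepth := 9) [psi]

theorem psi_d1 (x : E) : D.psi (D.d1 x) = D.d1 x := by
  simp (maxDischargeDepth := 9) [psi]

theorem psi_d2 (x : E) : D.psi (D.d2 x) = D.d1 x := by
  simp (maxDischargeDepth := 9) [psi]

theorem psi_g (α : Bool) (x : E) : D.psi (D.g α x) = D.d1 x := by
  cases α <;> simp (maxDischargeDepth := 9) [psi]

theorem psi_of_f2 (A : S) (o o' : O) (h : D.f2 false A = D.e o) (h' : D.f2 true A = D.e o') :
    D.psi A = A := by
  simp (maxDischargeDepth := 9) [psi, h, h']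

/-- The laws for connections on composite edges turn the folding into a grid with two rows.
Exchanged into rows, it becomes the folding of `A` followed by an identity, above an identity
followed by the folding of `B`. -/
theorem psi_v (A B : S) (c : D.f1 true A = D.f1 false B) :
    D.psi (D.v A B) =
      D.v (D.h (D.psi A) (D.d1 (D.f2 true B))) (D.h (D.d1 (D.f2 false A)) (D.psi B)) := by
  have h1 : D.b true (D.f2 false A) = D.b false (D.f2 false B) := by
    rw [← b_f1, ← b_f1, c]
  have h2 : D.b true (D.f2 true A) = D.b false (D.f2 true B) := by
    rw [← b_f1, ← b_f1, c]
  unfold psi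
  rw [f2_v _ _ _ c, f2_v _ _ _ c, g_m_true _ _ h1, g_m_false _ _ h2]
  rw [exch (D.g true (D.f2 false A)) (D.d1 (D.f2 false A)) (D.d2 (D.f2 false A))
    (D.g true (D.f2 false B)) (by simp (maxDischargeDepth := 9))
      (by simp (maxDischargeDepth := 9) [h1]) (by simp (maxDischargeDepth := 9))
      (by simp (maxDischargeDepth := 9) [h1])]
  rw [exch (D.g false (D.f2 true A)) (D.d2 (D.f2 true B)) (D.d1 (D.f2 true B))
    (D.g false (D.f2 true B)) (by simp (maxDischargeDepth := 9) [h2])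
      (by simp (maxDischargeDepth := 9)) (by simp (maxDischargeDepth := 9) [h2])
      (by simp (maxDischargeDepth := 9))]
  rw [exch _ _ A B (by simp (maxDischargeDepth := 9) [h1]) c (by simp (maxDischargeDepth := 9))
    (by simp (maxDischargeDepth := 9) [h1])]
  rw [exch _ _ _ _ (by simp (maxDischargeDepth := 9) [h1, c])
    (by simp (maxDischargeDepth := 9) [h2]) (by simp (maxDischargeDepth := 9) [h2])
    (by simp (maxDischargeDepth := 9) [h1])]
  congr 1 <;> simp (maxDischargeDepth := 9) [h_assoc, h1, h2]

theorem psi_h (A B : S) (c : D.f2 true A = D.f2 false B) :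
    D.psi (D.h A B) =
      D.v (D.h (D.d1 (D.f1 false A)) (D.psi B)) (D.h (D.psi A) (D.d1 (D.f1 true B))) := by
  have h1 : D.b true (D.f1 false A) = D.b false (D.f1 false B) := by
    rw [b_f1, b_f1, c]
  have h2 : D.b true (D.f1 true A) = D.b false (D.f1 true B) := by
    rw [b_f1, b_f1, c]
  -- Both rows are padded with identity squares to five columns. In the middle column the two
  -- connections on the common edge of `A` and `B` then compose to a degenerate square.
  have e1 : D.h (D.d1 (D.f1 false A)) (D.psi B) =
      D.h (D.h (D.h (D.h (D.d1 (D.e (D.b false (D.f2 false A)))) (D.d1 (D.f1 false A)))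
        (D.g true (D.f2 false B))) B) (D.g false (D.f2 true B)) := by
    simp (maxDischargeDepth := 9) [psi, h_assoc, c]
  have e2 : D.h (D.psi A) (D.d1 (D.f1 true B)) =
      D.h (D.h (D.h (D.h (D.g true (D.f2 false A)) A)
        (D.g false (D.f2 true A))) (D.d1 (D.f1 true B))) (D.d1 (D.e (D.b true (D.f2 true B)))) := by
    simp (maxDischargeDepth := 9) [psi, h_assoc, c]
  rw [e1, e2, ← exch _ _ _ _ (by simp (maxDischargeDepth := 9) [c])
    (by simp (maxDischargeDepth := 9)) (by simp (maxDischargeDepth := 9) [c])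
    (by simp (maxDischargeDepth := 9) [c]),
    ← exch _ _ _ _ (by simp (maxDischargeDepth := 9) [c]) (by simp (maxDischargeDepth := 9))
      (by simp (maxDischargeDepth := 9) [c]) (by simp (maxDischargeDepth := 9) [c]),
    ← exch _ _ _ _ (by simp (maxDischargeDepth := 9)) (by simp (maxDischargeDepth := 9) [c])
      (by simp (maxDischargeDepth := 9) [c]) (by simp (maxDischargeDepth := 9) [c]),
    ← exch _ _ _ _ (by simp (maxDischargeDepth := 9)) (by simp (maxDischargeDepth := 9))
      (by simp (maxDischargeDepth := 9)) (by simp (maxDischargeDepth := 9))]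
  simp (maxDischargeDepth := 9) [psi, h_assoc, c]

/-- Read by columns, each connection added by the folding meets the opposite connection added by the
unfolding; their composite is degenerate and disappears. -/
theorem unf_psi (A : S) : D.unf (D.f1 false A) (D.f1 true A) (D.f2 false A) (D.f2 true A)
    (D.psi A) = A := by
  have e1 : D.h (D.d1 (D.f1 false A)) (D.g true (D.f2 true A)) =
      D.h (D.h (D.d1 (D.e (D.b false (D.f2 false A)))) (D.d1 (D.f1 false A)))
        (D.g true (D.f2 true A)) := by simp
  have e2 : D.v (D.h (D.d1 (D.f1 false A)) (D.g true (D.f2 true A))) (D.psi A) =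
      D.h (D.g true (D.f2 false A)) A := by
    unfold psi
    rw [e1, ← exch (D.h (D.d1 _) (D.d1 _)) (D.h _ A) _ (D.g false _)
      (by simp (maxDischargeDepth := 9)) (by simp (maxDischargeDepth := 9))
      (by simp (maxDischargeDepth := 9))
      (by simp (maxDischargeDepth := 9)), ← exch (D.d1 _) (D.g true _) _ A
      (by simp (maxDischargeDepth := 9)) (by simp (maxDischargeDepth := 9))
      (by simp (maxDischargeDepth := 9)) (by simp (maxDischargeDepth := 9))]
    simp
  rw [unf, e2, ← exch _ _ _ _ (by simp (maxDischargeDepth := 9)) (by simp (maxDischargeDepth := 9))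
    (by simp (maxDischargeDepth := 9)) (by simp (maxDischargeDepth := 9))]
  simp

/-- The main tool for equations between squares: it suffices to compare boundaries and foldings, and
foldings of composites are explicit by `psi_v` and `psi_h`. -/
theorem psi_injective {A B : S} (h1 : ∀ α, D.f1 α A = D.f1 α B) (h2 : ∀ α, D.f2 α A = D.f2 α B)
    (h : D.psi A = D.psi B) : A = B := by
  rw [← D.unf_psi A, ← D.unf_psi B, h1, h1, h2, h2, h]

/-- The edges `p`, `q`, `r`, `s` form the boundary of a square. -/
structure IsFrame {O E S : Type u} (D : DCat O E S) (p q r s : E) : Prop where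
  pr : D.b false p = D.b false r
  ps : D.b true p = D.b false s
  rq : D.b true r = D.b false q
  sq : D.b true s = D.b true q

/-- The faces of `x` are those of the folding of a square with faces `p`, `q`, `r`, `s`. -/
structure IsFill {O E S : Type u} (D : DCat O E S) (p q r s : E) (x : S) : Prop where
  f1_false : D.f1 false x = D.m p s
  f1_true : D.f1 true x = D.m r q
  f2_false : D.f2 false x = D.e (D.b false r)
  f2_true : D.f2 true x = D.e (D.b true s)

variable {D} {p q r s : E} {x : S}

theorem f1_unf_false (hF : D.IsFrame p q r s) (hx : D.IsFill p q r s x) :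
    D.f1 false (D.unf p q r s x) = p := by
  obtain ⟨h1, h2, h3, h4⟩ := hF
  obtain ⟨h5, h6, h7, h8⟩ := hx
  simp (maxDischargeDepth := 9) [unf, *]

theorem f1_unf_true (hF : D.IsFrame p q r s) (hx : D.IsFill p q r s x) :
    D.f1 true (D.unf p q r s x) = q := by
  obtain ⟨h1, h2, h3, h4⟩ := hF
  obtain ⟨h5, h6, h7, h8⟩ := hx
  simp (maxDischargeDepth := 9) [unf, *]

theorem f2_unf_false (hF : D.IsFrame p q r s) (hx : D.IsFill p q r s x) :
    D.f2 false (D.unf p q r s x) = r := by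
  obtain ⟨h1, h2, h3, h4⟩ := hF
  obtain ⟨h5, h6, h7, h8⟩ := hx
  simp (maxDischargeDepth := 9) [unf, *]

theorem f2_unf_true (hF : D.IsFrame p q r s) (hx : D.IsFill p q r s x) :
    D.f2 true (D.unf p q r s x) = s := by
  obtain ⟨h1, h2, h3, h4⟩ := hF
  obtain ⟨h5, h6, h7, h8⟩ := hx
  simp (maxDischargeDepth := 9) [unf, *]

/-- The outer rows of the unfolding consist of connections and identities, so they fold to
identities, and `x` is its own folding because its faces in the second direction are degenerate. -/
theorem psi_unf (hF : D.IsFrame p q r s) (hx : D.IsFill p q r s x) :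
    D.psi (D.unf p q r s x) = x := by
  obtain ⟨h1, h2, h3, h4⟩ := hF
  obtain ⟨h5, h6, h7, h8⟩ := hx
  unfold unf
  rw [psi_v _ _ _ (by simp (maxDischargeDepth := 9) [*]), psi_v _ _ _
    (by simp (maxDischargeDepth := 9) [*]), psi_h _ _ _ (by simp (maxDischargeDepth := 9) [*]),
    psi_h _ _ _ (by simp (maxDischargeDepth := 9) [*]), psi_of_f2 D x _ _ h7 h8]
  simp (maxDischargeDepth := 9) [psi_g, psi_d1, *]
  rw [← d1_m _ _ h2, ← d1_m _ _ h3]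
  simp (maxDischargeDepth := 9) [*]

end Folding

end DCat

/-! ### Inverses and transposed squares in a double category. -/

namespace DCat
open Laws

variable {O E S : Type u}

/-- The edges `x` and `y` are inverse to each other. -/
structure EInv (D : DCat O E S) (x y : E) : Prop where
  tf : D.b true x = D.b false y
  ft : D.b true y = D.b false x
  left : D.m x y = D.e (D.b false x)
  right : D.m y x = D.e (D.b false y)

/-- The squares `A` and `B` are inverse to each other for the first composition. -/
structure R1 (D : DCat O E S) (A B : S) : Prop where
  tf : D.f1 true A = D.f1 false B
  ft : D.f1 true B = D.f1 false A
  left : D.v A B = D.d1 (D.f1 false A)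
  right : D.v B A = D.d1 (D.f1 false B)

/-- The squares `A` and `B` are inverse to each other for the second composition. -/
structure R2 (D : DCat O E S) (A B : S) : Prop where
  tf : D.f2 true A = D.f2 false B
  ft : D.f2 true B = D.f2 false A
  left : D.h A B = D.d2 (D.f2 false A)
  right : D.h B A = D.d2 (D.f2 false B)

/-- The squares `A` and `B` are transposed to each other: their faces are exchanged, and their
foldings are inverse to each other. -/
structure T (D : DCat O E S) (A B : S) : Prop where
  f12 : ∀ α, D.f1 α A = D.f2 α B
  f21 : ∀ α, D.f2 α A = D.f1 α B
  inv : D.R1 (D.psi A) (D.psi B)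

variable {D : DCat O E S}

theorem R1.symm {A B : S} (h : D.R1 A B) : D.R1 B A := ⟨h.ft, h.tf, h.right, h.left⟩

theorem T.symm {A B : S} (h : D.T A B) : D.T B A :=
  ⟨fun α => (h.f21 α).symm, fun α => (h.f12 α).symm, h.inv.symm⟩

variable [D.Laws]

theorem R1.unique {A B B' : S} (h : D.R1 A B) (h' : D.R1 A B') : B = B' := by
  have e := v_assoc B A B' h.ft h'.tf
  rw [h.right, h'.left, d1_v _ _ (by rw [← h.tf, h'.tf]), v_d1 _ _ h.ft.symm] at e
  exact e.symm

theorem R1.h {x y z w : S} (h : D.R1 x y) (h' : D.R1 z w) (c : D.f2 true x = D.f2 false z)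
    (c' : D.f2 true y = D.f2 false w) : D.R1 (D.h x z) (D.h y w) where
  tf := by rw [f1_h _ _ _ c, f1_h _ _ _ c', h.tf, h'.tf]
  ft := by rw [f1_h _ _ _ c, f1_h _ _ _ c', h.ft, h'.ft]
  left := by
    have e : D.b true (D.f1 false x) = D.b false (D.f1 false z) := by rw [b_f1, b_f1, c]
    rw [← exch _ _ _ _ h.tf h'.tf c c', h.left, h'.left, f1_h _ _ _ c, d1_m _ _ e]
  right := by
    have e : D.b true (D.f1 false y) = D.b false (D.f1 false w) := by rw [b_f1, b_f1, c']
    rw [← exch _ _ _ _ h.ft h'.ft c' c, h.right, h'.right, f1_h _ _ _ c', d1_m _ _ e]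

theorem R1.v {x y z w : S} (h : D.R1 x y) (h' : D.R1 z w) (c : D.f1 true x = D.f1 false z) :
    D.R1 (D.v x z) (D.v w y) := by
  have c' : D.f1 true w = D.f1 false y := by rw [h'.ft, ← c, h.tf]
  refine ⟨?_, ?_, ?_, ?_⟩
  · rw [f1_v_true _ _ c, f1_v_false _ _ c', h'.tf]
  · rw [f1_v_true _ _ c', f1_v_false _ _ c, h.ft]
  · rw [v_assoc _ _ _ c (by rw [f1_v_false _ _ c', h'.tf]), ← v_assoc z w y h'.tf c', h'.left,
      d1_v _ _ (by rw [← c, h.tf]), h.left, f1_v_false _ _ c]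
  · rw [v_assoc _ _ _ c' (by rw [f1_v_false _ _ c, h.ft]), ← v_assoc y x z h.ft c, h.right,
      d1_v _ _ (by rw [← h.tf, c]), h'.right, f1_v_false _ _ c']

theorem R1.d1 (x : E) : D.R1 (D.d1 x) (D.d1 x) := by
  constructor <;> simp

/-- The faces in the second direction of `A` and `B` compose to an identity; if one is an identity,
so is the other. -/
theorem R1.f2_eq {A B : S} (h : D.R1 A B) (α : Bool) {o : O} (ho : D.f2 α A = D.e o) :
    D.f2 α B = D.e o := by
  have e := congrArg (D.f2 α) h.left
  rw [f2_v _ _ _ h.tf, ho, f2_d1, b_f1, ho, b_e] at e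
  have e2 : D.b false (D.f2 α B) = o := by
    rw [← b_f1, ← h.tf, b_f1, ho, b_e]
  rwa [e_m _ _ e2.symm] at e

theorem T.unique {A B B' : S} (h : D.T A B) (h' : D.T A B') : B = B' :=
  D.psi_injective (fun α => by rw [← h.f21, h'.f21]) (fun α => by rw [← h.f12, h'.f12])
    (h.inv.unique h'.inv)

theorem isFrame_swap (A : S) :
    D.IsFrame (D.f2 false A) (D.f2 true A) (D.f1 false A) (D.f1 true A) := by
  constructor <;> simp

/-- The transposed square obtained from an inverse of the folding. -/
theorem T.of_inv {A x : S} (h : D.R1 (D.psi A) x) :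
    D.T A (D.unf (D.f2 false A) (D.f2 true A) (D.f1 false A) (D.f1 true A) x) := by
  have hF := D.isFrame_swap A
  have hx : D.IsFill (D.f2 false A) (D.f2 true A) (D.f1 false A) (D.f1 true A) x :=
    ⟨by rw [← h.tf, f1_psi_true], by rw [h.ft, f1_psi_false],
      by rw [h.f2_eq false (f2_psi_false D A)]; simp,
      by rw [h.f2_eq true (f2_psi_true D A)]; simp⟩
  refine ⟨?_, ?_, ?_⟩
  · rintro (_ | _)
    · rw [f2_unf_false hF hx]
    · rw [f2_unf_true hF hx]
  · rintro (_ | _)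
    · rw [f1_unf_false hF hx]
    · rw [f1_unf_true hF hx]
  · rwa [psi_unf hF hx]

theorem exists_T_iff (A : S) : (∃ B, D.T A B) ↔ ∃ x, D.R1 (D.psi A) x :=
  ⟨fun ⟨_, h⟩ => ⟨_, h.inv⟩, fun ⟨_, h⟩ => ⟨_, T.of_inv h⟩⟩

/-- The formulas `psi_v` and `psi_h` are mirror images: the two rows are interchanged. This is the
reversal of order in the inverse of a composite. -/
theorem T.v {A A' B B' : S} (h : D.T A A') (h' : D.T B B') (c : D.f1 true A = D.f1 false B) :
    D.T (D.v A B) (D.h A' B') := by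
  have c' : D.f2 true A' = D.f2 false B' := by rw [← h.f12, ← h'.f12, c]
  have h1 : D.b true (D.f2 false A) = D.b false (D.f2 false B) := by
    rw [← b_f1, ← b_f1, c]
  have h2 : D.b true (D.f2 true A) = D.b false (D.f2 true B) := by
    rw [← b_f1, ← b_f1, c]
  refine ⟨?_, ?_, ?_⟩
  · rintro (_ | _)
    · rw [f1_v_false _ _ c, f2_h_false _ _ c', h.f12]
    · rw [f1_v_true _ _ c, f2_h_true _ _ c', h'.f12]
  · intro α
    rw [f2_v _ _ _ c, f1_h _ _ _ c', h.f21, h'.f21]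
  · rw [psi_v _ _ _ c, psi_h _ _ _ c']
    apply R1.v
    · rw [← h'.f21]
      exact h.inv.h (R1.d1 _) (by simp [f2_psi_true, h2])
        (by rw [h.inv.f2_eq true (f2_psi_true D A), f2_d1, h2])
    · rw [← h.f21]
      exact (R1.d1 _).h h'.inv (by simp [f2_psi_false, h1])
        (by rw [h'.inv.f2_eq false (f2_psi_false D B), f2_d1, h1])
    · rw [f1_h _ _ _ (by simp [f2_psi_true, h2]), f1_h _ _ _ (by simp [f2_psi_false, h1]),
        f1_psi_true, f1_psi_false, f1_d1, f1_d1, c, m_assoc _ _ _ (by simp [h1]) (by simp)]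

theorem T.h {A A' B B' : S} (h : D.T A A') (h' : D.T B B') (c : D.f2 true A = D.f2 false B) :
    D.T (D.h A B) (D.v A' B') :=
  (T.v h.symm h'.symm (by rw [← h.f21, ← h'.f21, c])).symm

theorem T.d1 (x : E) : D.T (D.d1 x) (D.d2 x) :=
  ⟨by simp, by simp, by rw [psi_d1, psi_d2]; exact R1.d1 x⟩

theorem T.g (α : Bool) (x : E) : D.T (D.g α x) (D.g α x) := by
  refine ⟨?_, ?_, by rw [psi_g]; exact R1.d1 x⟩ <;>
  · rintro (_ | _) <;> cases α <;> simp

theorem R1.f2_inv {A B : S} (h : D.R1 A B) (α : Bool) : D.EInv (D.f2 α A) (D.f2 α B) where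
  tf := by rw [← b_f1, ← b_f1, h.tf]
  ft := by rw [← b_f1, ← b_f1, h.ft]
  left := by rw [← f2_v _ _ _ h.tf, h.left, f2_d1, b_f1]
  right := by rw [← f2_v _ _ _ h.ft, h.right, f2_d1, b_f1]

theorem R2.f1_inv {A B : S} (h : D.R2 A B) (α : Bool) : D.EInv (D.f1 α A) (D.f1 α B) where
  tf := by rw [b_f1, b_f1, h.tf]
  ft := by rw [b_f1, b_f1, h.ft]
  left := by rw [← f1_h _ _ _ h.tf, h.left, f1_d2, b_f1]
  right := by rw [← f1_h _ _ _ h.ft, h.right, f1_d2, b_f1]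

/-- The inverse of the folding of a square which is invertible for the first composition. -/
theorem R1.psi {A B : S} (h : D.R1 A B) :
    D.R1 (D.psi A) (D.h (D.h (D.d1 (D.f2 false A)) (D.psi B)) (D.d1 (D.f2 true A))) := by
  have hr := h.f2_inv false
  have hs := h.f2_inv true
  have c1 := hr.tf
  have c2 := hr.ft
  have c3 := hs.tf
  have c4 := hs.ft
  have c5 := h.tf
  have c6 := h.ft
  -- Folding `A ⋆_1 B = ε_1` shows that the whiskered foldings of `A` and `B` are inverse. The
  -- whiskers are then moved to one side, where they cancel because the faces of `A` and `B` in the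
  -- second direction are inverse edges.
  have e1 := (psi_v D A B h.tf).symm
  have e2 := (psi_v D B A h.ft).symm
  rw [h.left, psi_d1] at e1
  rw [h.right, psi_d1] at e2
  have a1 : D.h (D.h (D.psi A) (D.d1 (D.f2 true B))) (D.d1 (D.f2 true A)) = D.psi A := by
    rw [h_assoc _ _ _ (by simp [f2_psi_true, c3]) (by simp [c4]), ← d1_m _ _ c4, hs.right]
    simp [f2_psi_true, c3]
  have a2 : D.h (D.d1 (D.f2 false A)) (D.h (D.d1 (D.f2 false B)) (D.psi A)) = D.psi A := by
    rw [← h_assoc _ _ _ (by simp [c1]) (by simp [f2_psi_false, c2]), ← d1_m _ _ c1, hr.left]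
    simp [f2_psi_false]
  have a3 := h_assoc (D := D) (D.d1 (D.f2 false A)) (D.psi B) (D.d1 (D.f2 true A))
    (by simp [f2_psi_false, c1]) (by simp [f2_psi_true, c4])
  have b1 : D.f1 true (D.h (D.psi A) (D.d1 (D.f2 true B))) =
      D.f1 false (D.h (D.d1 (D.f2 false A)) (D.psi B)) := by
    rw [f1_h _ _ _ (by simp [f2_psi_true, c3]), f1_h _ _ _ (by simp [f2_psi_false, c1]),
      f1_psi_true, f1_psi_false, f1_d1, f1_d1, c5, m_assoc _ _ _ (by simp [c1]) (by simp)]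
  have b2 : D.f1 true (D.h (D.psi B) (D.d1 (D.f2 true A))) =
      D.f1 false (D.h (D.d1 (D.f2 false B)) (D.psi A)) := by
    rw [f1_h _ _ _ (by simp [f2_psi_true, c4]), f1_h _ _ _ (by simp [f2_psi_false, c2]),
      f1_psi_true, f1_psi_false, f1_d1, f1_d1, c6, m_assoc _ _ _ (by simp [c2]) (by simp)]
  have l : D.v (D.psi A) (D.h (D.h (D.d1 (D.f2 false A)) (D.psi B)) (D.d1 (D.f2 true A))) =
      D.d1 (D.f1 false (D.psi A)) := by
    conv_lhs => rw [← a1]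
    rw [← exch _ _ _ _ b1 (by simp)
      (by rw [f2_h_true _ _ (by simp [f2_psi_true, c3])]; simp [c4])
      (by rw [f2_h_true _ _ (by simp [f2_psi_false, c1])]; simp [f2_psi_true, c4]), e1,
      d1_v _ _ (by simp), ← d1_m _ _ (by simp), f1_psi_false]
  have r : D.v (D.h (D.h (D.d1 (D.f2 false A)) (D.psi B)) (D.d1 (D.f2 true A))) (D.psi A) =
      D.d1 (D.f1 true (D.psi A)) := by
    conv_lhs => rw [← a2]
    rw [a3, ← exch _ _ _ _ (by simp) b2
      (by rw [f2_h_false _ _ (by simp [f2_psi_true, c4])]; simp [f2_psi_false, c1])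
      (by rw [f2_h_false _ _ (by simp [f2_psi_false, c2])]; simp [c1]), e2,
      d1_v _ _ (by simp), ← d1_m _ _ (by simp [c1]), f1_psi_true, c5]
  have t1 : D.f1 false (D.h (D.h (D.d1 (D.f2 false A)) (D.psi B)) (D.d1 (D.f2 true A))) =
      D.f1 true (D.psi A) := by
    rw [f1_h _ _ _ (by rw [f2_h_true _ _ (by simp [f2_psi_false, c1])]; simp [f2_psi_true, c4]),
      f1_h _ _ _ (by simp [f2_psi_false, c1]), f1_d1, f1_d1, f1_psi_false, f1_psi_true,
      m_assoc _ _ _ (by simp [c1]) (by simp [c4]), m_assoc _ _ _ (by simp) c4, hs.right,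
      m_e _ _ (by simp), c5]
  have t2 : D.f1 true (D.h (D.h (D.d1 (D.f2 false A)) (D.psi B)) (D.d1 (D.f2 true A))) =
      D.f1 false (D.psi A) := by
    rw [f1_h _ _ _ (by rw [f2_h_true _ _ (by simp [f2_psi_false, c1])]; simp [f2_psi_true, c4]),
      f1_h _ _ _ (by simp [f2_psi_false, c1]), f1_d1, f1_d1, f1_psi_false, f1_psi_true,
      ← m_assoc _ _ _ c1 (by simp), hr.left, e_m _ _ (by rw [b_f1, c2]), c6]
  exact ⟨t1.symm, t2, l, by rw [r, t1]⟩

/-- The inverse of the folding of a square which is invertible for the second composition. -/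
theorem R2.psi {A B : S} (h : D.R2 A B) :
    D.R1 (D.psi A) (D.h (D.h (D.d1 (D.f1 false A)) (D.psi B)) (D.d1 (D.f1 true A))) := by
  have hp := h.f1_inv false
  have hq := h.f1_inv true
  have c5 := h.tf
  have c6 := h.ft
  have c1 := hp.tf
  have c4 := hq.ft
  -- This is the same computation with the horizontal formula: the whiskers are now the faces in the
  -- first direction, which are inverse edges.
  have e1 := (psi_h D A B h.tf).symm
  have e2 := (psi_h D B A h.ft).symm
  rw [h.left, psi_d2] at e1
  rw [h.right, psi_d2] at e2
  have k1 : D.f2 true (D.d1 (D.f1 false A)) = D.f2 false (D.psi B) := by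
    simp [f2_psi_false, c5]
  have k2 : D.f2 true (D.psi B) = D.f2 false (D.d1 (D.f1 true A)) := by
    simp [f2_psi_true, c6]
  have k3 : D.f2 true (D.psi A) = D.f2 false (D.d1 (D.f1 true B)) := by
    simp [f2_psi_true, c5]
  have k4 : D.f2 true (D.d1 (D.f1 false B)) = D.f2 false (D.psi A) := by
    simp [f2_psi_false, c6]
  have k5 : D.f2 true (D.d1 (D.f1 true B)) = D.f2 false (D.d1 (D.f1 true A)) := by
    simp [c6]
  have k6 : D.f2 true (D.d1 (D.f1 false A)) = D.f2 false (D.d1 (D.f1 false B)) := by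
    simp [c5]
  have a1 : D.h (D.h (D.psi A) (D.d1 (D.f1 true B))) (D.d1 (D.f1 true A)) = D.psi A := by
    rw [h_assoc _ _ _ k3 k5, ← d1_m _ _ c4, hq.right]
    simp [f2_psi_true, c5]
  have a2 : D.h (D.d1 (D.f1 false A)) (D.h (D.d1 (D.f1 false B)) (D.psi A)) = D.psi A := by
    rw [← h_assoc _ _ _ k6 k4, ← d1_m _ _ c1, hp.left]
    simp [f2_psi_false]
  have a3 := h_assoc (D := D) (D.d1 (D.f1 false A)) (D.psi B) (D.d1 (D.f1 true A)) k1 k2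
  have b1 : D.f1 true (D.h (D.d1 (D.f1 false A)) (D.psi B)) =
      D.f1 false (D.h (D.psi A) (D.d1 (D.f1 true B))) := by
    rw [f1_h _ _ _ k1, f1_h _ _ _ k3, f1_psi_true, f1_psi_false, f1_d1, f1_d1, c5,
      m_assoc _ _ _ (by simp [c5]) (by simp)]
  have b2 : D.f1 true (D.h (D.d1 (D.f1 false B)) (D.psi A)) =
      D.f1 false (D.h (D.psi B) (D.d1 (D.f1 true A))) := by
    rw [f1_h _ _ _ k4, f1_h _ _ _ k2, f1_psi_true, f1_psi_false, f1_d1, f1_d1, c6,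
      m_assoc _ _ _ (by simp [c6]) (by simp)]
  have k7 : D.f2 true (D.h (D.d1 (D.f1 false A)) (D.psi B)) =
      D.f2 false (D.d1 (D.f1 true A)) := by rw [f2_h_true _ _ k1, k2]
  have t1 : D.f1 false (D.h (D.h (D.d1 (D.f1 false A)) (D.psi B)) (D.d1 (D.f1 true A))) =
      D.f1 true (D.psi A) := by
    rw [f1_h _ _ _ k7, f1_h _ _ _ k1, f1_d1, f1_d1, f1_psi_false, f1_psi_true,
      ← m_assoc _ _ _ c1 (by simp), hp.left, c6, e_m _ _ (by simp)]
  have t2 : D.f1 true (D.h (D.h (D.d1 (D.f1 false A)) (D.psi B)) (D.d1 (D.f1 true A))) =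
      D.f1 false (D.psi A) := by
    rw [f1_h _ _ _ k7, f1_h _ _ _ k1, f1_d1, f1_d1, f1_psi_false, f1_psi_true,
      m_assoc _ _ _ (by simp [c5]) (by simp [c6]), m_assoc _ _ _ (by simp) c4, hq.right,
      m_e _ _ (by simp), c5]
  refine ⟨t1.symm, t2, ?_, ?_⟩
  · conv_lhs => rw [← a2]
    rw [a3, ← exch _ _ _ _ (by simp) b2
      (by rw [f2_h_false _ _ k4, k6]) (by rw [f2_h_false _ _ k2, k1]), e2,
      d1_v _ _ (by simp), ← d1_m _ _ (by simp [c5]), f1_psi_false, c5]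
  · conv_lhs => rw [← a1]
    rw [← exch _ _ _ _ b1 (by simp) k7 (by rw [f2_h_true _ _ k3, k5]), e1, d1_v _ _ (by simp),
      ← d1_m _ _ (by simp), t1, f1_psi_true]

theorem T.exists_of_R1 {A B : S} (h : D.R1 A B) : ∃ C, D.T A C := ⟨_, T.of_inv h.psi⟩

theorem T.exists_of_R2 {A B : S} (h : D.R2 A B) : ∃ C, D.T A C := ⟨_, T.of_inv h.psi⟩

/-- A transposable square whose faces in the first direction are invertible is invertible for the
second composition. -/
theorem T.exists_R2 {A A' : S} {p q : E} (h : D.T A A') (hp : D.EInv (D.f1 false A) p)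
    (hq : D.EInv (D.f1 true A) q) : ∃ B, D.R2 A B := by
  have p1 := hp.tf
  have p2 := hp.ft
  have q1 := hq.tf
  have q2 := hq.ft
  simp only [b_f1] at p1 p2 q1 q2
  have i1 := h.inv
  have x1 : D.f1 false (D.psi A') = D.m (D.f2 false A) (D.f1 true A) := by
    rw [← i1.tf, f1_psi_true]
  have x2 : D.f1 true (D.psi A') = D.m (D.f1 false A) (D.f2 true A) := by
    rw [i1.ft, f1_psi_false]
  have x3 : D.f2 false (D.psi A') = D.e (D.b false (D.f2 false A)) :=
    i1.f2_eq false (f2_psi_false D A)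
  have x4 : D.f2 true (D.psi A') = D.e (D.b true (D.f2 true A)) :=
    i1.f2_eq true (f2_psi_true D A)
  have k1 : D.f2 true (D.d1 p) = D.f2 false (D.psi A') := by simp [x3, p2]
  have k2 : D.f2 true (D.psi A') = D.f2 false (D.d1 q) := by simp [x4, q1]
  have k3 : D.f2 true (D.h (D.d1 p) (D.psi A')) = D.f2 false (D.d1 q) := by
    rw [f2_h_true _ _ k1, k2]
  have k4 : D.f2 true (D.psi A) = D.f2 false (D.d1 q) := by simp [f2_psi_true, q1]
  have k5 : D.f2 true (D.d1 p) = D.f2 false (D.psi A) := by simp [f2_psi_false, p2]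
  have hF : D.IsFrame p q (D.f2 true A) (D.f2 false A) :=
    ⟨p1.symm, p2, q1, q2.symm⟩
  have hx : D.IsFill p q (D.f2 true A) (D.f2 false A)
      (D.h (D.h (D.d1 p) (D.psi A')) (D.d1 q)) := by
    refine ⟨?_, ?_, ?_, ?_⟩
    · rw [f1_h _ _ _ k3, f1_h _ _ _ k1, f1_d1, f1_d1, x1,
        m_assoc _ _ _ (by simp [p2]) (by simp [q1]), m_assoc _ _ _ (by simp) hq.tf, hq.left,
        m_e _ _ (by simp)]
    · rw [f1_h _ _ _ k3, f1_h _ _ _ k1, f1_d1, f1_d1, x2, ← m_assoc _ _ _ hp.ft (by simp),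
        hp.right, e_m _ _ (by simp [p1])]
    · rw [f2_h_false _ _ k3, f2_h_false _ _ k1, f2_d1, p1]
    · rw [f2_h_true _ _ k3, f2_d1, q2]
  -- The faces of an inverse are forced to be `p`, `q` and the exchanged second faces of `A`. Its
  -- folding must be the inverse of `ψ A`, namely `ψ A'`, whiskered by `p` and `q` to fit this
  -- frame.
  set B := D.unf p q (D.f2 true A) (D.f2 false A) (D.h (D.h (D.d1 p) (D.psi A')) (D.d1 q))
    with hB
  have b1 : D.f1 false B = p := f1_unf_false hF hx
  have b2 : D.f1 true B = q := f1_unf_true hF hx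
  have b3 : D.f2 false B = D.f2 true A := f2_unf_false hF hx
  have b4 : D.f2 true B = D.f2 false A := f2_unf_true hF hx
  have b5 : D.psi B = D.h (D.h (D.d1 p) (D.psi A')) (D.d1 q) := psi_unf hF hx
  have l1 : D.h (D.d1 (D.f1 false A)) (D.psi B) = D.h (D.psi A') (D.d1 q) := by
    rw [b5, h_assoc _ _ _ k1 k2, ← h_assoc _ _ _ (by simp [p1])
      (by rw [f2_h_false _ _ k2, k1]), ← d1_m _ _ hp.tf, hp.left]
    rw [d1_e, d2_h _ _ (by rw [f2_h_false _ _ k2, x3, b_f1])]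
  have l2 : D.h (D.psi B) (D.d1 (D.f1 true A)) = D.h (D.d1 p) (D.psi A') := by
    rw [b5, h_assoc _ _ _ k3 (by simp [q2]), ← d1_m _ _ hq.ft, hq.right, d1_e,
      h_d2 _ _ (by rw [k3, f2_d1])]
  have cAB : D.f2 true A = D.f2 false B := b3.symm
  refine ⟨B, cAB, b4, ?_, ?_⟩
  · apply D.psi_injective
    · rintro (_ | _)
      · rw [f1_h _ _ _ cAB, b1, hp.left, f1_d2, b_f1]
      · rw [f1_h _ _ _ cAB, b2, hq.left, f1_d2, b_f1]
    · rintro (_ | _)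
      · rw [f2_h_false _ _ cAB, f2_d2]
      · rw [f2_h_true _ _ cAB, f2_d2, b4]
    · rw [psi_d2, psi_h _ _ _ cAB, l1, b2, ← exch _ _ _ _ i1.ft (by simp) k2 k4, i1.right,
        v_d1 _ _ (by simp), ← d1_m _ _ (by rw [x1]; simp [q1]), x1,
        m_assoc _ _ _ (by simp) hq.tf, hq.left, m_e _ _ (by simp)]
  · apply D.psi_injective
    · rintro (_ | _)
      · rw [f1_h _ _ _ b4, b1, hp.right, f1_d2, b3, p1]
      · rw [f1_h _ _ _ b4, b2, hq.right, f1_d2, b3, q1]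
    · rintro (_ | _)
      · rw [f2_h_false _ _ b4, f2_d2]
      · rw [f2_h_true _ _ b4, f2_d2, b3]
    · rw [psi_d2, psi_h _ _ _ b4, l2, b1, ← exch _ _ _ _ (by simp) i1.tf k5 k1, i1.left,
        v_d1 _ _ (by simp), ← d1_m _ _ (by rw [f1_psi_false]; simp [p2]), f1_psi_false,
        ← m_assoc _ _ _ hp.ft (by simp), hp.right, e_m _ _ (by simp [p1]), b3]

/-- The equation that characterizes the transposed squares. -/
theorem psi_equation {A B : S} (h1 : ∀ α, D.f1 α A = D.f2 α B) (h2 : ∀ α, D.f2 α A = D.f1 α B) :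
    D.h (D.v (D.g true (D.f2 false A)) B) (D.v A (D.g false (D.f1 true A))) =
        D.v (D.g false (D.f1 false A)) (D.g true (D.f2 true A)) ↔
      D.v (D.psi A) (D.psi B) = D.d1 (D.f1 false (D.psi A)) := by
  have k1 : D.f1 true (D.g true (D.f2 false A)) = D.f1 false B := by simp [h2]
  have k2 : D.f1 true A = D.f1 false (D.g false (D.f1 true A)) := by simp
  have k3 : D.f1 true (D.g false (D.f1 false A)) = D.f1 false (D.g true (D.f2 true A)) := by simp
  have k4 : D.f2 true (D.v (D.g true (D.f2 false A)) B) =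
      D.f2 false (D.v A (D.g false (D.f1 true A))) := by
    rw [f2_v _ _ _ k1, f2_v _ _ _ k2, ← h1]; simp
  -- Connections fold to identities, so the two halves of the left-hand side fold to `ψ B` and `ψ
  -- A`, and the right-hand side folds to an identity. Since both sides have the same boundary, the
  -- equation is equivalent to its folding.
  have e1 : D.psi (D.v (D.g true (D.f2 false A)) B) = D.psi B := by
    rw [psi_v _ _ _ k1, psi_g, ← h1, ← d1_m _ _ (by simp), f2_g_true, d1_e,
      d2_h _ _ (by simp [f2_psi_false, ← h1]), d1_v]
    rw [f1_psi_false, ← h1, ← h2]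
  have e2 : D.psi (D.v A (D.g false (D.f1 true A))) = D.psi A := by
    rw [psi_v _ _ _ k2, psi_g, f2_g_false, d1_e, h_d2 _ _ (by simp [f2_psi_true]),
      ← d1_m _ _ (by simp), v_d1 _ _ (by rw [f1_psi_true])]
  have k5 : D.f1 false (D.v (D.g true (D.f2 false A)) B) = D.e (D.b false (D.f2 false A)) := by
    rw [f1_v_false _ _ k1, f1_g_true]
  have k6 : D.f1 true (D.v A (D.g false (D.f1 true A))) = D.e (D.b true (D.f1 true A)) := by
    rw [f1_v_true _ _ k2, f1_g_false]
  have e3 : D.psi (D.h (D.v (D.g true (D.f2 false A)) B) (D.v A (D.g false (D.f1 true A)))) =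
      D.v (D.psi A) (D.psi B) := by
    rw [psi_h _ _ _ k4, e1, e2, k5, k6, d1_e, d1_e, d2_h _ _ (by simp [f2_psi_false]),
      h_d2 _ _ (by rw [f2_psi_true, h1])]
  have e4 : D.psi (D.v (D.g false (D.f1 false A)) (D.g true (D.f2 true A))) =
      D.d1 (D.f1 false (D.psi A)) := by
    rw [psi_v _ _ _ k3, psi_g, psi_g, f2_g, f2_g, ← d1_m _ _ (by simp), v_d1 _ _ (by simp),
      f1_psi_false]
  rw [← e3, ← e4]
  refine ⟨fun h => by rw [h], fun h => D.psi_injective ?_ ?_ h⟩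
  · rintro (_ | _)
    · rw [f1_h _ _ _ k4, k5, f1_v_false _ _ k2, f1_v_false _ _ k3, f1_g, e_m _ _ (by simp)]
    · rw [f1_h _ _ _ k4, k6, f1_v_true _ _ k1, f1_v_true _ _ k3, f1_g, m_e _ _ (by simp [← h2]),
        h2]
  · rintro (_ | _)
    · rw [f2_h_false _ _ k4, f2_v _ _ _ k1, f2_v _ _ _ k3]
      simp [← h1]
    · rw [f2_h_true _ _ k4, f2_v _ _ _ k2, f2_v _ _ _ k3]
      simp

theorem T.iff {A B : S} : D.T A B ↔
    (∀ α, D.f1 α A = D.f2 α B) ∧ (∀ α, D.f2 α A = D.f1 α B) ∧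
    D.h (D.v (D.g true (D.f2 false A)) B) (D.v A (D.g false (D.f1 true A))) =
        D.v (D.g false (D.f1 false A)) (D.g true (D.f2 true A)) ∧
    D.h (D.v (D.g true (D.f2 false B)) A) (D.v B (D.g false (D.f1 true B))) =
        D.v (D.g false (D.f1 false B)) (D.g true (D.f2 true B)) := by
  constructor
  · intro h
    exact ⟨h.f12, h.f21, (psi_equation h.f12 h.f21).2 h.inv.left,
      (psi_equation h.symm.f12 h.symm.f21).2 h.inv.right⟩
  · rintro ⟨h1, h2, h3, h4⟩
    refine ⟨h1, h2, ?_, ?_, (psi_equation h1 h2).1 h3,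
      (psi_equation (fun α => (h2 α).symm) fun α => (h1 α).symm).1 h4⟩
    · rw [f1_psi_true, f1_psi_false, h1, h2]
    · rw [f1_psi_true, f1_psi_false, h1, h2]

end DCat

/-! ## Total operations indexed by natural numbers -/

/-- The index `c_i` for natural numbers. -/
def lo (c i : ℕ) : ℕ := if c < i then c else c - 1

theorem lo_of_lt {c i : ℕ} (h : c < i) : lo c i = c := if_pos h

theorem lo_of_ge {c i : ℕ} (h : i ≤ c) : lo c i = c - 1 := if_neg (by omega)

theorem ofNat_val' {n i : ℕ} (h : i ≤ n) : (Fin.ofNat (n + 1) i : ℕ) = i :=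
  Nat.mod_eq_of_lt (by omega)

theorem ofNat_coe {n : ℕ} (i : Fin (n + 1)) : Fin.ofNat (n + 1) (i : ℕ) = i :=
  Fin.ext (ofNat_val' (by omega))

theorem ofNat_ne {n i j : ℕ} (hi : i ≤ n) (hj : j ≤ n) (h : i ≠ j) :
    Fin.ofNat (n + 1) i ≠ Fin.ofNat (n + 1) j := by
  intro e
  have := congrArg Fin.val e
  rw [ofNat_val' hi, ofNat_val' hj] at this
  exact h this

theorem low_ofNat {n i j : ℕ} (hi : i ≤ n + 1) (hj : j ≤ n + 1)
    (h : Fin.ofNat (n + 1 + 1) i ≠ Fin.ofNat (n + 1 + 1) j) :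
    low (Fin.ofNat (n + 1 + 1) i) (Fin.ofNat (n + 1 + 1) j) h = Fin.ofNat (n + 1) (lo i j) := by
  have hij : i ≠ j := fun e => h (by rw [e])
  ext
  rw [low_val, ofNat_val' hi, ofNat_val' hj, ofNat_val']
  · rfl
  · unfold lo; split_ifs <;> omega

namespace Layer

variable {k : ℕ} {X Y Z : Type u}

/-- The face `∂_i^α`. -/
def fc (L : Layer k X Y) (i : ℕ) (α : Bool) (A : Y) : X := L.face (Fin.ofNat (k + 1) i) α A

/-- The degeneracy `ε_i`. -/
def dg (L : Layer k X Y) (i : ℕ) (A : X) : Y := L.deg (Fin.ofNat (k + 1) i) A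

/-- The connection `Γ_i^α`. -/
def cn (L : Layer k X Y) (i : ℕ) (α : Bool) (A : X) : Y :=
  -- The value outside the range is a mere default.
  if h : i < k then L.conn ⟨i, h⟩ α A else L.deg 0 A

open Classical in
/-- The composition `⋆_i`, extended by the first projection. -/
noncomputable def cp (L : Layer k X Y) (i : ℕ) (A B : Y) : Y :=
  if h : L.fc i true A = L.fc i false B then L.comp (Fin.ofNat (k + 1) i) A B h else A

theorem fc_coe (L : Layer k X Y) (i : Fin (k + 1)) (α : Bool) (A : Y) :
    L.face i α A = L.fc i α A := by rw [fc, ofNat_coe]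

theorem dg_coe (L : Layer k X Y) (i : Fin (k + 1)) (A : X) :
    L.deg i A = L.dg i A := by rw [dg, ofNat_coe]

theorem cn_coe (L : Layer k X Y) (i : Fin k) (α : Bool) (A : X) :
    L.conn i α A = L.cn i α A := by rw [cn, dif_pos i.2]

theorem isComp_ofNat (L : Layer k X Y) (i : ℕ) (A B P : Y) :
    L.IsComp (Fin.ofNat (k + 1) i) A B P ↔
      L.fc i true A = L.fc i false B ∧ L.cp i A B = P := by
  constructor
  · rintro ⟨h, rfl⟩
    exact ⟨h, dif_pos h⟩
  · rintro ⟨h, rfl⟩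
    exact ⟨h, (dif_pos h).symm⟩

theorem isComp_coe (L : Layer k X Y) (i : Fin (k + 1)) (A B P : Y) :
    L.IsComp i A B P ↔ L.fc i true A = L.fc i false B ∧ L.cp i A B = P := by
  rw [← isComp_ofNat, ofNat_coe]

/-- The axioms on the faces of connections and compositions, for cells of two consecutive
dimensions. -/
structure FaceLaws (L : Layer k X Y) : Prop where
  face_conn_castSucc : ∀ (i : Fin k) α A, L.face i.castSucc α (L.conn i α A) = A
  face_conn_succ : ∀ (i : Fin k) α A, L.face i.succ α (L.conn i α A) = A
  face_comp_false : ∀ i A B P, L.IsComp i A B P → L.face i false P = L.face i false A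
  face_comp_true : ∀ i A B P, L.IsComp i A B P → L.face i true P = L.face i true B

theorem Laws.faceLaws {L : Layer k X Y} (hL : L.Laws) : L.FaceLaws :=
  ⟨hL.face_conn_castSucc, hL.face_conn_succ, hL.face_comp_false, hL.face_comp_true⟩

/-- The axioms on the faces of faces, connections and compositions, for cells of three consecutive
dimensions. -/
structure FaceLaws₂ (L : Layer k X Y) (M : Layer (k + 1) Y Z) : Prop where
  face_face : ∀ (i j : Fin (k + 2)) (h : i ≠ j) α β A,
    L.face (low i j h) α (M.face j β A) = L.face (low j i h.symm) β (M.face i α A)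
  face_conn : ∀ (i : Fin (k + 2)) (j : Fin (k + 1)) (h : ¬ (i = j.castSucc ∨ i = j.succ)) α β A,
    M.face i α (M.conn j β A) =
      L.conn (lowGen j i h) β (L.face (low i j.castSucc fun e => h (Or.inl e)) α A)
  face_conn_castSucc_not : ∀ (j : Fin (k + 1)) α A,
    M.face j.castSucc α (M.conn j (!α) A) = L.deg j (L.face j α A)
  face_conn_succ_not : ∀ (j : Fin (k + 1)) α A,
    M.face j.succ α (M.conn j (!α) A) = L.deg j (L.face j α A)
  face_comp : ∀ (i j : Fin (k + 2)) (h : i ≠ j) α A B P, M.IsComp j A B P →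
    L.IsComp (low j i h.symm) (M.face i α A) (M.face i α B) (M.face i α P)

theorem Laws₂.faceLaws {L : Layer k X Y} {M : Layer (k + 1) Y Z} (h : L.Laws₂ M) : L.FaceLaws₂ M :=
  ⟨h.face_face, h.face_conn, h.face_conn_castSucc_not, h.face_conn_succ_not, h.face_comp⟩

section FaceLaws

variable {L : Layer k X Y} (hL : L.FaceLaws)
include hL

theorem FaceLaws.fc_cn_self {i : ℕ} (hi : i < k) (α : Bool) (A : X) : L.fc i α (L.cn i α A) = A := by
  have := hL.face_conn_castSucc ⟨i, hi⟩ α A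
  rwa [fc_coe, cn_coe] at this

theorem FaceLaws.fc_succ_cn_self {i : ℕ} (hi : i < k) (α : Bool) (A : X) :
    L.fc (i + 1) α (L.cn i α A) = A := by
  have := hL.face_conn_succ ⟨i, hi⟩ α A
  rwa [fc_coe, cn_coe] at this

theorem FaceLaws.fc_cp_false {i : ℕ} {A B : Y} (h : L.fc i true A = L.fc i false B) :
    L.fc i false (L.cp i A B) = L.fc i false A :=
  hL.face_comp_false _ _ _ _ ((isComp_ofNat ..).2 ⟨h, rfl⟩)

theorem FaceLaws.fc_cp_true {i : ℕ} {A B : Y} (h : L.fc i true A = L.fc i false B) :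
    L.fc i true (L.cp i A B) = L.fc i true B :=
  hL.face_comp_true _ _ _ _ ((isComp_ofNat ..).2 ⟨h, rfl⟩)

end FaceLaws

section FaceLaws₂

variable {L : Layer k X Y} {M : Layer (k + 1) Y Z} (h : L.FaceLaws₂ M)
include h

theorem FaceLaws₂.fc_fc {i j : ℕ} (hi : i ≤ k + 1) (hj : j ≤ k + 1) (hij : i ≠ j) (α β : Bool) (A : Z) :
    L.fc (lo i j) α (M.fc j β A) = L.fc (lo j i) β (M.fc i α A) := by
  have := h.face_face _ _ (ofNat_ne hi hj hij) α β A
  rwa [low_ofNat hi hj, low_ofNat hj hi] at this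

theorem FaceLaws₂.fc_cn {i j : ℕ} (hi : i ≤ k + 1) (hj : j ≤ k) (h1 : i ≠ j) (h2 : i ≠ j + 1)
    (α β : Bool) (A : Y) : M.fc i α (M.cn j β A) = L.cn (lo j i) β (L.fc (lo i j) α A) := by
  have := h.face_conn (Fin.ofNat (k + 1 + 1) i) ⟨j, by omega⟩ (by
    rintro (e | e) <;>
    · have := congrArg Fin.val e
      rw [ofNat_val' hi] at this
      simp at this
      omega) α β A
  rw [cn_coe, cn_coe, fc_coe, fc_coe] at this
  simp only [lowGen, low_val, ofNat_val' hi] at this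
  exact this

theorem FaceLaws₂.fc_cn_not {j : ℕ} (hj : j ≤ k) (α : Bool) (A : Y) :
    M.fc j α (M.cn j (!α) A) = L.dg j (L.fc j α A) := by
  have := h.face_conn_castSucc_not ⟨j, by omega⟩ α A
  rwa [cn_coe, fc_coe, fc_coe, dg_coe] at this

theorem FaceLaws₂.fc_succ_cn_not {j : ℕ} (hj : j ≤ k) (α : Bool) (A : Y) :
    M.fc (j + 1) α (M.cn j (!α) A) = L.dg j (L.fc j α A) := by
  have := h.face_conn_succ_not ⟨j, by omega⟩ α A
  rwa [cn_coe, fc_coe, fc_coe, dg_coe] at this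

theorem FaceLaws₂.fc_cp {i j : ℕ} (hi : i ≤ k + 1) (hj : j ≤ k + 1) (hij : i ≠ j) (α : Bool) {A B : Z}
    (c : M.fc j true A = M.fc j false B) :
    M.fc i α (M.cp j A B) = L.cp (lo j i) (M.fc i α A) (M.fc i α B) := by
  have := h.face_comp _ _ (ofNat_ne hi hj hij) α A B _ ((isComp_ofNat ..).2 ⟨c, rfl⟩)
  rw [low_ofNat hj hi] at this
  exact ((isComp_ofNat ..).1 this).2.symm

end FaceLaws₂

section Laws

variable {L : Layer k X Y} (hL : L.Laws)
include hL

theorem Laws.fc_dg_self (i : ℕ) (α : Bool) (A : X) : L.fc i α (L.dg i A) = A :=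
  hL.face_deg_self _ α A

theorem Laws.fc_cn_self {i : ℕ} (hi : i < k) (α : Bool) (A : X) : L.fc i α (L.cn i α A) = A :=
  hL.faceLaws.fc_cn_self hi α A

theorem Laws.fc_succ_cn_self {i : ℕ} (hi : i < k) (α : Bool) (A : X) :
    L.fc (i + 1) α (L.cn i α A) = A :=
  hL.faceLaws.fc_succ_cn_self hi α A

theorem Laws.fc_cp_false {i : ℕ} {A B : Y} (h : L.fc i true A = L.fc i false B) :
    L.fc i false (L.cp i A B) = L.fc i false A :=
  hL.faceLaws.fc_cp_false h

theorem Laws.fc_cp_true {i : ℕ} {A B : Y} (h : L.fc i true A = L.fc i false B) :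
    L.fc i true (L.cp i A B) = L.fc i true B :=
  hL.faceLaws.fc_cp_true h

theorem Laws.cp_assoc {i : ℕ} {A B C : Y} (h : L.fc i true A = L.fc i false B)
    (h' : L.fc i true B = L.fc i false C) :
    L.cp i (L.cp i A B) C = L.cp i A (L.cp i B C) := by
  have := (hL.assoc _ A B C _ _ (L.cp i A (L.cp i B C)) ((isComp_ofNat ..).2 ⟨h, rfl⟩)
    ((isComp_ofNat ..).2 ⟨h', rfl⟩)).1 ((isComp_ofNat ..).2 ⟨by rw [hL.fc_cp_false h', h], rfl⟩)
  exact ((isComp_ofNat ..).1 this).2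

theorem Laws.cp_dg (i : ℕ) (A : Y) : L.cp i A (L.dg i (L.fc i true A)) = A :=
  ((isComp_ofNat ..).1 (hL.comp_deg _ A)).2

theorem Laws.dg_cp (i : ℕ) (A : Y) : L.cp i (L.dg i (L.fc i false A)) A = A :=
  ((isComp_ofNat ..).1 (hL.deg_comp _ A)).2

theorem Laws.cp_cn {i : ℕ} (hi : i < k) (A : X) :
    L.cp i (L.cn i true A) (L.cn i false A) = L.dg (i + 1) A := by
  have := hL.conn_comp_castSucc ⟨i, hi⟩ A
  rw [isComp_coe, dg_coe, cn_coe, cn_coe] at this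
  exact this.2

theorem Laws.cp_succ_cn {i : ℕ} (hi : i < k) (A : X) :
    L.cp (i + 1) (L.cn i true A) (L.cn i false A) = L.dg i A := by
  have := hL.conn_comp_succ ⟨i, hi⟩ A
  rw [isComp_coe, dg_coe, cn_coe, cn_coe] at this
  exact this.2

end Laws

/-- Two consecutive layers of a cubical category. -/
structure Tower (L : Layer k X Y) (M : Layer (k + 1) Y Z) : Prop where
  fst : L.Laws
  snd : M.Laws
  mix : L.Laws₂ M

section Tower

variable {L : Layer k X Y} {M : Layer (k + 1) Y Z} (h : L.Laws₂ M)

section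
include h

theorem Laws₂.fc_fc {i j : ℕ} (hi : i ≤ k + 1) (hj : j ≤ k + 1) (hij : i ≠ j) (α β : Bool) (A : Z) :
    L.fc (lo i j) α (M.fc j β A) = L.fc (lo j i) β (M.fc i α A) :=
  h.faceLaws.fc_fc hi hj hij α β A

theorem Laws₂.fc_dg {i j : ℕ} (hi : i ≤ k + 1) (hj : j ≤ k + 1) (hij : i ≠ j) (α : Bool) (A : Y) :
    M.fc i α (M.dg j A) = L.dg (lo j i) (L.fc (lo i j) α A) := by
  have := h.face_deg _ _ (ofNat_ne hi hj hij) α A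
  rwa [low_ofNat hi hj, low_ofNat hj hi] at this

theorem Laws₂.fc_cn {i j : ℕ} (hi : i ≤ k + 1) (hj : j ≤ k) (h1 : i ≠ j) (h2 : i ≠ j + 1)
    (α β : Bool) (A : Y) : M.fc i α (M.cn j β A) = L.cn (lo j i) β (L.fc (lo i j) α A) :=
  h.faceLaws.fc_cn hi hj h1 h2 α β A

theorem Laws₂.fc_cn_not {j : ℕ} (hj : j ≤ k) (α : Bool) (A : Y) :
    M.fc j α (M.cn j (!α) A) = L.dg j (L.fc j α A) :=
  h.faceLaws.fc_cn_not hj α A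

theorem Laws₂.fc_succ_cn_not {j : ℕ} (hj : j ≤ k) (α : Bool) (A : Y) :
    M.fc (j + 1) α (M.cn j (!α) A) = L.dg j (L.fc j α A) :=
  h.faceLaws.fc_succ_cn_not hj α A

theorem Laws₂.dg_dg {i j : ℕ} (hi : i ≤ k + 1) (hj : j ≤ k + 1) (hij : i ≠ j) (A : X) :
    M.dg i (L.dg (lo j i) A) = M.dg j (L.dg (lo i j) A) := by
  have := h.deg_deg _ _ (ofNat_ne hi hj hij) A
  rwa [low_ofNat hi hj, low_ofNat hj hi] at this

theorem Laws₂.cn_cn {i j : ℕ} (hij : i < j) (hj : j < k) (α β : Bool) (A : X) :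
    M.cn i α (L.cn j β A) = M.cn (j + 1) β (L.cn i α A) := by
  have := h.conn_conn ⟨i, hij.trans hj⟩ ⟨j, hj⟩ α β A (by simp [hij.ne])
  rw [cn_coe, cn_coe, cn_coe, cn_coe, succAbove_val, succAbove_val] at this
  simpa [hij, not_lt_of_gt hij] using this

theorem Laws₂.cn_succ_cn {i : ℕ} (hi : i < k) (α : Bool) (A : X) :
    M.cn (i + 1) α (L.cn i α A) = M.cn i α (L.cn i α A) := by
  have := h.conn_conn_self ⟨i, hi⟩ α A
  rwa [cn_coe, cn_coe, cn_coe] at this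

theorem Laws₂.cn_dg {i c : ℕ} (hi : i ≤ k) (hc : c ≤ k + 1) (h1 : c ≠ i) (h2 : c ≠ i + 1)
    (α : Bool) (A : X) : M.cn i α (L.dg (lo c i) A) = M.dg c (L.cn (lo i c) α A) := by
  have hlo : lo c i < k + 1 := by unfold lo; split_ifs <;> omega
  have := h.conn_deg ⟨i, by omega⟩ ⟨lo c i, hlo⟩ (by
    intro e
    have := congrArg Fin.val e
    simp only [lo] at this
    split_ifs at this <;> omega) α A
  rw [cn_coe, cn_coe, dg_coe, dg_coe, succAbove_val, low_val] at this
  rw [this]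
  congr 1
  · simp only [Fin.val_castSucc]
    unfold lo; split_ifs <;> omega
  · congr 1
    change (if i < lo c i then i else i - 1) = lo i c
    unfold lo; split_ifs <;> omega

theorem Laws₂.cn_dg_self {i : ℕ} (hi : i ≤ k) (α : Bool) (A : X) :
    M.cn i α (L.dg i A) = M.dg i (L.dg i A) := by
  have := h.conn_deg_self ⟨i, by omega⟩ α A
  rwa [cn_coe, dg_coe, dg_coe] at this

theorem Laws₂.fc_cp {i j : ℕ} (hi : i ≤ k + 1) (hj : j ≤ k + 1) (hij : i ≠ j) (α : Bool) {A B : Z}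
    (c : M.fc j true A = M.fc j false B) :
    M.fc i α (M.cp j A B) = L.cp (lo j i) (M.fc i α A) (M.fc i α B) :=
  h.faceLaws.fc_cp hi hj hij α c

theorem Laws₂.fc_composable {i j : ℕ} (hi : i ≤ k + 1) (hj : j ≤ k + 1) (hij : i ≠ j) (α : Bool)
    {A B : Z} (c : M.fc j true A = M.fc j false B) :
    L.fc (lo j i) true (M.fc i α A) = L.fc (lo j i) false (M.fc i α B) := by
  rw [h.fc_fc hj hi hij.symm, h.fc_fc hj hi hij.symm, c]

theorem Laws₂.dg_cp {i c : ℕ} (hi : i ≤ k + 1) (hc : c ≤ k + 1) (hic : c ≠ i) {A B : Y}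
    (e : L.fc (lo c i) true A = L.fc (lo c i) false B) :
    M.dg i (L.cp (lo c i) A B) = M.cp c (M.dg i A) (M.dg i B) := by
  have := h.deg_comp (Fin.ofNat (k + 1 + 1) i) (Fin.ofNat (k + 1) (lo c i)) A B _
    ((isComp_ofNat ..).2 ⟨e, rfl⟩)
  rw [isComp_coe] at this
  have e2 : ((Fin.ofNat (k + 1 + 1) i).succAbove (Fin.ofNat (k + 1) (lo c i)) : ℕ) = c := by
    rw [succAbove_val, ofNat_val' hi, ofNat_val' (by unfold lo; split_ifs <;> omega)]
    unfold lo; split_ifs <;> omega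
  rw [e2] at this
  exact this.2.symm

theorem Laws₂.cn_cp {i c : ℕ} (hi : i ≤ k) (hc : c ≤ k + 1) (h1 : c ≠ i) (h2 : c ≠ i + 1)
    (α : Bool) {A B : Y} (e : L.fc (lo c i) true A = L.fc (lo c i) false B) :
    M.cn i α (L.cp (lo c i) A B) = M.cp c (M.cn i α A) (M.cn i α B) := by
  have hlo : lo c i < k + 1 := by unfold lo; split_ifs <;> omega
  have := h.conn_comp ⟨i, by omega⟩ ⟨lo c i, hlo⟩ α A B (L.cp (lo c i) A B) (by
    intro e
    have := congrArg Fin.val e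
    simp only [lo] at this
    split_ifs at this <;> omega) ((isComp_coe ..).2 ⟨e, rfl⟩)
  rw [cn_coe, cn_coe, cn_coe, isComp_coe] at this
  have e2 : ((Fin.castSucc (⟨i, by omega⟩ : Fin (k + 1))).succAbove ⟨lo c i, hlo⟩ : ℕ) = c := by
    rw [succAbove_val]
    simp only [Fin.val_castSucc]
    unfold lo; split_ifs <;> omega
  rw [e2] at this
  exact this.2.symm

theorem Laws₂.cn_cp_self_false {i : ℕ} (hi : i ≤ k) {A B : Y}
    (e : L.fc i true A = L.fc i false B) :
    M.cn i false (L.cp i A B) = M.cp (i + 1) (M.cp i (M.cn i false A) (M.dg (i + 1) B))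
      (M.cp i (M.dg i B) (M.cn i false B)) := by
  obtain ⟨Q, R, h1, h2, h3⟩ := h.conn_comp_false ⟨i, by omega⟩ A B (L.cp i A B)
    ((isComp_coe ..).2 ⟨e, rfl⟩)
  rw [isComp_coe, cn_coe, dg_coe] at h1 h2
  rw [isComp_coe, cn_coe] at h3
  rw [← h1.2, ← h2.2] at h3
  exact h3.2.symm

theorem Laws₂.cn_cp_self_true {i : ℕ} (hi : i ≤ k) {A B : Y}
    (e : L.fc i true A = L.fc i false B) :
    M.cn i true (L.cp i A B) = M.cp (i + 1) (M.cp i (M.cn i true A) (M.dg i A))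
      (M.cp i (M.dg (i + 1) A) (M.cn i true B)) := by
  obtain ⟨Q, R, h1, h2, h3⟩ := h.conn_comp_true ⟨i, by omega⟩ A B (L.cp i A B)
    ((isComp_coe ..).2 ⟨e, rfl⟩)
  rw [isComp_coe, cn_coe, dg_coe] at h1 h2
  rw [isComp_coe, cn_coe] at h3
  rw [← h1.2, ← h2.2] at h3
  exact h3.2.symm

end

theorem Tower.exch (h : Tower L M) {i j : ℕ} (hi : i ≤ k + 1) (hj : j ≤ k + 1) (hij : i ≠ j)
    {A B C D : Z}
    (h1 : M.fc i true A = M.fc i false B) (h2 : M.fc i true C = M.fc i false D)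
    (h3 : M.fc j true A = M.fc j false C) (h4 : M.fc j true B = M.fc j false D) :
    M.cp j (M.cp i A B) (M.cp i C D) = M.cp i (M.cp j A C) (M.cp j B D) := by
  have := h.snd.exchange _ _ A B C D _ _ _ _ (M.cp j (M.cp i A B) (M.cp i C D))
    (ofNat_ne hi hj hij)
    ((isComp_ofNat ..).2 ⟨h1, rfl⟩) ((isComp_ofNat ..).2 ⟨h2, rfl⟩)
    ((isComp_ofNat ..).2 ⟨h3, rfl⟩) ((isComp_ofNat ..).2 ⟨h4, rfl⟩)
    ((isComp_ofNat ..).2 ⟨by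
      rw [h.mix.fc_cp hj hi hij.symm _ h1, h.mix.fc_cp hj hi hij.symm _ h2, h3, h4], rfl⟩)
  exact ((isComp_ofNat ..).1 this).2.symm

/-- The double category formed by the directions `i` and `i + 1`. -/
@[simps] noncomputable def dcat (L : Layer k X Y) (M : Layer (k + 1) Y Z) (i : ℕ) :
    DCat X Y Z where
  b := L.fc i
  e := L.dg i
  m := L.cp i
  f1 := M.fc i
  f2 := M.fc (i + 1)
  d1 := M.dg i
  d2 := M.dg (i + 1)
  g := M.cn i
  v := M.cp i
  h := M.cp (i + 1)

theorem lo_self_succ (i : ℕ) : lo i (i + 1) = i := lo_of_lt (by omega)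

theorem lo_succ_self (i : ℕ) : lo (i + 1) i = i := lo_of_ge (by omega)

/-- Edge symmetry holds because the faces in both directions lie in the same set `Y`, whose relevant
direction is `i` in either case. Everything proved for squares now applies to any two adjacent
directions. -/
theorem Tower.dcat_laws (h : Tower L M) {i : ℕ} (hi : i ≤ k) : (dcat L M i).Laws := by
  have i1 : i ≤ k + 1 := by omega
  have i2 : i + 1 ≤ k + 1 := by omega
  have n1 : i ≠ i + 1 := by omega
  have n2 : i + 1 ≠ i := by omega
  have i3 : i < k + 1 := by omega
  constructor
  case b_e => exact fun α o => h.fst.fc_dg_self i α o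
  case b_m_false => exact fun x y c => h.fst.fc_cp_false c
  case b_m_true => exact fun x y c => h.fst.fc_cp_true c
  case m_assoc => exact fun x y z c c' => h.fst.cp_assoc c c'
  case e_m => rintro x o rfl; exact h.fst.dg_cp i x
  case m_e => rintro x o rfl; exact h.fst.cp_dg i x
  case b_f1 =>
    intro α β A
    have := h.mix.fc_fc i2 i1 n2 α β A
    rwa [lo_succ_self, lo_self_succ] at this
  case f1_v_false => exact fun A B c => h.snd.fc_cp_false c
  case f1_v_true => exact fun A B c => h.snd.fc_cp_true c
  case f2_v =>
    intro α A B c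
    have := h.mix.fc_cp i2 i1 n2 α c
    rwa [lo_self_succ] at this
  case f2_h_false => exact fun A B c => h.snd.fc_cp_false c
  case f2_h_true => exact fun A B c => h.snd.fc_cp_true c
  case f1_h =>
    intro α A B c
    have := h.mix.fc_cp i1 i2 n1 α c
    rwa [lo_succ_self] at this
  case f1_d1 => exact fun α x => h.snd.fc_dg_self i α x
  case f2_d1 =>
    intro α x
    have := h.mix.fc_dg i2 i1 n2 α x
    rwa [lo_succ_self, lo_self_succ] at this
  case f2_d2 => exact fun α x => h.snd.fc_dg_self (i + 1) α x
  case f1_d2 =>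
    intro α x
    have := h.mix.fc_dg i1 i2 n1 α x
    rwa [lo_succ_self, lo_self_succ] at this
  case v_assoc => exact fun A B C c c' => h.snd.cp_assoc c c'
  case h_assoc => exact fun A B C c c' => h.snd.cp_assoc c c'
  case d1_v => rintro A x rfl; exact h.snd.dg_cp i A
  case v_d1 => rintro A x rfl; exact h.snd.cp_dg i A
  case d2_h => rintro A x rfl; exact h.snd.dg_cp (i + 1) A
  case h_d2 => rintro A x rfl; exact h.snd.cp_dg (i + 1) A
  case d1_m =>
    intro x y c
    have := h.mix.dg_cp i1 i2 n2 (A := x) (B := y) (by rwa [lo_succ_self])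
    rwa [lo_succ_self] at this
  case d1_e =>
    intro o
    have := h.mix.dg_dg i1 i2 n1 o
    rwa [lo_succ_self, lo_self_succ] at this
  case exch => exact fun A B C E h1 h2 h3 h4 => h.exch i1 i2 n1 h1 h2 h3 h4
  case f1_g => exact fun α x => h.snd.fc_cn_self i3 α x
  case f2_g => exact fun α x => h.snd.fc_succ_cn_self i3 α x
  case f1_g_true => exact fun x => h.mix.fc_cn_not hi false x
  case f1_g_false => exact fun x => h.mix.fc_cn_not hi true x
  case f2_g_true => exact fun x => h.mix.fc_succ_cn_not hi false x
  case f2_g_false => exact fun x => h.mix.fc_succ_cn_not hi true x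
  case g_e =>
    intro α o
    have := h.mix.dg_dg i1 i2 n1 o
    rw [lo_succ_self, lo_self_succ] at this
    exact (h.mix.cn_dg_self hi α o).trans this
  case v_g => exact fun x => h.snd.cp_cn i3 x
  case h_g => exact fun x => h.snd.cp_succ_cn i3 x
  case g_m_true => exact fun x y c => h.mix.cn_cp_self_true hi c
  case g_m_false => exact fun x y c => h.mix.cn_cp_self_false hi c

end Tower
end Layer

theorem lo_succ_left {i c : ℕ} (h1 : c ≠ i) (h2 : c ≠ i + 1) : lo (i + 1) c = lo i c + 1 := by
  unfold lo; split_ifs <;> omega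

theorem lo_succ_right {i c : ℕ} (h1 : c ≠ i) : lo c (i + 1) = lo c i := by
  unfold lo; split_ifs <;> omega

theorem lo_lt {i c k : ℕ} (hi : i ≤ k) (hc : c ≤ k + 1) (h1 : c ≠ i) (h2 : c ≠ i + 1) :
    lo i c < k := by
  unfold lo; split_ifs <;> omega

/-! ### Foldings, inverses and transpositions in cubical categories. -/

namespace Layer

variable {k : ℕ} {X Y Z : Type u}

/-- The folding operation `ψ_i`. -/
noncomputable def ps (L : Layer k X Y) (i : ℕ) (A : Y) : Y :=
  L.cp (i + 1) (L.cp (i + 1) (L.cn i true (L.fc (i + 1) false A)) A)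
    (L.cn i false (L.fc (i + 1) true A))

/-- `A` and `B` are inverse to each other for `⋆_i`. -/
structure Inv (L : Layer k X Y) (i : ℕ) (A B : Y) : Prop where
  tf : L.fc i true A = L.fc i false B
  ft : L.fc i true B = L.fc i false A
  left : L.cp i A B = L.dg i (L.fc i false A)
  right : L.cp i B A = L.dg i (L.fc i false B)

/-- `A` and `B` are transposed to each other in the directions `i` and `i + 1`. -/
structure IsT (L : Layer k X Y) (i : ℕ) (A B : Y) : Prop where
  f12 : ∀ α, L.fc i α A = L.fc (i + 1) α B
  f21 : ∀ α, L.fc (i + 1) α A = L.fc i α B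
  inv : L.Inv i (L.ps i A) (L.ps i B)

variable {L : Layer k X Y} {M : Layer (k + 1) Y Z} {i c : ℕ}

theorem Inv.symm {A B : Y} (h : L.Inv i A B) : L.Inv i B A := ⟨h.ft, h.tf, h.right, h.left⟩

theorem IsT.symm {A B : Y} (h : L.IsT i A B) : L.IsT i B A :=
  ⟨fun α => (h.f21 α).symm, fun α => (h.f12 α).symm, h.inv.symm⟩

theorem r1_iff {A B : Z} : (dcat L M i).R1 A B ↔ M.Inv i A B :=
  ⟨fun h => ⟨h.tf, h.ft, h.left, h.right⟩, fun h => ⟨h.tf, h.ft, h.left, h.right⟩⟩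

theorem r2_iff {A B : Z} : (dcat L M i).R2 A B ↔ M.Inv (i + 1) A B :=
  ⟨fun h => ⟨h.tf, h.ft, h.left, h.right⟩, fun h => ⟨h.tf, h.ft, h.left, h.right⟩⟩

theorem eInv_iff {A B : Y} : (dcat L M i).EInv A B ↔ L.Inv i A B :=
  ⟨fun h => ⟨h.tf, h.ft, h.left, h.right⟩, fun h => ⟨h.tf, h.ft, h.left, h.right⟩⟩

theorem t_iff {A B : Z} : (dcat L M i).T A B ↔ M.IsT i A B :=
  ⟨fun h => ⟨h.f12, h.f21, r1_iff.1 h.inv⟩, fun h => ⟨h.f12, h.f21, r1_iff.2 h.inv⟩⟩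

theorem Laws.ps_composable (hL : L.Laws) (hi : i < k) (A : Y) :
    L.fc (i + 1) true (L.cn i true (L.fc (i + 1) false A)) = L.fc (i + 1) false A ∧
    L.fc (i + 1) true (L.cp (i + 1) (L.cn i true (L.fc (i + 1) false A)) A) =
      L.fc (i + 1) false (L.cn i false (L.fc (i + 1) true A)) := by
  have e := hL.fc_succ_cn_self hi true (L.fc (i + 1) false A)
  refine ⟨e, ?_⟩
  rw [hL.fc_cp_true e, hL.fc_succ_cn_self hi]

section TwoLayers

variable (h : Tower L M)
include h

theorem Tower.isT_unique (hi : i ≤ k) {A B B' : Z} (h1 : M.IsT i A B) (h2 : M.IsT i A B') :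
    B = B' :=
  have := h.dcat_laws hi
  (t_iff (L := L).2 h1).unique (t_iff.2 h2)

theorem Tower.isT_cp (hi : i ≤ k) {A A' B B' : Z} (h1 : M.IsT i A A') (h2 : M.IsT i B B')
    (e : M.fc i true A = M.fc i false B) : M.IsT i (M.cp i A B) (M.cp (i + 1) A' B') :=
  have := h.dcat_laws hi
  t_iff.1 ((t_iff (L := L).2 h1).v (t_iff.2 h2) e)

theorem Tower.isT_cp_succ (hi : i ≤ k) {A A' B B' : Z} (h1 : M.IsT i A A') (h2 : M.IsT i B B')
    (e : M.fc (i + 1) true A = M.fc (i + 1) false B) :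
    M.IsT i (M.cp (i + 1) A B) (M.cp i A' B') :=
  have := h.dcat_laws hi
  t_iff.1 ((t_iff (L := L).2 h1).h (t_iff.2 h2) e)

theorem Tower.isT_dg (hi : i ≤ k) (x : Y) : M.IsT i (M.dg i x) (M.dg (i + 1) x) :=
  have := h.dcat_laws hi
  t_iff.1 (DCat.T.d1 (D := dcat L M i) x)

theorem Tower.isT_cn_self (hi : i ≤ k) (α : Bool) (x : Y) :
    M.IsT i (M.cn i α x) (M.cn i α x) :=
  have := h.dcat_laws hi
  t_iff.1 (DCat.T.g (D := dcat L M i) α x)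

theorem Tower.exists_isT_iff (hi : i ≤ k) (A : Z) :
    (∃ B, M.IsT i A B) ↔ ∃ B, M.Inv i (M.ps i A) B := by
  have := h.dcat_laws hi
  have := DCat.exists_T_iff (D := dcat L M i) A
  simp only [t_iff, r1_iff] at this
  exact this

theorem Tower.exists_isT_of_inv_succ (hi : i ≤ k) {A B : Z} (h1 : M.Inv (i + 1) A B) :
    ∃ C, M.IsT i A C := by
  have := h.dcat_laws hi
  obtain ⟨C, hC⟩ := DCat.T.exists_of_R2 (r2_iff (L := L).2 h1)
  exact ⟨C, t_iff.1 hC⟩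

theorem Tower.exists_inv_succ (hi : i ≤ k) {A B : Z} (h1 : M.IsT i A B)
    (h2 : ∀ α, ∃ x, L.Inv i (M.fc i α A) x) : ∃ C, M.Inv (i + 1) A C := by
  have := h.dcat_laws hi
  obtain ⟨p, hp⟩ := h2 false
  obtain ⟨q, hq⟩ := h2 true
  obtain ⟨C, hC⟩ := (t_iff (L := L).2 h1).exists_R2 (eInv_iff.2 hp) (eInv_iff.2 hq)
  exact ⟨C, r2_iff.1 hC⟩

theorem Tower.ps_injective (hi : i ≤ k) {A B : Z} (h1 : ∀ α, M.fc i α A = M.fc i α B)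
    (h2 : ∀ α, M.fc (i + 1) α A = M.fc (i + 1) α B) (h3 : M.ps i A = M.ps i B) : A = B :=
  have := h.dcat_laws hi
  (dcat L M i).psi_injective h1 h2 h3

/-- The corner relation between the faces `∂_i` and `∂_{i+1}`. -/
theorem Tower.corner (hi : i ≤ k) (α β : Bool) (A : Z) :
    L.fc i α (M.fc i β A) = L.fc i β (M.fc (i + 1) α A) :=
  have := h.dcat_laws hi
  DCat.Laws.b_f1 (D := dcat L M i) α β A

/-- Foldings commute with the operations in a third direction, up to renumbering. Since
transposition is expressed through foldings, its stability under those operations reduces to that of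
inverses. -/
theorem Tower.fc_ps (hi : i ≤ k) (hc : c ≤ k + 1) (h1 : c ≠ i) (h2 : c ≠ i + 1) (α : Bool)
    (A : Z) : M.fc c α (M.ps i A) = L.ps (lo i c) (M.fc c α A) := by
  obtain ⟨e1, e2⟩ := h.snd.ps_composable (Nat.lt_succ_of_le hi) A
  unfold ps
  rw [h.mix.fc_cp hc (by omega) h2 α e2, h.mix.fc_cp hc (by omega) h2 α e1,
    h.mix.fc_cn hc hi h1 h2, h.mix.fc_cn hc hi h1 h2, ← lo_succ_right h1,
    h.mix.fc_fc hc (by omega) h2, h.mix.fc_fc hc (by omega) h2, lo_succ_left h1 h2]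

theorem Tower.ps_cp (hi : i ≤ k) (hc : c ≤ k + 1) (h1 : c ≠ i) (h2 : c ≠ i + 1) {A B : Z}
    (e : M.fc c true A = M.fc c false B) :
    M.ps i (M.cp c A B) = M.cp c (M.ps i A) (M.ps i B) := by
  have hi' : i + 1 ≤ k + 1 := by omega
  obtain ⟨a1, a2⟩ := h.snd.ps_composable (Nat.lt_succ_of_le hi) A
  obtain ⟨b1, b2⟩ := h.snd.ps_composable (Nat.lt_succ_of_le hi) B
  have f (α : Bool) : L.fc (lo c i) true (M.fc (i + 1) α A) =
      L.fc (lo c i) false (M.fc (i + 1) α B) := by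
    rw [← lo_succ_right h1]
    exact h.mix.fc_composable hi' hc (Ne.symm h2) α e
  have g (α β : Bool) : M.fc c true (M.cn i α (M.fc (i + 1) β A)) =
      M.fc c false (M.cn i α (M.fc (i + 1) β B)) := by
    rw [h.mix.fc_cn hc hi h1 h2, h.mix.fc_cn hc hi h1 h2, f]
  unfold ps
  rw [h.mix.fc_cp hi' hc (Ne.symm h2) _ e, h.mix.fc_cp hi' hc (Ne.symm h2) _ e,
    lo_succ_right h1, h.mix.cn_cp hi hc h1 h2 _ (f _), h.mix.cn_cp hi hc h1 h2 _ (f _),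
    h.exch hc hi' h2 (g _ _) e a1 b1, h.exch hc hi' h2 _ (g _ _) a2 b2]
  rw [h.mix.fc_cp hc hi' h2 _ a1, h.mix.fc_cp hc hi' h2 _ b1, g, e]

theorem Tower.ps_dg (hi : i ≤ k) (hc : c ≤ k + 1) (h1 : c ≠ i) (h2 : c ≠ i + 1) (A : Y) :
    M.ps i (M.dg c A) = M.dg c (L.ps (lo i c) A) := by
  have hi' : i + 1 ≤ k + 1 := by omega
  obtain ⟨a1, a2⟩ := h.fst.ps_composable (lo_lt hi hc h1 h2) A
  rw [← lo_succ_left h1 h2] at a1 a2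
  unfold ps
  rw [← lo_succ_left h1 h2, h.mix.dg_cp hc hi' (Ne.symm h2) a2, h.mix.dg_cp hc hi' (Ne.symm h2) a1,
    ← h.mix.cn_dg hi hc h1 h2, ← h.mix.cn_dg hi hc h1 h2, h.mix.fc_dg hi' hc (Ne.symm h2),
    h.mix.fc_dg hi' hc (Ne.symm h2), lo_succ_right h1]

/-- For `c = i + 1` the connection shares a direction with the folding. That case fails here and is
the reason for introducing thin cells. -/
theorem Tower.ps_cn (hic : i + 2 ≤ c) (hc : c ≤ k) (α : Bool) (A : Y) :
    M.ps i (M.cn c α A) = M.cn c α (L.ps i A) := by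
  obtain ⟨a1, a2⟩ := h.fst.ps_composable (i := i) (by omega) A
  have l1 : lo (i + 1) c = i + 1 := lo_of_lt (by omega)
  have l2 : lo c (i + 1) = c - 1 := lo_of_ge (by omega)
  have l3 (α β : Bool) (B : X) : M.cn c α (L.cn i β B) = M.cn i β (L.cn (c - 1) α B) := by
    have := h.mix.cn_cn (i := i) (j := c - 1) (by omega) (by omega) β α B
    rw [this]
    congr 1
    omega
  unfold ps
  rw [← l1] at a1 a2
  have e1 := h.mix.cn_cp hc (c := i + 1) (by omega) (by omega) (by omega) α a2
  have e2 := h.mix.cn_cp hc (c := i + 1) (by omega) (by omega) (by omega) α a1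
  rw [l1] at e1 e2
  rw [e1, e2, l3, l3, h.mix.fc_cn (by omega) hc (by omega) (by omega),
    h.mix.fc_cn (by omega) hc (by omega) (by omega), l1, l2]

/-! ### Inverses in a third direction -/

theorem Tower.inv_fc (hi : i ≤ k + 1) (hc : c ≤ k + 1) (h1 : c ≠ i) (α : Bool) {A B : Z}
    (e : M.Inv i A B) : L.Inv (lo i c) (M.fc c α A) (M.fc c α B) where
  tf := h.mix.fc_composable hc hi h1 α e.tf
  ft := h.mix.fc_composable hc hi h1 α e.ft
  left := by
    rw [← h.mix.fc_cp hc hi h1 α e.tf, e.left, h.mix.fc_dg hc hi h1, h.mix.fc_fc hi hc h1.symm]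
  right := by
    rw [← h.mix.fc_cp hc hi h1 α e.ft, e.right, h.mix.fc_dg hc hi h1, h.mix.fc_fc hi hc h1.symm]

theorem Tower.inv_dg (hi : i ≤ k + 1) (hc : c ≤ k + 1) (h1 : c ≠ i) {A B : Y}
    (e : L.Inv (lo i c) A B) : M.Inv i (M.dg c A) (M.dg c B) where
  tf := by rw [h.mix.fc_dg hi hc h1.symm, h.mix.fc_dg hi hc h1.symm, e.tf]
  ft := by rw [h.mix.fc_dg hi hc h1.symm, h.mix.fc_dg hi hc h1.symm, e.ft]
  left := by
    rw [← h.mix.dg_cp hc hi h1.symm e.tf, e.left, h.mix.fc_dg hi hc h1.symm,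
      h.mix.dg_dg hc hi h1]
  right := by
    rw [← h.mix.dg_cp hc hi h1.symm e.ft, e.right, h.mix.fc_dg hi hc h1.symm,
      h.mix.dg_dg hc hi h1]

theorem Tower.inv_cn (hc : c ≤ k) (hi : i ≤ k + 1) (h1 : i ≠ c) (h2 : i ≠ c + 1) (α : Bool)
    {A B : Y} (e : L.Inv (lo i c) A B) : M.Inv i (M.cn c α A) (M.cn c α B) where
  tf := by rw [h.mix.fc_cn hi hc h1 h2, h.mix.fc_cn hi hc h1 h2, e.tf]
  ft := by rw [h.mix.fc_cn hi hc h1 h2, h.mix.fc_cn hi hc h1 h2, e.ft]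
  left := by
    rw [← h.mix.cn_cp hc hi h1 h2 α e.tf, e.left, h.mix.cn_dg hc hi h1 h2,
      h.mix.fc_cn hi hc h1 h2]
  right := by
    rw [← h.mix.cn_cp hc hi h1 h2 α e.ft, e.right, h.mix.cn_dg hc hi h1 h2,
      h.mix.fc_cn hi hc h1 h2]

theorem Tower.inv_cp (hi : i ≤ k + 1) (hc : c ≤ k + 1) (h1 : c ≠ i) {A A' B B' : Z}
    (e : M.Inv i A A') (e' : M.Inv i B B') (g : M.fc c true A = M.fc c false B)
    (g' : M.fc c true A' = M.fc c false B') : M.Inv i (M.cp c A B) (M.cp c A' B') where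
  tf := by
    rw [h.mix.fc_cp hi hc h1.symm _ g, h.mix.fc_cp hi hc h1.symm _ g', e.tf, e'.tf]
  ft := by
    rw [h.mix.fc_cp hi hc h1.symm _ g, h.mix.fc_cp hi hc h1.symm _ g', e.ft, e'.ft]
  left := by
    rw [← h.exch hi hc h1.symm e.tf e'.tf g g', e.left, e'.left,
      h.mix.fc_cp hi hc h1.symm _ g, h.mix.dg_cp hi hc h1]
    exact h.mix.fc_composable hi hc h1.symm _ g
  right := by
    rw [← h.exch hi hc h1.symm e.ft e'.ft g' g, e.right, e'.right,
      h.mix.fc_cp hi hc h1.symm _ g', h.mix.dg_cp hi hc h1]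
    exact h.mix.fc_composable hi hc h1.symm _ g'

/-! ### Transpositions in a third direction -/

theorem Tower.isT_fc (hi : i ≤ k) (hc : c ≤ k + 1) (h1 : c ≠ i) (h2 : c ≠ i + 1) (α : Bool)
    {A B : Z} (e : M.IsT i A B) : L.IsT (lo i c) (M.fc c α A) (M.fc c α B) where
  f12 β := by
    rw [h.mix.fc_fc (by omega) hc h1.symm, e.f12, ← lo_succ_left h1 h2,
      h.mix.fc_fc (by omega) hc h2.symm, lo_succ_right h1]
  f21 β := by
    rw [h.mix.fc_fc (by omega) hc h1.symm, ← e.f21, ← lo_succ_left h1 h2,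
      h.mix.fc_fc (by omega) hc h2.symm, lo_succ_right h1]
  inv := by
    rw [← h.fc_ps hi hc h1 h2, ← h.fc_ps hi hc h1 h2]
    exact h.inv_fc (by omega) hc h1 α e.inv

theorem Tower.isT_dg_of (hi : i ≤ k) (hc : c ≤ k + 1) (h1 : c ≠ i) (h2 : c ≠ i + 1)
    {A B : Y} (e : L.IsT (lo i c) A B) : M.IsT i (M.dg c A) (M.dg c B) where
  f12 β := by
    rw [h.mix.fc_dg (by omega) hc h1.symm, e.f12, ← lo_succ_left h1 h2,
      h.mix.fc_dg (by omega) hc h2.symm, lo_succ_right h1]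
  f21 β := by
    rw [h.mix.fc_dg (by omega) hc h1.symm, ← e.f21, ← lo_succ_left h1 h2,
      h.mix.fc_dg (by omega) hc h2.symm, lo_succ_right h1]
  inv := by
    rw [h.ps_dg hi hc h1 h2, h.ps_dg hi hc h1 h2]
    exact h.inv_dg (by omega) hc h1 e.inv

theorem Tower.isT_cn_of (hic : i + 2 ≤ c) (hc : c ≤ k) (α : Bool)
    {A B : Y} (e : L.IsT i A B) : M.IsT i (M.cn c α A) (M.cn c α B) := by
  have l1 : lo i c = i := lo_of_lt (by omega)
  have l2 : lo (i + 1) c = i + 1 := lo_of_lt (by omega)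
  have l3 : lo c (i + 1) = lo c i := lo_succ_right (by omega)
  refine ⟨fun β => ?_, fun β => ?_, ?_⟩
  · rw [h.mix.fc_cn (by omega) hc (by omega) (by omega), h.mix.fc_cn (by omega) hc (by omega)
      (by omega), l1, l2, l3, e.f12]
  · rw [h.mix.fc_cn (by omega) hc (by omega) (by omega), h.mix.fc_cn (by omega) hc (by omega)
      (by omega), l1, l2, l3, e.f21]
  · rw [h.ps_cn hic hc, h.ps_cn hic hc]
    exact h.inv_cn hc (by omega) (by omega) (by omega) α (l1.symm ▸ e.inv)

theorem Tower.isT_cp_of (hi : i ≤ k) (hc : c ≤ k + 1) (h1 : c ≠ i) (h2 : c ≠ i + 1)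
    {A A' B B' : Z} (e : M.IsT i A A') (e' : M.IsT i B B') (g : M.fc c true A = M.fc c false B)
    (g' : M.fc c true A' = M.fc c false B') : M.IsT i (M.cp c A B) (M.cp c A' B') where
  f12 β := by
    rw [h.mix.fc_cp (by omega) hc h1.symm _ g, h.mix.fc_cp (by omega) hc h2.symm _ g', e.f12,
      e'.f12, lo_succ_right h1]
  f21 β := by
    rw [h.mix.fc_cp (by omega) hc h1.symm _ g', h.mix.fc_cp (by omega) hc h2.symm _ g, e.f21,
      e'.f21, lo_succ_right h1]
  inv := by
    rw [h.ps_cp hi hc h1 h2 g, h.ps_cp hi hc h1 h2 g']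
    exact h.inv_cp (by omega) hc h1 e.inv e'.inv
      (by rw [h.fc_ps hi hc h1 h2, h.fc_ps hi hc h1 h2, g])
      (by rw [h.fc_ps hi hc h1 h2, h.fc_ps hi hc h1 h2, g'])

end TwoLayers

section ThreeLayers

variable {W : Type u} {K : Layer k W X} {L : Layer (k + 1) X Y} {M : Layer (k + 1 + 1) Y Z}

/-- Transposition commutes with compositions in a third direction. -/
theorem Tower.isT_cp_third (h : Tower K L) (h' : Tower L M) (hi : i ≤ k + 1) (hc : c ≤ k + 2)
    (h1 : c ≠ i) (h2 : c ≠ i + 1)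
    {A A' B B' : Z} (e : M.IsT i A A') (e' : M.IsT i B B') (g : M.fc c true A = M.fc c false B) :
    M.fc c true A' = M.fc c false B' ∧ M.IsT i (M.cp c A B) (M.cp c A' B') := by
  -- The composability of `A'` and `B'` is not assumed: the two faces are transposed to the same
  -- cell, and transposed cells are unique one dimension lower.
  have g' : M.fc c true A' = M.fc c false B' := by
    have a := h'.isT_fc hi hc h1 h2 true e
    have b := h'.isT_fc hi hc h1 h2 false e'
    rw [g] at a
    exact h.isT_unique (Nat.le_of_lt_succ (lo_lt hi hc h1 h2)) a b
  exact ⟨g', h'.isT_cp_of hi hc h1 h2 e e' g g'⟩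

end ThreeLayers
end Layer

/-! ### Sets of squares stable under folding and unfolding. -/

namespace DCat
open Laws

variable {O E S : Type u} {D : DCat O E S} [D.Laws]

/-- A set of squares which is closed under compositions and contains the degenerate squares of the
first direction. -/
structure Closed (D : DCat O E S) (P : S → Prop) : Prop where
  d1 : ∀ x, P (D.d1 x)
  v : ∀ A B, D.f1 true A = D.f1 false B → P A → P B → P (D.v A B)
  h : ∀ A B, D.f2 true A = D.f2 false B → P A → P B → P (D.h A B)

variable {P : S → Prop}

theorem Closed.psi_v (hP : D.Closed P) {A B : S} (c : D.f1 true A = D.f1 false B)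
    (hA : P (D.psi A)) (hB : P (D.psi B)) : P (D.psi (D.v A B)) := by
  have h1 : D.b true (D.f2 false A) = D.b false (D.f2 false B) := by
    rw [← b_f1, ← b_f1, c]
  have h2 : D.b true (D.f2 true A) = D.b false (D.f2 true B) := by
    rw [← b_f1, ← b_f1, c]
  have k1 : D.f2 true (D.psi A) = D.f2 false (D.d1 (D.f2 true B)) := by simp [f2_psi_true, h2]
  have k2 : D.f2 true (D.d1 (D.f2 false A)) = D.f2 false (D.psi B) := by simp [f2_psi_false, h1]
  rw [DCat.psi_v D A B c]
  refine hP.v _ _ ?_ (hP.h _ _ k1 hA (hP.d1 _)) (hP.h _ _ k2 (hP.d1 _) hB)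
  rw [f1_h _ _ _ k1, f1_h _ _ _ k2, f1_psi_true, f1_psi_false, f1_d1, f1_d1, c,
    m_assoc _ _ _ (by simp [h1]) (by simp)]

theorem Closed.psi_h (hP : D.Closed P) {A B : S} (c : D.f2 true A = D.f2 false B)
    (hA : P (D.psi A)) (hB : P (D.psi B)) : P (D.psi (D.h A B)) := by
  have k1 : D.f2 true (D.psi A) = D.f2 false (D.d1 (D.f1 true B)) := by simp [f2_psi_true, c]
  have k2 : D.f2 true (D.d1 (D.f1 false A)) = D.f2 false (D.psi B) := by simp [f2_psi_false, c]
  rw [DCat.psi_h D A B c]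
  refine hP.v _ _ ?_ (hP.h _ _ k2 (hP.d1 _) hB) (hP.h _ _ k1 hA (hP.d1 _))
  rw [f1_h _ _ _ k1, f1_h _ _ _ k2, f1_psi_true, f1_psi_false, f1_d1, f1_d1, c,
    m_assoc _ _ _ (by simp [c]) (by simp)]

/-- Only the connections on the faces of `A` are required to lie in `P`, because the set of
`T_i`-invertible cells does not contain all connections. -/
theorem psi_mem (hh : ∀ A B, D.f2 true A = D.f2 false B → P A → P B → P (D.h A B)) {A : S}
    (hg : ∀ α β, P (D.g α (D.f2 β A))) (hA : P A) : P (D.psi A) :=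
  hh _ _ (by simp) (hh _ _ (by simp) (hg _ _) hA) (hg _ _)

theorem mem_of_psi_mem (hv : ∀ A B, D.f1 true A = D.f1 false B → P A → P B → P (D.v A B))
    (hh : ∀ A B, D.f2 true A = D.f2 false B → P A → P B → P (D.h A B)) {A : S}
    (hd : ∀ α, P (D.d1 (D.f1 α A))) (hg : ∀ α β, P (D.g α (D.f2 β A))) (hA : P (D.psi A)) :
    P A := by
  rw [← D.unf_psi A]
  refine hv _ _ ?_ (hv _ _ ?_ (hh _ _ ?_ (hd _) (hg _ _)) hA) (hh _ _ ?_ (hg _ _) (hd _))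
  · rw [f1_v_true _ _ (by simp [f1_psi_false]), f1_psi_true]; simp
  · simp [f1_psi_false]
  · simp
  · simp

theorem Closed.psi (hP : D.Closed P) (hg : ∀ α x, P (D.g α x)) {A : S} (hA : P A) :
    P (D.psi A) :=
  psi_mem hP.h (fun _ _ => hg _ _) hA

theorem Closed.of_psi (hP : D.Closed P) (hg : ∀ α x, P (D.g α x)) {A : S} (hA : P (D.psi A)) :
    P A :=
  mem_of_psi_mem hP.v hP.h (fun _ => hP.d1 _) (fun _ _ => hg _ _) hA

/-- The transposed square of an invertible square belongs to any closed set that contains its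
inverse. -/
theorem Closed.of_T_of_R1 (hP : D.Closed P) (hg : ∀ α x, P (D.g α x)) {A B C : S}
    (h : D.R1 A B) (hB : P B) (hC : D.T A C) : P C := by
  apply hP.of_psi hg
  -- The folding of `C` is the inverse of `ψ A`, which `R1.psi` describes as a whiskering of `ψ B`.
  rw [hC.inv.unique h.psi]
  have c1 := (h.f2_inv false).tf
  have c4 := (h.f2_inv true).ft
  have k : D.f2 true (D.d1 (D.f2 false A)) = D.f2 false (D.psi B) := by simp [f2_psi_false, c1]
  refine hP.h _ _ ?_ (hP.h _ _ k (hP.d1 _) (hP.psi hg hB)) (hP.d1 _)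
  rw [f2_h_true _ _ k]
  simp [f2_psi_true, c4]

/-- The conditions on faces for two foldings to be inverse to each other. -/
theorem psi_faces {A B : S} (h1 : ∀ α, D.f1 α A = D.f2 α B) (h2 : ∀ α, D.f2 α A = D.f1 α B) :
    D.f1 true (D.psi A) = D.f1 false (D.psi B) ∧ D.f1 true (D.psi B) = D.f1 false (D.psi A) ∧
    ∀ α, D.f2 α (D.v (D.psi A) (D.psi B)) = D.f2 α (D.d1 (D.f1 false (D.psi A))) := by
  have e1 : D.f1 true (D.psi A) = D.f1 false (D.psi B) := by
    rw [f1_psi_true, f1_psi_false, h1, h2]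
  refine ⟨e1, by rw [f1_psi_true, f1_psi_false, h1, h2], ?_⟩
  rintro (_ | _)
  · rw [f2_v _ _ _ e1, f2_psi_false, f2_psi_false, f2_d1, b_f1, f2_psi_false, ← h1, b_f1]
    simp
  · rw [f2_v _ _ _ e1, f2_psi_true, f2_psi_true, f2_d1, b_f1, f2_psi_true, ← h1, b_f1]
    simp

theorem g_m_false_composable (D : DCat O E S) [D.Laws] {x y : E} (c : D.b true x = D.b false y) :
    D.f1 true (D.g false x) = D.f1 false (D.d2 y) ∧ D.f1 true (D.d1 y) = D.f1 false (D.g false y) ∧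
    D.f2 true (D.v (D.g false x) (D.d2 y)) = D.f2 false (D.v (D.d1 y) (D.g false y)) := by
  have c1 : D.f1 true (D.g false x) = D.f1 false (D.d2 y) := by simp [c]
  have c2 : D.f1 true (D.d1 y) = D.f1 false (D.g false y) := by simp
  exact ⟨c1, c2, by rw [f2_v _ _ _ c1, f2_v _ _ _ c2]; simp [c]⟩

theorem g_m_true_composable (D : DCat O E S) [D.Laws] {x y : E} (c : D.b true x = D.b false y) :
    D.f1 true (D.g true x) = D.f1 false (D.d1 x) ∧ D.f1 true (D.d2 x) = D.f1 false (D.g true y) ∧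
    D.f2 true (D.v (D.g true x) (D.d1 x)) = D.f2 false (D.v (D.d2 x) (D.g true y)) := by
  have c1 : D.f1 true (D.g true x) = D.f1 false (D.d1 x) := by simp
  have c2 : D.f1 true (D.d2 x) = D.f1 false (D.g true y) := by simp [c]
  exact ⟨c1, c2, by rw [f2_v _ _ _ c1, f2_v _ _ _ c2]; simp [c]⟩

end DCat

/-! ### Thin cells, and transpositions of connections. -/

namespace Layer

variable {k : ℕ} {W X Y Z : Type u}

/-- The composite folding `ψ_i ψ_{i+1} A` is degenerate in the direction `i`. -/
def Thin (M : Layer k Y Z) (i : ℕ) (A : Z) : Prop :=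
  ∃ a, M.ps i (M.ps (i + 1) A) = M.dg i a

/-- `A` has a thin transposed cell. -/
def ThinT (M : Layer k Y Z) (i : ℕ) (A : Z) : Prop :=
  ∃ B, M.Thin i B ∧ M.IsT i A B

variable {K : Layer k W X} {L : Layer (k + 1) X Y} {M : Layer (k + 1 + 1) Y Z} {i c : ℕ}

section Degenerate

variable (h : Tower L M)
include h

/-- For `c = i` composability forces the two degenerate cells to be equal and the composite is a
unit law; otherwise degeneracies preserve the composition. -/
theorem Tower.deg_cp {i c : ℕ} (hi : i ≤ k + 2) (hc : c ≤ k + 2) {A B : Z}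
    (hA : ∃ a, A = M.dg i a) (hB : ∃ b, B = M.dg i b) (e : M.fc c true A = M.fc c false B) :
    ∃ a, M.cp c A B = M.dg i a := by
  obtain ⟨a, rfl⟩ := hA
  obtain ⟨b, rfl⟩ := hB
  by_cases hci : c = i
  · subst hci
    rw [h.snd.fc_dg_self, h.snd.fc_dg_self] at e
    subst e
    have := h.snd.cp_dg c (M.dg c a)
    rw [h.snd.fc_dg_self] at this
    exact ⟨a, this⟩
  · refine ⟨_, (h.mix.dg_cp hi hc hci ?_).symm⟩
    rw [h.mix.fc_dg hc hi hci, h.mix.fc_dg hc hi hci] at e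
    have := congrArg (L.fc (lo i c) false) e
    rwa [h.fst.fc_dg_self, h.fst.fc_dg_self] at this

theorem Tower.closed_deg (hi : i ≤ k + 1) : (dcat L M i).Closed fun A => ∃ a, A = M.dg i a where
  d1 x := ⟨x, rfl⟩
  v _ _ e hA hB := h.deg_cp (by omega) (by omega) hA hB e
  h _ _ e hA hB := h.deg_cp (by omega) (by omega) hA hB e

theorem Tower.deg_ps_cp (hi : i ≤ k + 1) (hc : c ≤ k + 2) {A B : Z}
    (e : M.fc c true A = M.fc c false B)
    (hA : ∃ a, M.ps i A = M.dg i a) (hB : ∃ b, M.ps i B = M.dg i b) :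
    ∃ a, M.ps i (M.cp c A B) = M.dg i a := by
  have := h.dcat_laws hi
  by_cases h1 : c = i
  · subst h1; exact (h.closed_deg hi).psi_v e hA hB
  by_cases h2 : c = i + 1
  · subst h2; exact (h.closed_deg hi).psi_h e hA hB
  rw [h.ps_cp hi hc h1 h2 e]
  exact h.deg_cp (by omega) hc hA hB (by rw [h.fc_ps hi hc h1 h2, h.fc_ps hi hc h1 h2, e])

theorem Tower.ps_dg_self (hi : i ≤ k + 1) (a : Y) : M.ps i (M.dg i a) = M.dg i a :=
  have := h.dcat_laws hi
  (dcat L M i).psi_d1 a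

theorem Tower.ps_dg_succ (hi : i ≤ k + 1) (a : Y) : M.ps i (M.dg (i + 1) a) = M.dg i a :=
  have := h.dcat_laws hi
  (dcat L M i).psi_d2 a

theorem Tower.ps_cn_self (hi : i ≤ k + 1) (α : Bool) (a : Y) : M.ps i (M.cn i α a) = M.dg i a :=
  have := h.dcat_laws hi
  (dcat L M i).psi_g α a

/-- For equal signs the cell equals `Γ_i Γ_i u`, whose folding is degenerate. For opposite signs one
face in direction `i + 1` is degenerate and the other is a connection. A pair `Γ_{i+1}^+`,
`Γ_{i+1}^-` collapses, and then a pair `Γ_i^+`, `Γ_i^-`. -/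
theorem Tower.ps_cn_succ_cn (hi : i ≤ k) (α β : Bool) (u : X) :
    ∃ a, M.ps i (M.cn (i + 1) β (L.cn i α u)) = M.dg i a := by
  by_cases hαβ : β = α
  · subst hαβ
    rw [h.mix.cn_succ_cn (by omega), h.ps_cn_self (by omega)]
    exact ⟨_, rfl⟩
  have l1 : lo (i + 1 + 1) i = i + 1 := lo_of_ge (by omega)
  have l2 : lo i (i + 1 + 1) = i := lo_of_lt (by omega)
  have l3 : lo (i + 1) (i + 1 + 1) = i + 1 := lo_of_lt (by omega)
  have d1 (γ : Bool) : M.cn i γ (L.dg (i + 1) u) = M.dg (i + 1 + 1) (L.cn i γ u) := by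
    have := h.mix.cn_dg (i := i) (c := i + 1 + 1) (by omega) (by omega) (by omega) (by omega) γ u
    rwa [l1, l2] at this
  have d2 : M.cp (i + 1) (M.dg (i + 1 + 1) (L.cn i true u)) (M.dg (i + 1 + 1) (L.cn i false u)) =
      M.dg i (L.dg (i + 1) u) := by
    have e : L.fc (i + 1) true (L.cn i true u) = L.fc (i + 1) false (L.cn i false u) := by
      rw [h.fst.fc_succ_cn_self (by omega), h.fst.fc_succ_cn_self (by omega)]
    have := h.mix.dg_cp (i := i + 1 + 1) (c := i + 1) (by omega) (by omega) (by omega)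
      (A := L.cn i true u) (B := L.cn i false u) (by rwa [l3])
    rw [l3, h.fst.cp_succ_cn (by omega)] at this
    rw [← this]
    have := h.mix.dg_dg (i := i) (j := i + 1 + 1) (by omega) (by omega) (by omega) u
    rw [l1, l2] at this
    exact this.symm
  refine ⟨L.dg (i + 1) u, ?_⟩
  cases α <;> cases β <;> first | exact absurd rfl hαβ | skip
  · have f1 : M.fc (i + 1) true (M.cn (i + 1) true (L.cn i false u)) = L.cn i false u :=
      h.snd.fc_cn_self (by omega) _ _
    have f2 : M.fc (i + 1) false (M.cn (i + 1) true (L.cn i false u)) = L.dg (i + 1) u := by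
      have := h.mix.fc_cn_not (j := i + 1) (by omega) false (L.cn i false u)
      rwa [h.fst.fc_succ_cn_self (by omega)] at this
    obtain ⟨a1, a2⟩ := h.snd.ps_composable (i := i) (by omega)
      (M.cn (i + 1) true (L.cn i false u))
    unfold ps
    rw [h.snd.fc_cp_true (by rw [a1])] at a2
    rw [h.snd.cp_assoc a1 a2, f1, f2, d1, ← h.mix.cn_succ_cn (by omega), h.snd.cp_cn (by omega), d2]
  · have f1 : M.fc (i + 1) false (M.cn (i + 1) false (L.cn i true u)) = L.cn i true u :=
      h.snd.fc_cn_self (by omega) _ _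
    have f2 : M.fc (i + 1) true (M.cn (i + 1) false (L.cn i true u)) = L.dg (i + 1) u := by
      have := h.mix.fc_cn_not (j := i + 1) (by omega) true (L.cn i true u)
      rwa [h.fst.fc_succ_cn_self (by omega)] at this
    unfold ps
    rw [f1, f2, d1, ← h.mix.cn_succ_cn (by omega), h.snd.cp_cn (by omega), d2]

end Degenerate

section Thin

variable (h : Tower K L) (h' : Tower L M)
include h'

theorem Tower.thin_cp (hi : i ≤ k) {A B : Z} (hc : c = i ∨ c = i + 1 ∨ c = i + 2)
    (e : M.fc c true A = M.fc c false B) (hA : M.Thin i A) (hB : M.Thin i B) :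
    M.Thin i (M.cp c A B) := by
  have := h'.dcat_laws (i := i + 1) (by omega)
  -- In the directions `i + 1` and `i + 2`, thinness of `A` says that its folding belongs to this
  -- closed set.
  have cl : (dcat L M (i + 1)).Closed fun A => ∃ a, M.ps i A = M.dg i a :=
    ⟨fun x => ⟨x, h'.ps_dg_succ (by omega) x⟩,
      fun A B e hA hB => h'.deg_ps_cp (by omega) (by omega) e hA hB,
      fun A B e hA hB => h'.deg_ps_cp (by omega) (by omega) e hA hB⟩
  rcases hc with rfl | rfl | rfl
  · unfold Thin
    rw [h'.ps_cp (by omega) (by omega) (by omega) (by omega) e]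
    exact h'.deg_ps_cp (by omega) (by omega) (by
      rw [h'.fc_ps (by omega) (by omega) (by omega) (by omega),
        h'.fc_ps (by omega) (by omega) (by omega) (by omega), e]) hA hB
  · exact cl.psi_v e hA hB
  · exact cl.psi_h e hA hB

theorem Tower.thin_dg (hi : i ≤ k) (hc : c = i ∨ c = i + 1 ∨ c = i + 2) (a : Y) :
    M.Thin i (M.dg c a) := by
  unfold Thin
  rcases hc with rfl | rfl | rfl
  · rw [h'.ps_dg (by omega) (by omega) (by omega) (by omega), h'.ps_dg_self (by omega)]
    exact ⟨_, rfl⟩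
  · rw [h'.ps_dg_self (by omega), h'.ps_dg_succ (by omega)]
    exact ⟨_, rfl⟩
  · rw [h'.ps_dg_succ (by omega), h'.ps_dg_succ (by omega)]
    exact ⟨_, rfl⟩

theorem Tower.thin_cn_succ (hi : i ≤ k) (α : Bool) (a : Y) : M.Thin i (M.cn (i + 1) α a) := by
  unfold Thin
  rw [h'.ps_cn_self (by omega), h'.ps_dg_succ (by omega)]
  exact ⟨_, rfl⟩

theorem Tower.thin_cn (hi : i ≤ k) (α : Bool) (a : Y) : M.Thin i (M.cn i α a) := by
  have l1 : lo (i + 1 + 1) i = i + 1 := lo_of_ge (by omega)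
  have l2 : lo i (i + 1 + 1) = i := lo_of_lt (by omega)
  obtain ⟨a1, a2⟩ := h'.snd.ps_composable (i := i + 1) (by omega) (M.cn i α a)
  have f (β : Bool) : M.fc (i + 1 + 1) β (M.cn i α a) = L.cn i α (L.fc (i + 1) β a) := by
    rw [h'.mix.fc_cn (by omega) (by omega) (by omega) (by omega), l1, l2]
  unfold Thin
  rw [ps.eq_1 M (i + 1)]
  refine h'.deg_ps_cp (by omega) (by omega) a2 (h'.deg_ps_cp (by omega) (by omega) a1 ?_ ?_) ?_
  · rw [f]; exact h'.ps_cn_succ_cn hi _ _ _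
  · rw [h'.ps_cn_self (by omega)]; exact ⟨_, rfl⟩
  · rw [f]; exact h'.ps_cn_succ_cn hi _ _ _

theorem Tower.closed_thin (hi : i ≤ k) : (dcat L M i).Closed (M.Thin i) where
  d1 x := h'.thin_dg hi (Or.inl rfl) x
  v _ _ e hA hB := h'.thin_cp hi (Or.inl rfl) e hA hB
  h _ _ e hA hB := h'.thin_cp hi (Or.inr (Or.inl rfl)) e hA hB

theorem Tower.closed_thin_succ (hi : i ≤ k) : (dcat L M (i + 1)).Closed (M.Thin i) where
  d1 x := h'.thin_dg hi (Or.inr (Or.inl rfl)) x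
  v _ _ e hA hB := h'.thin_cp hi (Or.inr (Or.inl rfl)) e hA hB
  h _ _ e hA hB := h'.thin_cp hi (Or.inr (Or.inr rfl)) e hA hB

/-- Thin cells are determined by their faces. -/
theorem Tower.thin_unique (hi : i ≤ k) {A B : Z} (hA : M.Thin i A) (hB : M.Thin i B)
    (h0 : ∀ α, M.fc i α A = M.fc i α B) (h1 : ∀ α, M.fc (i + 1) α A = M.fc (i + 1) α B)
    (h2 : ∀ α, M.fc (i + 2) α A = M.fc (i + 2) α B) : A = B := by
  have I := h'.dcat_laws (i := i) (by omega)
  have I' := h'.dcat_laws (i := i + 1) (by omega)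
  have e0 (α : Bool) : M.fc i α (M.ps (i + 1) A) = M.fc i α (M.ps (i + 1) B) := by
    rw [h'.fc_ps (by omega) (by omega) (by omega) (by omega),
      h'.fc_ps (by omega) (by omega) (by omega) (by omega), h0]
  have e1 (α : Bool) : M.fc (i + 1) α (M.ps (i + 1) A) = M.fc (i + 1) α (M.ps (i + 1) B) := by
    have a1 := (dcat L M (i + 1)).f1_psi_false A
    have a2 := (dcat L M (i + 1)).f1_psi_true A
    have b1 := (dcat L M (i + 1)).f1_psi_false B
    have b2 := (dcat L M (i + 1)).f1_psi_true B
    simp only [dcat_f1, dcat_f2] at a1 a2 b1 b2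
    rw [h1, h2] at a1 a2
    cases α
    · exact a1.trans b1.symm
    · exact a2.trans b2.symm
  refine h'.ps_injective (i := i + 1) (by omega) h1 h2 (h'.ps_injective (i := i) (by omega) e0 e1 ?_)
  obtain ⟨a, ha⟩ := hA
  obtain ⟨b, hb⟩ := hB
  have a1 := (dcat L M i).f1_psi_false (M.ps (i + 1) A)
  have b1 := (dcat L M i).f1_psi_false (M.ps (i + 1) B)
  -- A degenerate cell is recovered from any of its faces in that direction, and this face is a
  -- composite of faces of `ψ_{i+1} A`. So the double foldings agree, and injectivity of folding
  -- applies twice.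
  have a2 : a = M.fc i false (M.ps i (M.ps (i + 1) A)) := by rw [ha, h'.snd.fc_dg_self]
  have b2 : b = M.fc i false (M.ps i (M.ps (i + 1) B)) := by rw [hb, h'.snd.fc_dg_self]
  simp only [dcat_f1, dcat_f2] at a1 b1
  rw [e0, e1] at a1
  rw [ha, hb, a2, b2]
  exact congrArg _ (a1.trans b1.symm)

/-- Thin cells with exchanged faces are transposed to each other. -/
theorem Tower.thin_isT (hi : i ≤ k) {A B : Z} (hA : M.Thin i A) (hB : M.Thin i B)
    (h0 : ∀ α, L.IsT i (M.fc i α A) (M.fc i α B))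
    (h1 : ∀ α, M.fc (i + 1) α A = M.fc (i + 2) α B)
    (h2 : ∀ α, M.fc (i + 2) α A = M.fc (i + 1) α B) : M.IsT (i + 1) A B := by
  have l1 : lo i (i + 1) = i := lo_of_lt (by omega)
  have l2 : lo (i + 1) i = i := lo_of_ge (by omega)
  have I' := h'.dcat_laws (i := i + 1) (by omega)
  -- Both sides of the equation are thin, so it suffices to compare faces; in direction `i` this is
  -- the hypothesis that the faces of `A` and `B` are transposed.
  have key {A B : Z} (hA : M.Thin i A) (hB : M.Thin i B)
      (h0 : ∀ α, L.IsT i (M.fc i α A) (M.fc i α B))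
      (h1 : ∀ α, M.fc (i + 1) α A = M.fc (i + 2) α B)
      (h2 : ∀ α, M.fc (i + 2) α A = M.fc (i + 1) α B) :
      M.cp (i + 1) (M.ps (i + 1) A) (M.ps (i + 1) B) =
        M.dg (i + 1) (M.fc (i + 1) false (M.ps (i + 1) A)) := by
    obtain ⟨f1, f2, f3⟩ : M.fc (i + 1) true (M.ps (i + 1) A) = M.fc (i + 1) false (M.ps (i + 1) B) ∧
        M.fc (i + 1) true (M.ps (i + 1) B) = M.fc (i + 1) false (M.ps (i + 1) A) ∧
        ∀ α, M.fc (i + 2) α (M.cp (i + 1) (M.ps (i + 1) A) (M.ps (i + 1) B)) =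
          M.fc (i + 2) α (M.dg (i + 1) (M.fc (i + 1) false (M.ps (i + 1) A))) :=
      DCat.psi_faces (D := dcat L M (i + 1)) h1 h2
    have hg (α : Bool) (x : Y) : M.Thin i ((dcat L M (i + 1)).g α x) := h'.thin_cn_succ hi α x
    refine h'.thin_unique hi (h'.thin_cp hi (Or.inr (Or.inl rfl)) f1
      ((h'.closed_thin_succ hi).psi hg hA) ((h'.closed_thin_succ hi).psi hg hB))
      (h'.thin_dg hi (Or.inr (Or.inl rfl)) _) ?_ ?_ f3
    · intro α
      rw [h'.mix.fc_cp (by omega) (by omega) (by omega) _ f1, h'.mix.fc_dg (by omega) (by omega)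
        (by omega), l1, l2, ← h'.corner (by omega), h'.fc_ps (by omega) (by omega) (by omega)
        (by omega), h'.fc_ps (by omega) (by omega) (by omega) (by omega), l2]
      exact (h0 α).inv.left
    · rintro (_ | _)
      · rw [h'.snd.fc_cp_false f1, h'.snd.fc_dg_self]
      · rw [h'.snd.fc_cp_true f1, h'.snd.fc_dg_self]
        exact f2
  obtain ⟨f1, f2, f3⟩ := DCat.psi_faces (D := dcat L M (i + 1)) h1 h2
  exact ⟨h1, h2, f1, f2, key hA hB h0 h1 h2, key hB hA (fun α => (h0 α).symm)
    (fun α => (h2 α).symm) fun α => (h1 α).symm⟩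

/-- The folding is an identity, hence its own inverse. The transposed cell therefore has this same
folding, and unfolding a degenerate cell gives a thin one. -/
theorem Tower.thinT_cn_succ_cn (hi : i ≤ k) (α β : Bool) (u : X) :
    M.ThinT i (M.cn (i + 1) α (L.cn i β u)) := by
  have I := h'.dcat_laws (i := i) (by omega)
  obtain ⟨a, ha⟩ := h'.ps_cn_succ_cn hi β α u
  have R : (dcat L M i).R1 (M.dg i a) (M.dg i a) := DCat.R1.d1 (D := dcat L M i) a
  obtain ⟨B, hB⟩ := (h'.exists_isT_iff (i := i) (by omega) (M.cn (i + 1) α (L.cn i β u))).2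
    ⟨M.dg i a, by rw [ha]; exact r1_iff.1 R⟩
  refine ⟨B, ?_, hB⟩
  have := hB.inv
  rw [ha] at this
  have e : M.ps i B = M.dg i a := (r1_iff.2 this).unique R
  refine (h'.closed_thin hi).of_psi (fun α x => h'.thin_cn hi α x) ?_
  change M.Thin i (M.ps i B)
  rw [e]
  exact h'.thin_dg hi (Or.inl rfl) a

end Thin

section Connections

variable (h : Tower K L) (h' : Tower L M)
include h h'

/-- In direction `i` the connection `Γ_{i+1}` preserves composites. In direction `i + 1` it turns
one into a two-by-two block that also contains `ε_{i+2}` of a factor; this is why the factors are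
required to have transposed cells themselves. -/
theorem Tower.closed_thinT (hi : i ≤ k) (α : Bool) :
    (dcat K L i).Closed fun y => (∃ y', L.IsT i y y') ∧ M.ThinT i (M.cn (i + 1) α y) where
  d1 x := by
    refine ⟨⟨_, h.isT_dg hi x⟩, ?_⟩
    have := h'.mix.cn_dg (i := i + 1) (c := i) (by omega) (by omega) (by omega) (by omega) α x
    rw [lo_self_succ, lo_succ_self] at this
    change M.ThinT i (M.cn (i + 1) α (L.dg i x))
    rw [this]
    exact ⟨_, h'.thin_dg hi (Or.inr (Or.inl rfl)) _, h'.isT_dg (by omega) _⟩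
  v A B e hA hB := by
    obtain ⟨⟨A', tA⟩, ⟨P, p, tP⟩⟩ := hA
    obtain ⟨⟨B', tB⟩, ⟨Q, q, tQ⟩⟩ := hB
    refine ⟨⟨_, h.isT_cp hi tA tB e⟩, ?_⟩
    have e' : L.fc (lo i (i + 1)) true A = L.fc (lo i (i + 1)) false B := by
      rw [lo_self_succ]; exact e
    have := h'.mix.cn_cp (i := i + 1) (c := i) (by omega) (by omega) (by omega) (by omega) α e'
    rw [lo_self_succ] at this
    have e2 : M.fc i true (M.cn (i + 1) α A) = M.fc i false (M.cn (i + 1) α B) := by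
      rw [h'.mix.fc_cn (by omega) (by omega) (by omega) (by omega),
        h'.mix.fc_cn (by omega) (by omega) (by omega) (by omega), e']
    change M.ThinT i (M.cn (i + 1) α (L.cp i A B))
    rw [this]
    exact ⟨_, h'.thin_cp hi (Or.inr (Or.inl rfl)) (by rw [← tP.f12, ← tQ.f12, e2]) p q,
      h'.isT_cp (by omega) tP tQ e2⟩
  h A B e hA hB := by
    obtain ⟨⟨A', tA⟩, ⟨P, p, tP⟩⟩ := hA
    obtain ⟨⟨B', tB⟩, ⟨Q, q, tQ⟩⟩ := hB
    refine ⟨⟨_, h.isT_cp_succ hi tA tB e⟩, ?_⟩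
    have l2 : lo i (i + 2) = i := lo_of_lt (by omega)
    have succ {U V : Z} (hU : M.ThinT i U) (hV : M.ThinT i V)
        (c : M.fc (i + 1) true U = M.fc (i + 1) false V) : M.ThinT i (M.cp (i + 1) U V) := by
      obtain ⟨U', u, tU⟩ := hU
      obtain ⟨V', v, tV⟩ := hV
      exact ⟨_, h'.thin_cp hi (Or.inl rfl) (by rw [← tU.f21, ← tV.f21, c]) u v,
        h'.isT_cp_succ (by omega) tU tV c⟩
    have third {U V : Z} (hU : M.ThinT i U) (hV : M.ThinT i V)
        (c : M.fc (i + 2) true U = M.fc (i + 2) false V) : M.ThinT i (M.cp (i + 2) U V) := by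
      obtain ⟨U', u, tU⟩ := hU
      obtain ⟨V', v, tV⟩ := hV
      obtain ⟨c', t⟩ := h.isT_cp_third h' (c := i + 2) (by omega) (by omega) (by omega) (by omega) tU tV c
      exact ⟨_, h'.thin_cp hi (Or.inr (Or.inr rfl)) c' u v, t⟩
    have deg (U : Y) : M.ThinT i (M.dg (i + 1) U) :=
      ⟨_, h'.thin_dg hi (Or.inl rfl) _, (h'.isT_dg (by omega) U).symm⟩
    have deg2 {U U' : Y} (t : L.IsT i U U') : M.ThinT i (M.dg (i + 2) U) :=
      ⟨_, h'.thin_dg hi (Or.inr (Or.inr rfl)) _,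
        h'.isT_dg_of (by omega) (by omega) (by omega) (by omega) (l2.symm ▸ t)⟩
    have I := h'.dcat_laws (i := i + 1) (by omega)
    have hA : M.ThinT i (M.cn (i + 1) α A) := ⟨P, p, tP⟩
    have hB : M.ThinT i (M.cn (i + 1) α B) := ⟨Q, q, tQ⟩
    change M.ThinT i (M.cn (i + 1) α (L.cp (i + 1) A B))
    have e' : L.fc (i + 1) true A = L.fc (i + 1) false B := e
    cases α
    · obtain ⟨c1, c2, c3⟩ := (dcat L M (i + 1)).g_m_false_composable e'
      rw [h'.mix.cn_cp_self_false (by omega) e']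
      exact third (succ hA (deg2 tB) c1) (succ (deg B) hB c2) c3
    · obtain ⟨c1, c2, c3⟩ := (dcat L M (i + 1)).g_m_true_composable e'
      rw [h'.mix.cn_cp_self_true (by omega) e']
      exact third (succ hA (deg A) c1) (succ (deg2 tA) hB c2) c3

/-- The transposition of a connection on a cell with a transposed cell. -/
theorem Tower.exists_isT_cn (hi : i ≤ k) (α : Bool) {y y' : Y} (t : L.IsT i y y') :
    ∃ Z, M.IsT i (M.cn (i + 1) α y) Z ∧ M.IsT (i + 1) Z (M.cn i α y') := by
  have I := h.dcat_laws hi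
  have I' := h'.dcat_laws (i := i) (by omega)
  have l2 : lo i (i + 2) = i := lo_of_lt (by omega)
  have l3 : lo (i + 2) i = i + 1 := lo_of_ge (by omega)
  -- By closure it suffices to treat the folding of `y` and the connections used to unfold it. Since
  -- `ψ_i y` is invertible for `⋆_i`, so is `Γ_{i+1} ψ_i y`, with a thin inverse, and invertible
  -- cells have transposed cells.
  have main : M.ThinT i (M.cn (i + 1) α y) := by
    refine ((h.closed_thinT h' hi α).of_psi (fun β s => ⟨⟨_, h.isT_cn_self hi β s⟩,
      h'.thinT_cn_succ_cn hi α β s⟩) (A := y) ⟨?_, ?_⟩).2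
    · obtain ⟨C, hC⟩ := DCat.T.exists_of_R1 (r1_iff (L := K).2 t.inv)
      exact ⟨C, t_iff.1 hC⟩
    · have R : M.Inv i (M.cn (i + 1) α (L.ps i y)) (M.cn (i + 1) α (L.ps i y')) :=
        h'.inv_cn (by omega) (by omega) (by omega) (by omega) α (by
          rw [lo_self_succ]; exact t.inv)
      obtain ⟨C, hC⟩ := DCat.T.exists_of_R1 (r1_iff (L := L).2 R)
      exact ⟨C, (h'.closed_thin hi).of_T_of_R1 (fun α x => h'.thin_cn hi α x) (r1_iff.2 R)
        (h'.thin_cn_succ hi _ _) hC, t_iff.1 hC⟩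
  obtain ⟨Z, hZ, tZ⟩ := main
  -- Both cells are thin, so only the faces of `Z` and `Γ_i y'` remain to be compared.
  refine ⟨Z, tZ, h'.thin_isT hi hZ (h'.thin_cn hi _ _) (fun β => ?_) (fun β => ?_) fun β => ?_⟩
  · rw [← tZ.f21]
    by_cases hβ : α = β
    · subst hβ
      rw [h'.snd.fc_cn_self (by omega), h'.snd.fc_cn_self (by omega)]
      exact t
    · obtain rfl : α = !β := by cases α <;> cases β <;> simp_all
      rw [h'.mix.fc_cn_not (by omega), h'.mix.fc_cn_not (by omega), t.f21]
      exact (h.isT_dg hi _).symm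
  · rw [← tZ.f12, h'.mix.fc_cn (by omega) (by omega) (by omega) (by omega),
      h'.mix.fc_cn (by omega) (by omega) (by omega) (by omega), lo_self_succ, lo_succ_self, l2, l3,
      t.f12]
  · have s := h'.isT_fc (by omega) (c := i + 2) (by omega) (by omega) (by omega) β tZ
    rw [l2] at s
    by_cases hβ : α = β
    · subst hβ
      have s1 : M.fc (i + 2) α (M.cn (i + 1) α y) = y := h'.snd.fc_succ_cn_self (by omega) _ _
      rw [s1] at s
      rw [h'.snd.fc_succ_cn_self (by omega)]
      exact h.isT_unique hi s t
    · obtain rfl : α = !β := by cases α <;> cases β <;> simp_all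
      have s1 : M.fc (i + 2) β (M.cn (i + 1) (!β) y) = L.dg (i + 1) (L.fc (i + 1) β y) :=
        h'.mix.fc_succ_cn_not (by omega) _ _
      rw [s1, t.f21] at s
      rw [h'.mix.fc_succ_cn_not (by omega)]
      exact h.isT_unique hi s (h.isT_dg hi _).symm

end Connections
end Layer

/-! ### Iterated foldings and plain invertibility. -/

namespace Layer

variable {k : ℕ} {X Y Z : Type u}

/-- The iterated folding `ψ_m ψ_{m+1} ⋯ ψ_{m+n-1}`. -/
noncomputable def ys (L : Layer k X Y) (m n : ℕ) (A : Y) : Y := (List.range' m n).foldr L.ps A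

theorem ys_succ (L : Layer k X Y) (m n : ℕ) (A : Y) :
    L.ys m (n + 1) A = L.ps m (L.ys (m + 1) n A) := rfl

/-- All the foldings involve directions above `c`; removing the direction `c` lowers their indices
by one. -/
theorem Tower.fc_ys {L : Layer k X Y} {M : Layer (k + 1) Y Z} (h : Tower L M) {n m c : ℕ}
    (hmn : m + n ≤ k) (hc : c ≤ m) (α : Bool) (A : Z) :
    M.fc c α (M.ys (m + 1) n A) = L.ys m n (M.fc c α A) := by
  induction n generalizing m with
  | zero => rfl
  | succ n ih =>
    rw [ys_succ, ys_succ, h.fc_ps (by omega) (by omega) (by omega) (by omega), ih (by omega)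
      (by omega), lo_of_ge (by omega)]
    rfl

theorem psi_eq_ps (L : Layer k X Y) (hL : L.Laws) (i : Fin k) (A : Y) :
    L.psi hL i A = L.ps i A := by
  have e1 : L.IsComp i.succ (L.conn i true (L.face i.succ false A)) A _ :=
    ⟨hL.face_conn_succ i true _, rfl⟩
  have e2 : L.IsComp i.succ _ (L.conn i false (L.face i.succ true A)) (L.psi hL i A) :=
    ⟨(hL.face_comp_true i.succ _ _ _ ⟨_, rfl⟩).trans (hL.face_conn_succ i false _).symm, rfl⟩
  rw [isComp_coe] at e1 e2
  rw [← e2.2, ← e1.2, cn_coe, cn_coe, fc_coe, fc_coe]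
  rfl

theorem foldr_psi (L : Layer k X Y) (hL : L.Laws) (A : Y) :
    (List.finRange k).foldr (L.psi hL) A = L.ys 0 k A := by
  have e : List.range' 0 k = (List.finRange k).map Fin.val := by
    rw [List.map_coe_finRange_eq_range, List.range_eq_range']
  rw [ys, e, List.foldr_map]
  congr 1
  funext i A
  exact psi_eq_ps L hL i A

theorem rInvertible_iff (L : Layer k X Y) (i : Fin (k + 1)) (A : Y) :
    L.RInvertible i A ↔ ∃ B, L.Inv i A B := by
  refine exists_congr fun B => ?_
  rw [isComp_coe, isComp_coe, dg_coe, dg_coe, fc_coe, fc_coe]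
  exact ⟨fun ⟨h1, h2⟩ => ⟨h1.1, h2.1, h1.2, h1.1 ▸ h2.2⟩,
    fun h => ⟨⟨h.tf, h.left⟩, ⟨h.ft, h.tf ▸ h.right⟩⟩⟩

theorem invertible_iff (L : Layer k X Y) (hL : L.Laws) (A : Y) :
    L.Invertible hL A ↔ ∃ B, L.Inv 0 (L.ys 0 k A) B := by
  rw [Invertible, foldr_psi, rInvertible_iff]
  rfl

end Layer

/-! ### Transposability in terms of invertibility and of faces. -/

namespace CubicalCategory
open Layer

variable {N : ℕ∞} (C : CubicalCategory.{u} N) {k i j c m n : ℕ}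

theorem tower (k : ℕ) (h : ((k + 1 : ℕ) : ℕ∞) < N) :
    Tower (C.layer k ((coe_lt_succ k).trans h)) (C.layer (k + 1) h) :=
  ⟨C.laws k _, C.laws (k + 1) _, C.laws₂ k _ _⟩

/-- `A` has a transposed cell in the directions `i` and `i + 1`. -/
def HasT (k : ℕ) (h : (k : ℕ∞) < N) (i : ℕ) (A : C.cell (k + 1)) : Prop :=
  ∃ B, (C.layer k h).IsT i A B

/-- The iterated folding `ψ_m ⋯ ψ_k A` is invertible for `⋆_m`. -/
def HasInv (k : ℕ) (h : (k : ℕ∞) < N) (m : ℕ) (A : C.cell (k + 1)) : Prop :=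
  ∃ B, (C.layer k h).Inv m ((C.layer k h).ys m (k - m) A) B

variable {C} (hk : (k : ℕ∞) < N) (hk' : ((k + 1 : ℕ) : ℕ∞) < N)

theorem HasT.cp {A B : C.cell (k + 1)} (hi : i < k) (hc : c ≤ k) (hA : C.HasT k hk i A)
    (hB : C.HasT k hk i B) (e : (C.layer k hk).fc c true A = (C.layer k hk).fc c false B) :
    C.HasT k hk i ((C.layer k hk).cp c A B) := by
  obtain ⟨A', tA⟩ := hA
  obtain ⟨B', tB⟩ := hB
  obtain _ | k := k
  · omega
  by_cases h1 : c = i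
  · subst h1
    exact ⟨_, (C.tower k hk).isT_cp (by omega) tA tB e⟩
  by_cases h2 : c = i + 1
  · subst h2
    exact ⟨_, (C.tower k hk).isT_cp_succ (by omega) tA tB e⟩
  obtain _ | k := k
  · omega
  · exact ⟨_, ((C.tower k _).isT_cp_third (C.tower (k + 1) hk) (by omega) hc h1 h2 tA tB e).2⟩

theorem HasT.fc {A : C.cell (k + 1 + 1)} (hi : i ≤ k) (hc : c ≤ k + 1) (h1 : c ≠ i)
    (h2 : c ≠ i + 1) (α : Bool) (hA : C.HasT (k + 1) hk' i A) :
    C.HasT k ((coe_lt_succ k).trans hk') (lo i c) ((C.layer (k + 1) hk').fc c α A) :=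
  let ⟨_, t⟩ := hA
  ⟨_, (C.tower k hk').isT_fc hi hc h1 h2 α t⟩

/-- For `c = i + 1` the transposed cell is `ε_i A` whatever `A` is, so the hypothesis on `A` is
restricted to larger `c`. -/
theorem HasT.dg {A : C.cell (k + 1)} (hi : i < c) (hc : c ≤ k + 1)
    (hA : i + 2 ≤ c → C.HasT k ((coe_lt_succ k).trans hk') i A) :
    C.HasT (k + 1) hk' i ((C.layer (k + 1) hk').dg c A) := by
  by_cases h : c = i + 1
  · subst h
    exact ⟨_, ((C.tower k hk').isT_dg (by omega) A).symm⟩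
  · obtain ⟨B, t⟩ := hA (by omega)
    refine ⟨_, (C.tower k hk').isT_dg_of (by omega) hc (by omega) h (B := B) ?_⟩
    rwa [lo_of_lt (by omega)]

theorem HasT.cn {A : C.cell (k + 1)} (hi : i < c) (hc : c ≤ k) (α : Bool)
    (hA : C.HasT k ((coe_lt_succ k).trans hk') i A) :
    C.HasT (k + 1) hk' i ((C.layer (k + 1) hk').cn c α A) := by
  obtain ⟨B, t⟩ := hA
  by_cases h : c = i + 1
  · subst h
    obtain _ | k := k
    · omega
    obtain ⟨Z, hZ, -⟩ := (C.tower k _).exists_isT_cn (C.tower (k + 1) hk') (by omega) α t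
    exact ⟨Z, hZ⟩
  · exact ⟨_, (C.tower k hk').isT_cn_of (by omega) hc α t⟩

theorem HasT.ps {A : C.cell (k + 1)} (hi : i < j) (hj : j < k) (hA : C.HasT k hk i A) :
    C.HasT k hk i ((C.layer k hk).ps j A) := by
  obtain _ | k := k
  · omega
  have := (C.tower k hk).dcat_laws (i := j) (by omega)
  refine DCat.psi_mem (D := dcat (C.layer k _) (C.layer (k + 1) hk) j)
    (fun A B e hA hB => HasT.cp hk (by omega) (by omega) hA hB e) (fun α β => ?_) hA
  refine HasT.cn hk hi (by omega) α ?_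
  have := HasT.fc hk (c := j + 1) (by omega) (by omega) (by omega) (by omega) β hA
  rwa [lo_of_lt (by omega)] at this

/-- Unfolding uses degeneracies on the faces in direction `j` and connections on those in direction
`j + 1`. Unlike for `HasT.ps`, transposability of these faces must be assumed. -/
theorem HasT.of_ps {A : C.cell (k + 1 + 1)} (hi : i < j) (hj : j ≤ k)
    (h1 : ∀ α, i + 2 ≤ j → C.HasT k ((coe_lt_succ k).trans hk') i ((C.layer (k + 1) hk').fc j α A))
    (h2 : ∀ α, C.HasT k ((coe_lt_succ k).trans hk') i ((C.layer (k + 1) hk').fc (j + 1) α A))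
    (hA : C.HasT (k + 1) hk' i ((C.layer (k + 1) hk').ps j A)) : C.HasT (k + 1) hk' i A := by
  have := (C.tower k hk').dcat_laws (i := j) (by omega)
  exact DCat.mem_of_psi_mem (D := dcat (C.layer k _) (C.layer (k + 1) hk') j)
    (fun A B e hA hB => HasT.cp hk' (by omega) (by omega) hA hB e)
    (fun A B e hA hB => HasT.cp hk' (by omega) (by omega) hA hB e)
    (fun α => HasT.dg hk' hi (by omega) (h1 α)) (fun α β => HasT.cn hk' hi hj α (h2 β)) hA

theorem HasT.ys {A : C.cell (k + 1)} (hi : i < m) (hmn : m + n ≤ k) (hA : C.HasT k hk i A) :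
    C.HasT k hk i ((C.layer k hk).ys m n A) := by
  induction n generalizing m with
  | zero => exact hA
  | succ n ih => exact HasT.ps hk hi (by omega) (ih (by omega) (by omega))

/-- The link between the two notions: one more folding turns a transposition in directions `i`, `i +
1` into an inverse for `⋆_i`. -/
theorem hasT_ys_iff {A : C.cell (k + 1)} (hi : i < k) :
    C.HasT k hk i ((C.layer k hk).ys (i + 1) (k - (i + 1)) A) ↔ C.HasInv k hk i A := by
  obtain _ | k := k
  · omega
  have e : k + 1 - i = (k + 1 - (i + 1)) + 1 := by omega
  rw [HasInv, e, ys_succ]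
  exact (C.tower k hk).exists_isT_iff (by omega) _

theorem HasInv.pred {A : C.cell (k + 1)} (hm : m < k) (h : C.HasInv k hk (m + 1) A) :
    C.HasInv k hk m A := by
  obtain _ | k := k
  · omega
  obtain ⟨B, hB⟩ := h
  exact (hasT_ys_iff hk hm).1 ((C.tower k hk).exists_isT_of_inv_succ (by omega) hB)

theorem HasT.hasInv {A : C.cell (k + 1)} (hi : i < k) (hm : m ≤ i) (hA : C.HasT k hk i A) :
    C.HasInv k hk m A := by
  obtain ⟨d, rfl⟩ := Nat.exists_eq_add_of_le hm
  induction d generalizing m with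
  | zero => exact (hasT_ys_iff hk hi).1 (HasT.ys hk (by omega) (by omega) hA)
  | succ d ih =>
    have e : m + (d + 1) = m + 1 + d := by omega
    exact (ih (m := m + 1) (e ▸ hi) (by omega) (e ▸ hA)).pred hk (by omega)

/-- The faces of `ψ_m B` in direction `m` are composites of faces of `B` in directions `m` and `m +
1`, which allows an induction on the number of foldings. -/
theorem HasT.fc_ys {A : C.cell (k + 1 + 1)} (hm : i + 2 ≤ m) (hmn : m + n ≤ k + 1)
    (hF : ∀ c, i + 2 ≤ c → c ≤ k + 1 → ∀ α,
      C.HasT k ((coe_lt_succ k).trans hk') i ((C.layer (k + 1) hk').fc c α A)) (α : Bool) :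
    C.HasT k ((coe_lt_succ k).trans hk') i
      ((C.layer (k + 1) hk').fc m α ((C.layer (k + 1) hk').ys m n A)) := by
  induction n generalizing m α with
  | zero => exact hF m hm (by omega) α
  | succ n ih =>
    have I := (C.tower k hk').dcat_laws (i := m) (by omega)
    rw [Layer.ys_succ]
    set B := (C.layer (k + 1) hk').ys (m + 1) n A with hB
    have h1 (β : Bool) : C.HasT k ((coe_lt_succ k).trans hk') i
        ((C.layer (k + 1) hk').fc m β B) := by
      rw [hB, (C.tower k hk').fc_ys (by omega) le_rfl]
      exact HasT.ys _ (by omega) (by omega) (hF m hm (by omega) β)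
    have h2 (β : Bool) := ih (m := m + 1) (by omega) (by omega) β
    rw [← hB] at h2
    have e (β : Bool) := (C.tower k hk').corner (i := m) (by omega) β (!β) B
    cases α
    · have := (dcat (C.layer k _) (C.layer (k + 1) hk') m).f1_psi_false B
      exact (congrArg (C.HasT k _ i) this).mpr (HasT.cp _ (by omega) (by omega) (h1 _) (h2 _) (e true))
    · have := (dcat (C.layer k _) (C.layer (k + 1) hk') m).f1_psi_true B
      exact (congrArg (C.HasT k _ i) this).mpr (HasT.cp _ (by omega) (by omega) (h2 _) (h1 _) (e false).symm)

theorem HasT.of_ys {A : C.cell (k + 1 + 1)} (hm : i < m) (hmn : m + n ≤ k + 1)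
    (hF : ∀ c, i + 2 ≤ c → c ≤ k + 1 → ∀ α,
      C.HasT k ((coe_lt_succ k).trans hk') i ((C.layer (k + 1) hk').fc c α A))
    (hA : C.HasT (k + 1) hk' i ((C.layer (k + 1) hk').ys m n A)) : C.HasT (k + 1) hk' i A := by
  induction n generalizing m with
  | zero => exact hA
  | succ n ih =>
    refine ih (m := m + 1) (by omega) (by omega) (HasT.of_ps hk' hm (by omega) (fun α h => ?_)
      (fun α => HasT.fc_ys hk' (by omega) (by omega) hF α) hA)
    rw [(C.tower k hk').fc_ys (by omega) le_rfl]
    exact HasT.ys _ hm (by omega) (hF m h (by omega) α)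

/-- A cell has a transposed cell if and only if it is invertible and its faces have transposed
cells. -/
theorem hasT_iff {A : C.cell (k + 1 + 1)} (hi : i ≤ k) :
    C.HasT (k + 1) hk' i A ↔ C.HasInv (k + 1) hk' 0 A ∧
      ∀ c ≤ k + 1, c ≠ i → c ≠ i + 1 → ∀ α,
        C.HasT k ((coe_lt_succ k).trans hk') (lo i c) ((C.layer (k + 1) hk').fc c α A) := by
  constructor
  · exact fun h => ⟨h.hasInv hk' (by omega) (by omega),
      fun c hc h1 h2 α => HasT.fc hk' hi hc h1 h2 α h⟩
  · rintro ⟨h0, hF⟩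
    -- An inverse for `⋆_m` after folding from `m` on is a transposition in directions `m`, `m + 1`
    -- after folding from `m + 1` on. The faces of that cell in direction `m` are iterated foldings
    -- of faces of `A`, hence invertible, so an inverse for `⋆_{m+1}` exists.
    have key (m : ℕ) (hm : m ≤ i) : C.HasInv (k + 1) hk' m A := by
      induction m with
      | zero => exact h0
      | succ m ih =>
        obtain ⟨B, hB⟩ := (hasT_ys_iff hk' (by omega)).2 (ih (by omega))
        have e : k + 1 - (m + 1) = k - m := by omega
        rw [e] at hB
        rw [HasInv, e]
        refine (C.tower k hk').exists_inv_succ (by omega) hB fun α => ?_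
        rw [(C.tower k hk').fc_ys (by omega) le_rfl]
        have := hF m (by omega) (by omega) (by omega) α
        rw [lo_of_ge (by omega)] at this
        exact this.hasInv _ (by omega) (by omega)
    -- At `m = i` the cell folded from `i + 1` on is transposable, and these remaining foldings can
    -- be undone.
    refine HasT.of_ys hk' (Nat.lt_succ_self i) (by omega) (fun c h1 h2 α => ?_)
      ((hasT_ys_iff hk' (by omega)).2 (key i le_rfl))
    have := hF c h2 (by omega) (by omega) α
    rwa [lo_of_lt (by omega)] at this

end CubicalCategory

/-! ### Commutation and braid relations for transpositions. -/

namespace Layer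

variable {k : ℕ} {W X Y Z : Type u}
  {K : Layer k W X} {L : Layer (k + 1) X Y} {M : Layer (k + 1 + 1) Y Z} {i j c : ℕ}

section Commutation

variable (h : Tower K L) (h' : Tower L M)
include h h'

theorem Tower.isT_ps (hij : i + 2 ≤ j) (hj : j ≤ k + 1) {A B : Z} (t : M.IsT i A B) :
    M.IsT i (M.ps j A) (M.ps j B) := by
  have f (β : Bool) : L.IsT i (M.fc (j + 1) β A) (M.fc (j + 1) β B) := by
    have := h'.isT_fc (c := j + 1) (by omega) (by omega) (by omega) (by omega) β t
    rwa [lo_of_lt (by omega)] at this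
  have g (α β : Bool) := h'.isT_cn_of hij (by omega) α (f β)
  obtain ⟨e1, e2⟩ := h'.snd.ps_composable (i := j) (by omega) A
  have t1 := (h.isT_cp_third h' (c := j + 1) (by omega) (by omega) (by omega) (by omega)
    (g true false) t (e1)).2
  exact (h.isT_cp_third h' (c := j + 1) (by omega) (by omega) (by omega) (by omega)
    t1 (g false true) e2).2

/-- Transposition respects `⋆_j` and `ε_j` for a third direction `j`, and transposed cells are
unique; so it carries the equations of an inverse to the same equations. -/
theorem Tower.inv_of_isT (hi : i ≤ k + 1) (hj : j ≤ k + 2) (h1 : j ≠ i) (h2 : j ≠ i + 1)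
    {P P' Q Q' : Z} (t : M.IsT i P Q) (t' : M.IsT i P' Q') (I : M.Inv j P P') : M.Inv j Q Q' := by
  have key {P P' Q Q' : Z} (t : M.IsT i P Q) (t' : M.IsT i P' Q') (I : M.Inv j P P') :
      M.fc j true Q = M.fc j false Q' ∧ M.cp j Q Q' = M.dg j (M.fc j false Q) := by
    obtain ⟨e, s⟩ := h.isT_cp_third h' hi hj h1 h2 t t' I.tf
    rw [I.left] at s
    exact ⟨e, h'.isT_unique hi s (h'.isT_dg_of hi hj h1 h2 (h'.isT_fc hi hj h1 h2 _ t))⟩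
  exact ⟨(key t t' I).1, (key t' t I.symm).1, (key t t' I).2, (key t' t I.symm).2⟩

/-- Transpositions in disjoint pairs of directions commute. -/
theorem Tower.isT_comm (hij : i + 2 ≤ j) (hj : j ≤ k + 1) {A B C D : Z} (hAB : M.IsT i A B)
    (hAC : M.IsT j A C) (hCD : M.IsT i C D) : M.IsT j B D where
  f12 α := by
    have t := h'.isT_fc (c := j) (by omega) (by omega) (by omega) (by omega) α hAB
    have t' := h'.isT_fc (c := j + 1) (by omega) (by omega) (by omega) (by omega) α hCD
    rw [lo_of_lt (by omega)] at t t'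
    rw [hAC.f12] at t
    exact h.isT_unique (by omega) t t'
  f21 α := by
    have t := h'.isT_fc (c := j + 1) (by omega) (by omega) (by omega) (by omega) α hAB
    have t' := h'.isT_fc (c := j) (by omega) (by omega) (by omega) (by omega) α hCD
    rw [lo_of_lt (by omega)] at t t'
    rw [hAC.f21] at t
    exact h.isT_unique (by omega) t t'
  inv := h.inv_of_isT h' (by omega) (by omega) (by omega) (by omega) (h.isT_ps h' hij hj hAB)
    (h.isT_ps h' hij hj hCD) hAC.inv

end Commutation

section Braid

/-- `B` is obtained from `A` by the transposition `T_i` followed by `T_{i+1}`. -/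
def IsTT (M : Layer k Y Z) (i : ℕ) (A B : Z) : Prop :=
  ∃ P, M.IsT i A P ∧ M.IsT (i + 1) P B

variable (h : Tower K L) (h' : Tower L M)
include h'

theorem Tower.isTT_unique (hi : i ≤ k) {A B B' : Z} (t : M.IsTT i A B) (t' : M.IsTT i A B') :
    B = B' := by
  obtain ⟨P, t1, t2⟩ := t
  obtain ⟨P', s1, s2⟩ := t'
  obtain rfl := h'.isT_unique (by omega) t1 s1
  exact h'.isT_unique (by omega) t2 s2

/-- The composite `T_{i+1} T_i` moves the directions `i + 1`, `i + 2` to `i`, `i + 1`. It therefore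
relates each operation in the former pair to that in the latter. -/
theorem Tower.isTT_fc (hi : i ≤ k) (α : Bool) {A B : Z} (t : M.IsTT i A B) :
    L.IsT i (M.fc (i + 1) α A) (M.fc i α B) := by
  obtain ⟨P, t1, t2⟩ := t
  have := h'.isT_fc (i := i + 1) (c := i) (by omega) (by omega) (by omega) (by omega) α t2
  rwa [lo_succ_self, ← t1.f21] at this

theorem Tower.isTT_fc_succ (hi : i ≤ k) (α : Bool) {A B : Z} (t : M.IsTT i A B) :
    L.IsT i (M.fc (i + 2) α A) (M.fc (i + 1) α B) := by
  obtain ⟨P, t1, t2⟩ := t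
  have := h'.isT_fc (i := i) (c := i + 2) (by omega) (by omega) (by omega) (by omega) α t1
  have e : M.fc (i + 2) α P = M.fc (i + 1) α B := t2.f21 α
  rwa [lo_of_lt (by omega), e] at this

theorem Tower.isTT_dg (hi : i ≤ k) {w w' : Y} (t : L.IsT i w w') :
    M.IsTT i (M.dg (i + 1) w) (M.dg i w') :=
  ⟨_, (h'.isT_dg (by omega) w).symm, h'.isT_dg_of (by omega) (by omega) (by omega) (by omega)
    (by rwa [lo_succ_self])⟩

include h

theorem Tower.isTT_cp (hi : i ≤ k) {A A' B B' : Z} (t : M.IsTT i A B) (t' : M.IsTT i A' B')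
    (e : M.fc (i + 1) true A = M.fc (i + 1) false A') :
    M.fc i true B = M.fc i false B' ∧ M.IsTT i (M.cp (i + 1) A A') (M.cp i B B') := by
  obtain ⟨P, t1, t2⟩ := t
  obtain ⟨P', s1, s2⟩ := t'
  obtain ⟨e', r⟩ := h.isT_cp_third h' (i := i + 1) (c := i) (by omega) (by omega) (by omega)
    (by omega) t2 s2 (by rw [← t1.f21, ← s1.f21, e])
  exact ⟨e', _, h'.isT_cp_succ (by omega) t1 s1 e, r⟩

theorem Tower.isTT_cp_succ (hi : i ≤ k) {A A' B B' : Z} (t : M.IsTT i A B)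
    (t' : M.IsTT i A' B') (e : M.fc (i + 2) true A = M.fc (i + 2) false A') :
    M.IsTT i (M.cp (i + 2) A A') (M.cp (i + 1) B B') := by
  obtain ⟨P, t1, t2⟩ := t
  obtain ⟨P', s1, s2⟩ := t'
  obtain ⟨e', r⟩ := h.isT_cp_third h' (i := i) (c := i + 2) (by omega) (by omega) (by omega)
    (by omega) t1 s1 e
  exact ⟨_, r, h'.isT_cp_succ (by omega) t2 s2 e'⟩

/-- The connections in the folding are handled by `exists_isT_cn`, the compositions by
`isTT_cp_succ`. -/
theorem Tower.isTT_ps (hi : i ≤ k) {A B : Z} (t : M.IsTT i A B) :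
    M.IsTT i (M.ps (i + 1) A) (M.ps i B) := by
  have g (α β : Bool) : M.IsTT i (M.cn (i + 1) α (M.fc (i + 2) β A))
      (M.cn i α (M.fc (i + 1) β B)) :=
    h.exists_isT_cn h' hi α (h'.isTT_fc_succ hi β t)
  obtain ⟨e1, e2⟩ := h'.snd.ps_composable (i := i + 1) (by omega) A
  exact h.isTT_cp_succ h' hi (h.isTT_cp_succ h' hi (g true false) t e1) (g false true) e2

theorem Tower.inv_of_isTT (hi : i ≤ k) {P P' Q Q' : Z} (t : M.IsTT i P Q) (t' : M.IsTT i P' Q')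
    (I : M.Inv (i + 1) P P') : M.Inv i Q Q' := by
  have key {P P' Q Q' : Z} (t : M.IsTT i P Q) (t' : M.IsTT i P' Q') (I : M.Inv (i + 1) P P') :
      M.fc i true Q = M.fc i false Q' ∧ M.cp i Q Q' = M.dg i (M.fc i false Q) := by
    obtain ⟨e, s⟩ := h.isTT_cp h' hi t t' I.tf
    rw [I.left] at s
    exact ⟨e, h'.isTT_unique hi s (h'.isTT_dg hi (h'.isTT_fc hi _ t))⟩
  exact ⟨(key t t' I).1, (key t' t I.symm).1, (key t t' I).2, (key t' t I.symm).2⟩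

/-- The braid relation for transpositions. -/
theorem Tower.isT_braid (hi : i ≤ k) {A B C D : Z} (hAB : M.IsTT i A B)
    (hAC : M.IsT (i + 1) A C) (hCD : M.IsTT i C D) : M.IsT i B D where
  f12 α := by
    have t := h'.isTT_fc hi α hAB
    rw [hAC.f12] at t
    exact h.isT_unique (by omega) t (h'.isTT_fc_succ hi α hCD)
  f21 α := by
    have t := h'.isTT_fc_succ hi α hAB
    have e : M.fc (i + 2) α A = M.fc (i + 1) α C := hAC.f21 α
    rw [e] at t
    exact h.isT_unique (by omega) t (h'.isTT_fc hi α hCD)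
  inv := h.inv_of_isTT h' hi (h.isTT_ps h' hi hAB) (h.isTT_ps h' hi hCD) hAC.inv

end Braid
end Layer

/-! ### The equation of a transposition, using only the laws on faces so that it applies to shells.
-/

namespace Layer

variable {k : ℕ} {X Y Z : Type u} {L : Layer k X Y} {M : Layer (k + 1) Y Z} {i c : ℕ}

/-- The equation of a transposition, for the extended operations. -/
def TEq (L : Layer k X Y) (i : ℕ) (A B : Y) : Prop :=
  L.cp (i + 1) (L.cp i (L.cn i true (L.fc (i + 1) false A)) B)
      (L.cp i A (L.cn i false (L.fc i true A))) =
    L.cp i (L.cn i false (L.fc i false A)) (L.cn i true (L.fc (i + 1) true A))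

/-- The faces of `A` and `B` in the directions `i` and `i + 1` are exchanged. -/
def Swapped (L : Layer k X Y) (i : ℕ) (A B : Y) : Prop :=
  (∀ α, L.fc i α A = L.fc (i + 1) α B) ∧ ∀ α, L.fc (i + 1) α A = L.fc i α B

theorem Swapped.symm {A B : Y} (h : L.Swapped i A B) : L.Swapped i B A :=
  ⟨fun α => (h.2 α).symm, fun α => (h.1 α).symm⟩

section

variable (hM : M.FaceLaws) (h : L.FaceLaws₂ M)
include h

theorem FaceLaws₂.corner (hi : i ≤ k) (α β : Bool) (A : Z) :
    L.fc i α (M.fc i β A) = L.fc i β (M.fc (i + 1) α A) := by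
  have := h.fc_fc (i := i + 1) (j := i) (by omega) (by omega) (by omega) α β A
  rwa [lo_succ_self, lo_self_succ] at this

theorem FaceLaws₂.swapped_fc (hi : i ≤ k) (hc : c ≤ k + 1) (h1 : c ≠ i) (h2 : c ≠ i + 1) (α : Bool)
    {A B : Z} (s : M.Swapped i A B) : L.Swapped (lo i c) (M.fc c α A) (M.fc c α B) := by
  constructor <;> intro β
  · rw [h.fc_fc (by omega) hc h1.symm, s.1, ← lo_succ_left h1 h2,
      h.fc_fc (by omega) hc h2.symm, lo_succ_right h1]
  · rw [h.fc_fc (by omega) hc h1.symm, ← s.2, ← lo_succ_left h1 h2,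
      h.fc_fc (by omega) hc h2.symm, lo_succ_right h1]

include hM

theorem FaceLaws.tEq_composable (hi : i ≤ k) {A B : Z} (s : M.Swapped i A B) :
    M.fc i true (M.cn i true (M.fc (i + 1) false A)) = M.fc i false B ∧
    M.fc i true A = M.fc i false (M.cn i false (M.fc i true A)) ∧
    M.fc (i + 1) true (M.cp i (M.cn i true (M.fc (i + 1) false A)) B) =
      M.fc (i + 1) false (M.cp i A (M.cn i false (M.fc i true A))) ∧
    M.fc i true (M.cn i false (M.fc i false A)) =
      M.fc i false (M.cn i true (M.fc (i + 1) true A)) := by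
  have c1 : M.fc i true (M.cn i true (M.fc (i + 1) false A)) = M.fc i false B := by
    rw [hM.fc_cn_self (by omega), s.2]
  have c2 : M.fc i true A = M.fc i false (M.cn i false (M.fc i true A)) := by
    rw [hM.fc_cn_self (by omega)]
  refine ⟨c1, c2, ?_, ?_⟩
  · rw [h.fc_cp (by omega) (by omega) (by omega) _ c1, h.fc_cp (by omega) (by omega) (by omega) _ c2,
      hM.fc_succ_cn_self (by omega), hM.fc_succ_cn_self (by omega), s.1]
  · have e1 := h.fc_cn_not hi true (M.fc i false A)
    have e2 := h.fc_cn_not hi false (M.fc (i + 1) true A)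
    exact e1.trans ((congrArg _ (h.corner hi true false A)).trans e2.symm)

/-- Exchanged faces make every composition in the equation defined, so the totalized operations lose
nothing. -/
theorem FaceLaws.tEquation_iff (i : Fin (k + 1)) {A B : Z} (s : M.Swapped i A B) :
    M.TEquation i A B ↔ M.TEq i A B := by
  obtain ⟨c1, c2, c3, c4⟩ := hM.tEq_composable h (Nat.le_of_lt_succ i.2) s
  simp only [TEquation, IsComp₂, isComp_coe, cn_coe, fc_coe, Fin.val_castSucc, Fin.val_succ]
  constructor
  · rintro ⟨P, ⟨Q, R, ⟨-, rfl⟩, ⟨-, rfl⟩, -, hP⟩, -, hP'⟩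
    exact hP.trans hP'.symm
  · exact fun e => ⟨_, ⟨_, _, ⟨c1, rfl⟩, ⟨c2, rfl⟩, c3, e⟩, c4, rfl⟩

theorem FaceLaws.isTInverse_iff (i : Fin (k + 1)) {A B : Z} :
    M.IsTInverse i A B ↔ M.Swapped i A B ∧ M.TEq i A B ∧ M.TEq i B A := by
  simp only [IsTInverse, fc_coe, Fin.val_castSucc, Fin.val_succ]
  constructor
  · rintro ⟨h1, h2, h3, h4⟩
    have s : M.Swapped i A B := ⟨h1, h2⟩
    exact ⟨s, (hM.tEquation_iff h i s).1 h3, (hM.tEquation_iff h i s.symm).1 h4⟩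
  · rintro ⟨s, h3, h4⟩
    exact ⟨s.1, s.2, (hM.tEquation_iff h i s).2 h3, (hM.tEquation_iff h i s.symm).2 h4⟩

/-- The faces of the equation of a transposition. -/
theorem FaceLaws.tEq_iff_of_ext (hL : L.Laws) (hi : i ≤ k)
    (ext : ∀ P Q : Z, (∀ c ≤ k + 1, ∀ α, M.fc c α P = M.fc c α Q) → P = Q)
    {A B : Z} (s : M.Swapped i A B) :
    M.TEq i A B ↔ ∀ c ≤ k + 1, c ≠ i → c ≠ i + 1 → ∀ α,
      L.TEq (lo i c) (M.fc c α A) (M.fc c α B) := by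
  obtain ⟨c1, c2, c3, c4⟩ := hM.tEq_composable h hi s
  -- A face in a third direction of each side is the corresponding side of the equation for the
  -- faces of `A` and `B`.
  have third (c : ℕ) (hc : c ≤ k + 1) (h1 : c ≠ i) (h2 : c ≠ i + 1) (α : Bool) :
      M.fc c α (M.cp (i + 1) (M.cp i (M.cn i true (M.fc (i + 1) false A)) B)
        (M.cp i A (M.cn i false (M.fc i true A)))) =
        L.cp (lo i c + 1)
          (L.cp (lo i c) (L.cn (lo i c) true (L.fc (lo i c + 1) false (M.fc c α A))) (M.fc c α B))
          (L.cp (lo i c) (M.fc c α A) (L.cn (lo i c) false (L.fc (lo i c) true (M.fc c α A)))) ∧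
      M.fc c α (M.cp i (M.cn i false (M.fc i false A)) (M.cn i true (M.fc (i + 1) true A))) =
        L.cp (lo i c) (L.cn (lo i c) false (L.fc (lo i c) false (M.fc c α A)))
          (L.cn (lo i c) true (L.fc (lo i c + 1) true (M.fc c α A))) := by
    have f0 (β : Bool) : L.fc (lo c i) α (M.fc i β A) = L.fc (lo i c) β (M.fc c α A) :=
      h.fc_fc hc (by omega) h1 α β A
    have f1 (β : Bool) : L.fc (lo c i) α (M.fc (i + 1) β A) = L.fc (lo i c + 1) β (M.fc c α A) := by
      rw [← lo_succ_left h1 h2, ← lo_succ_right h1]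
      exact h.fc_fc hc (by omega) h2 α β A
    rw [h.fc_cp hc (by omega) h2 _ c3, h.fc_cp hc (by omega) h1 _ c1,
      h.fc_cp hc (by omega) h1 _ c2, h.fc_cp hc (by omega) h1 _ c4, h.fc_cn hc hi h1 h2,
      h.fc_cn hc hi h1 h2, h.fc_cn hc hi h1 h2, h.fc_cn hc hi h1 h2, f0, f0, f1, f1,
      lo_succ_left h1 h2]
    exact ⟨rfl, rfl⟩
  constructor
  · intro e c hc h1 h2 α
    obtain ⟨e1, e2⟩ := third c hc h1 h2 α
    exact e1.symm.trans ((congrArg _ e).trans e2)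
  · intro e
    -- In the directions `i` and `i + 1` the two sides have the same faces without any hypothesis on
    -- the equation, by the unit laws.
    have x1 (γ : Bool) (x : Y) : M.fc i γ (M.cn i (!γ) x) = L.dg i (L.fc i γ x) :=
      h.fc_cn_not hi γ x
    have x2 (γ : Bool) (x : Y) : M.fc (i + 1) γ (M.cn i (!γ) x) = L.dg i (L.fc i γ x) :=
      h.fc_succ_cn_not hi γ x
    have y1 (γ : Bool) (x : Y) : M.fc i γ (M.cn i γ x) = x := hM.fc_cn_self (by omega) γ x
    have y2 (γ : Bool) (x : Y) : M.fc (i + 1) γ (M.cn i γ x) = x :=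
      hM.fc_succ_cn_self (by omega) γ x
    refine ext _ _ fun c hc α => ?_
    by_cases h1 : c = i
    · subst h1
      rw [h.fc_cp (by omega) (by omega) (by omega) _ c3, lo_succ_self]
      cases α
      · have := x1 false (M.fc (c + 1) false A)
        rw [Bool.not_false] at this
        rw [hM.fc_cp_false c1, hM.fc_cp_false c2, hM.fc_cp_false c4, y1, this,
          ← h.corner hi, hL.dg_cp]
      · have := x1 true (M.fc c true A)
        rw [Bool.not_true] at this
        rw [hM.fc_cp_true c1, hM.fc_cp_true c2, hM.fc_cp_true c4, y1, this, ← s.2,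
          h.corner hi, hL.cp_dg]
    by_cases h2 : c = i + 1
    · subst h2
      rw [h.fc_cp (by omega) (by omega) (by omega) _ c4, lo_self_succ]
      cases α
      · have e1 := x2 false (M.fc (i + 1) false A)
        have e2 := x2 false (M.fc (i + 1) true A)
        rw [Bool.not_false] at e1 e2
        rw [hM.fc_cp_false c3, h.fc_cp (by omega) (by omega) (by omega) _ c1, lo_self_succ, y2, e1,
          e2, ← s.1, ← h.corner hi, ← h.corner hi, hL.dg_cp, hL.cp_dg]
      · have e1 := x2 true (M.fc i true A)
        have e2 := x2 true (M.fc i false A)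
        rw [Bool.not_true] at e1 e2
        rw [hM.fc_cp_true c3, h.fc_cp (by omega) (by omega) (by omega) _ c2, lo_self_succ, y2, e1,
          e2, h.corner hi, h.corner hi, hL.dg_cp, hL.cp_dg]
    obtain ⟨e1, e2⟩ := third c hc h1 h2 α
    rw [e1, e2]
    exact e c hc h1 h2 α

end

theorem Tower.isT_iff (h : Tower L M) (hi : i ≤ k) {A B : Z} :
    M.IsT i A B ↔ M.Swapped i A B ∧ M.TEq i A B ∧ M.TEq i B A := by
  have := h.dcat_laws hi
  rw [← t_iff (L := L), DCat.T.iff, Swapped, and_assoc]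
  rfl

theorem Tower.isTInverse_iff (h : Tower L M) (i : Fin (k + 1)) {A B : Z} :
    M.IsTInverse i A B ↔ M.IsT i A B := by
  rw [h.isT_iff (Nat.le_of_lt_succ i.2), h.snd.faceLaws.isTInverse_iff h.mix.faceLaws]

end Layer

/-! ### Transposed shells. -/

namespace CubicalCategory
open Layer

variable {N : ℕ∞}

/-- Transposed `k`-cells. -/
def TRel (C : CubicalCategory.{u} N) :
    (k : ℕ) → (k : ℕ∞) ≤ N → Fin (k - 1) → C.cell k → C.cell k → Prop
  | 0, _, i => i.elim0
  | k + 1, h, i => (C.layer k ((coe_lt_succ k).trans_le h)).IsT i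

/-- Transposed shells. -/
def BoxT {n : ℕ} (C : CubicalCategory.{u} (n : ℕ∞)) (i : Fin n) (A B : BoxCell C) : Prop :=
  (∀ α, A.1 i.castSucc α = B.1 i.succ α) ∧ (∀ α, A.1 i.succ α = B.1 i.castSucc α) ∧
    ∀ j (h : ¬ (j = i.castSucc ∨ j = i.succ)) α,
      C.TRel n le_rfl (lowGen i j h) (A.1 j α) (B.1 j α)

theorem tRel_unique {C : CubicalCategory.{u} N} {k : ℕ} {h : (k : ℕ∞) ≤ N} {i : Fin (k - 1)}
    {A B B' : C.cell k} (t : C.TRel k h i A B) (t' : C.TRel k h i A B') : B = B' := by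
  obtain _ | _ | k := k
  · exact i.elim0
  · exact i.elim0
  · have hi := i.2
    exact (C.tower k _).isT_unique (by omega) t t'

theorem isTInverse_iff_tRel {C : CubicalCategory.{u} N} {k : ℕ} {h : ((k + 1 : ℕ) : ℕ∞) ≤ N}
    {i : Fin k} {A B : C.cell (k + 1)} :
    (C.layer k ((coe_lt_succ k).trans_le h)).IsTInverse i A B ↔ C.TRel (k + 1) h i A B := by
  obtain _ | k := k
  · exact i.elim0
  · exact (C.tower k _).isTInverse_iff i

/-- Shells are families of faces, so the laws on faces hold by construction. They suffice for the
study of transpositions, and associativity and exchange for shells are never needed. -/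
theorem box_faceLaws {m : ℕ} (C : CubicalCategory.{u} ((m + 1 : ℕ) : ℕ∞)) :
    (boxLayer (m + 1) C).FaceLaws where
  face_conn_castSucc i α A := by
    change connFamily (C.layer m (coe_lt_succ m)) i α A i.castSucc α = A
    simp [connFamily]
  face_conn_succ i α A := by
    change connFamily (C.layer m (coe_lt_succ m)) i α A i.succ α = A
    simp [connFamily]
  face_comp_false i A B P := by
    rintro ⟨h, rfl⟩
    change compFamily (C.layer m (coe_lt_succ m)) i A.1 B.1 _ i false = A.1 i false
    simp [compFamily]
  face_comp_true i A B P := by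
    rintro ⟨h, rfl⟩
    change compFamily (C.layer m (coe_lt_succ m)) i A.1 B.1 _ i true = B.1 i true
    simp [compFamily]

theorem box_faceLaws₂ {m : ℕ} (C : CubicalCategory.{u} ((m + 1 : ℕ) : ℕ∞)) :
    (C.layer m (coe_lt_succ m)).FaceLaws₂ (boxLayer (m + 1) C) where
  face_face i j h α β A := A.2 i j h α β
  face_conn i j h α β A := by
    change connFamily (C.layer m (coe_lt_succ m)) j β A i α = _
    simp only [connFamily, dif_neg h]
  face_conn_castSucc_not j α A := by
    change connFamily (C.layer m (coe_lt_succ m)) j (!α) A j.castSucc α = _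
    simp [connFamily]
  face_conn_succ_not j α A := by
    change connFamily (C.layer m (coe_lt_succ m)) j (!α) A j.succ α = _
    simp [connFamily]
  face_comp i j h α A B P := by
    rintro ⟨h', rfl⟩
    refine ⟨compFamily_aux C j A B h' i h α, ?_⟩
    change _ = compFamily (C.layer m (coe_lt_succ m)) j A.1 B.1 _ i α
    simp only [compFamily, dif_neg h]
    rfl

theorem boxCell_ext {n : ℕ} {C : CubicalCategory.{u} (n : ℕ∞)} {A B : BoxCell C}
    (h : ∀ j α, A.1 j α = B.1 j α) : A = B :=
  Subtype.ext (funext fun j => funext fun α => h j α)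

theorem boxLayer_fc {m : ℕ} (C : CubicalCategory.{u} ((m + 1 : ℕ) : ℕ∞)) (j : Fin (m + 2))
    (α : Bool) (A : BoxCell C) : (boxLayer (m + 1) C).fc j α A = A.1 j α := by
  rw [← fc_coe]; rfl

/-- Shells are determined by their faces, so the equation of a transposition can be tested on the
faces in the other directions, where the exchange of faces comes for free. -/
theorem box_isTInverse_iff {n : ℕ} {C : CubicalCategory.{u} (n : ℕ∞)} {i : Fin n}
    {A B : BoxCell C} : (boxLayer n C).IsTInverse i A B ↔ BoxT C i A B := by
  obtain _ | m := n
  · exact i.elim0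
  have hi := Nat.le_of_lt_succ i.2
  have ext (P Q : BoxCell C) (h : ∀ c ≤ m + 1, ∀ α, (boxLayer (m + 1) C).fc c α P =
      (boxLayer (m + 1) C).fc c α Q) : P = Q := boxCell_ext fun j α => by
    have := h j (by omega) α
    rwa [boxLayer_fc, boxLayer_fc] at this
  have sw : (boxLayer (m + 1) C).Swapped i A B ↔
      (∀ α, A.1 i.castSucc α = B.1 i.succ α) ∧ ∀ α, A.1 i.succ α = B.1 i.castSucc α := by
    simp only [← boxLayer_fc]
    rfl
  have bt : BoxT C i A B ↔ (boxLayer (m + 1) C).Swapped i A B ∧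
      ∀ j (h : ¬ (j = i.castSucc ∨ j = i.succ)) α,
        C.TRel (m + 1) le_rfl (lowGen i j h) (A.1 j α) (B.1 j α) := by
    rw [sw, and_assoc]
    rfl
  rw [(box_faceLaws C).isTInverse_iff (box_faceLaws₂ C), bt]
  refine and_congr_right fun s => ?_
  rw [(box_faceLaws C).tEq_iff_of_ext (box_faceLaws₂ C) (C.laws m _) hi ext s,
    (box_faceLaws C).tEq_iff_of_ext (box_faceLaws₂ C) (C.laws m _) hi ext s.symm]
  have key (j : Fin (m + 2)) (h : ¬ (j = i.castSucc ∨ j = i.succ)) (α : Bool) :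
      C.TRel (m + 1) le_rfl (lowGen i j h) (A.1 j α) (B.1 j α) ↔
      (C.layer m (coe_lt_succ m)).TEq (lo i j) ((boxLayer (m + 1) C).fc j α A)
        ((boxLayer (m + 1) C).fc j α B) ∧
      (C.layer m (coe_lt_succ m)).TEq (lo i j) ((boxLayer (m + 1) C).fc j α B)
        ((boxLayer (m + 1) C).fc j α A) := by
    have h1 : (j : ℕ) ≠ i := fun e => h (Or.inl (Fin.ext e))
    have h2 : (j : ℕ) ≠ i + 1 := fun e => h (Or.inr (Fin.ext e))
    have hl : lo i j < m := lo_lt hi (by omega) h1 h2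
    obtain _ | m := m
    · omega
    have e := (C.tower m (coe_lt_succ (m + 1))).isT_iff (i := lo i j) (by omega)
      (A := A.1 j α) (B := B.1 j α)
    have s' := (box_faceLaws₂ C).swapped_fc hi (by omega) h1 h2 α s
    rw [boxLayer_fc, boxLayer_fc] at s' ⊢
    exact e.trans (and_iff_right s')
  constructor
  · rintro ⟨e1, e2⟩ j h α
    have h1 : (j : ℕ) ≠ i := fun e => h (Or.inl (Fin.ext e))
    have h2 : (j : ℕ) ≠ i + 1 := fun e => h (Or.inr (Fin.ext e))
    exact (key j h α).2 ⟨e1 j (by omega) h1 h2 α, e2 j (by omega) h1 h2 α⟩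
  · intro e
    have key' (c : ℕ) (hc : c ≤ m + 1) (h1 : c ≠ i) (h2 : c ≠ i + 1) (α : Bool) :=
      (key ⟨c, by omega⟩ (by
        rintro (e | e)
        · exact h1 (congrArg Fin.val e)
        · exact h2 (congrArg Fin.val e)) α).1 (e _ _ α)
    exact ⟨fun c hc h1 h2 α => (key' c hc h1 h2 α).1, fun c hc h1 h2 α => (key' c hc h1 h2 α).2⟩

end CubicalCategory

/-! ### The action of words as a relation -/

section Act

variable {m : ℕ} {X : Type u} {R : Fin m → X → X → Prop}

/-- The relation `B = l · A` for a list of letters `l`. -/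
def Act (R : Fin m → X → X → Prop) : List (Fin m) → X → X → Prop
  | [], A, B => A = B
  | i :: l, A, B => ∃ P, Act R l A P ∧ R i P B

theorem act_unique (hR : ∀ i A B B', R i A B → R i A B' → B = B') {l : List (Fin m)} {A B B' : X}
    (h : Act R l A B) (h' : Act R l A B') : B = B' := by
  induction l generalizing B B' with
  | nil => exact h.symm.trans h'
  | cons i l ih =>
    obtain ⟨P, h1, h2⟩ := h
    obtain ⟨P', h1', h2'⟩ := h'
    obtain rfl := ih h1 h1'
    exact hR _ _ _ _ h2 h2'

theorem act_append {l l' : List (Fin m)} {A B : X} :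
    Act R (l ++ l') A B ↔ ∃ P, Act R l' A P ∧ Act R l P B := by
  induction l generalizing B with
  | nil => exact ⟨fun h => ⟨B, h, rfl⟩, fun ⟨_, h, e⟩ => e ▸ h⟩
  | cons i l ih =>
    constructor
    · rintro ⟨P, h1, h2⟩
      obtain ⟨Q, h3, h4⟩ := ih.1 h1
      exact ⟨Q, h3, P, h4, h2⟩
    · rintro ⟨Q, h3, P, h4, h2⟩
      exact ⟨P, ih.2 ⟨Q, h3, h4⟩, h2⟩

theorem mem_listAct_iff {t : Fin m → X →. X} (ht : ∀ i A B, B ∈ t i A ↔ R i A B)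
    {l : List (Fin m)} {A B : X} : B ∈ listAct t l A ↔ Act R l A B := by
  induction l generalizing B with
  | nil => exact Part.mem_some_iff.trans eq_comm
  | cons i l ih =>
    exact Part.mem_bind_iff.trans (exists_congr fun P => and_congr ih (ht i P B))

/-- Uniqueness makes the arbitrary choice in `tMap` harmless. -/
theorem Layer.mem_tMap_iff {k : ℕ} {X Y : Type u} {L : Layer k X Y} {i : Fin k} {A B : Y}
    (hL : ∀ B B', L.IsTInverse i A B → L.IsTInverse i A B' → B = B') :
    B ∈ L.tMap i A ↔ L.IsTInverse i A B := by
  constructor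
  · rintro ⟨h, rfl⟩
    exact h.choose_spec
  · intro h
    have h' : ∃ B, L.IsTInverse i A B := ⟨B, h⟩
    exact ⟨h', hL _ _ h'.choose_spec h⟩

end Act

/-! ### The action of words on shells. -/

namespace CubicalCategory
open Layer

variable {n : ℕ} {C : CubicalCategory.{u} (n : ℕ∞)}

theorem boxT_unique {i : Fin n} {A B B' : BoxCell C} (t : BoxT C i A B) (t' : BoxT C i A B') :
    B = B' := by
  refine boxCell_ext fun j α => ?_
  by_cases h : j = i.castSucc ∨ j = i.succ
  · obtain rfl | rfl := h
    · rw [← t.2.1, ← t'.2.1]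
    · rw [← t.1, ← t'.1]
  · exact tRel_unique (t.2.2 j h α) (t'.2.2 j h α)

theorem ract_castSucc_transp (i : Fin n) : ract i.castSucc (transp (n := n + 1) i) = i.succ :=
  ract_lft (n := n + 1) i

theorem ract_succ_transp (i : Fin n) : ract i.succ (transp (n := n + 1) i) = i.castSucc :=
  ract_rgt (n := n + 1) i

theorem ract_transp_of_not {i : Fin n} {j : Fin (n + 1)} (h : ¬ (j = i.castSucc ∨ j = i.succ)) :
    ract j (transp (n := n + 1) i) = j :=
  ract_transp_of_ne (n := n + 1) j i (fun e => h (Or.inl (Fin.ext e)))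
    fun e => h (Or.inr (Fin.ext e))

theorem BoxT.act_genFace {i : Fin n} {A B : BoxCell C} (t : BoxT C i A B) (j : Fin (n + 1))
    (α : Bool) : Act (C.TRel n le_rfl) (genFace j i).toList
      (A.1 (ract j (transp (n := n + 1) i)) α) (B.1 j α) := by
  unfold genFace
  split_ifs with h
  · change A.1 _ α = _
    obtain rfl | rfl := h
    · rw [ract_castSucc_transp, t.2.1]
    · rw [ract_succ_transp, t.1]
  · rw [ract_transp_of_not h]
    exact ⟨_, rfl, t.2.2 j h α⟩

/-- The faces of `l · A`. -/
theorem act_boxT_face {l : List (Fin n)} {A B : BoxCell C} (h : Act (BoxT C) l A B)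
    (j : Fin (n + 1)) (α : Bool) : Act (C.TRel n le_rfl) (listFace j l).toList
      (A.1 (ract j (listBar (n := n + 1) l)) α) (B.1 j α) := by
  induction l generalizing B j with
  | nil => exact congrArg (fun S : BoxCell C => S.1 j α) h
  | cons i l ih =>
    obtain ⟨P, h1, h2⟩ := h
    -- The leftmost letter acts last, so the face `j` of the result comes from the face `j · T_i` of
    -- the intermediate shell. This is the recursion defining `listFace`.
    rw [listFace_cons, FreeMonoid.toList_mul, act_append, listBar_cons, ract_mul]
    exact ⟨_, ih h1 _, h2.act_genFace j α⟩

/-- A shell with given transposed faces has a transposed shell. -/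
theorem exists_boxT {i : Fin n} {A : BoxCell C}
    (h : ∀ j (h : ¬ (j = i.castSucc ∨ j = i.succ)) α,
      ∃ x, C.TRel n le_rfl (lowGen i j h) (A.1 j α) x) : ∃ B, BoxT C i A B := by
  choose x hx using h
  obtain _ | m := n
  · exact i.elim0
  set L := C.layer m (coe_lt_succ m) with hL
  have hi := i.2
  have sh (a b : Fin (m + 2)) (h : a ≠ b) (α β : Bool) :
      L.fc (lo a b) α (A.1 b β) = L.fc (lo b a) β (A.1 a α) := by
    have := A.2 a b h α β
    rwa [fc_coe, fc_coe] at this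
  -- The faces are forced: two pairs are exchanged and the others are transposed. What has to be
  -- proved is that they fit into a shell.
  let F : Fin (m + 2) → Bool → C.cell (m + 1) := fun j α =>
    if h : j = i.castSucc ∨ j = i.succ then A.1 (ract j (transp (n := m + 2) i)) α else x j h α
  have F1 (α : Bool) : F i.castSucc α = A.1 i.succ α := by
    simp only [F, dif_pos, true_or, ract_castSucc_transp]
  have F2 (α : Bool) : F i.succ α = A.1 i.castSucc α := by
    simp only [F, dif_pos, or_true, ract_succ_transp]
  have F3 (j : Fin (m + 2)) (h : ¬ (j = i.castSucc ∨ j = i.succ)) (α : Bool) :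
      F j α = x j h α := by
    simp only [F, dif_neg h]
  have T (j : Fin (m + 2)) (h : ¬ (j = i.castSucc ∨ j = i.succ)) (α : Bool) :
      L.IsT (lo i j) (A.1 j α) (F j α) := by
    rw [F3 j h]; exact hx j h α
  have nv {j : Fin (m + 2)} (h : ¬ (j = i.castSucc ∨ j = i.succ)) :
      (j : ℕ) ≠ i ∧ (j : ℕ) ≠ i + 1 :=
    ⟨fun e => h (Or.inl (Fin.ext e)), fun e => h (Or.inr (Fin.ext e))⟩
  have half (a b : Fin (m + 2)) (ha : a = i.castSucc ∨ a = i.succ)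
      (hb : ¬ (b = i.castSucc ∨ b = i.succ)) (α β : Bool) :
      L.fc (lo a b) α (F b β) = L.fc (lo b a) β (F a α) := by
    obtain ⟨n1, n2⟩ := nv hb
    obtain rfl | rfl := ha
    · rw [F1]
      have := sh i.succ b (fun e => hb (Or.inr e.symm)) α β
      rw [Fin.val_succ, lo_succ_left n1 n2, lo_succ_right n1, (T b hb β).f21] at this
      exact this
    · rw [F2]
      have := sh i.castSucc b (fun e => hb (Or.inl e.symm)) α β
      rw [Fin.val_castSucc, (T b hb β).f12] at this
      rw [Fin.val_succ, lo_succ_left n1 n2, lo_succ_right n1]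
      exact this
  have shell : IsShell (m + 1) C F := by
    intro a b hab α β
    rw [fc_coe, fc_coe]
    change L.fc (lo a b) α (F b β) = L.fc (lo b a) β (F a α)
    by_cases ha : a = i.castSucc ∨ a = i.succ
    · by_cases hb : b = i.castSucc ∨ b = i.succ
      · obtain rfl | rfl := ha <;> obtain rfl | rfl := hb
        · exact absurd rfl hab
        · rw [F1, F2]
          have := sh i.succ i.castSucc hab.symm α β
          rw [Fin.val_succ, Fin.val_castSucc, lo_succ_self, lo_self_succ] at this ⊢
          exact this
        · rw [F1, F2]
          have := sh i.castSucc i.succ hab.symm α β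
          rw [Fin.val_succ, Fin.val_castSucc, lo_succ_self, lo_self_succ] at this ⊢
          exact this
        · exact absurd rfl hab
      · exact half a b ha hb α β
    · by_cases hb : b = i.castSucc ∨ b = i.succ
      · exact (half b a hb ha β α).symm
      · obtain ⟨a1, a2⟩ := nv ha
        obtain ⟨b1, b2⟩ := nv hb
        have ab : (a : ℕ) ≠ b := fun e => hab (Fin.ext e)
        -- Two distinct directions other than `i` and `i + 1` require at least four directions.
        obtain _ | _ | m := m
        · omega
        · omega
        -- Both iterated faces are transposed to the same cell in the same pair of directions, so
        -- they agree by uniqueness.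
        · have r1 : lo (lo i a) (lo b a) = lo (lo i b) (lo a b) := by
            unfold lo; split_ifs <;> omega
          have T1 := (C.tower (m + 1) (coe_lt_succ _)).isT_fc (i := lo i b) (c := lo a b)
            (by unfold lo; split_ifs <;> omega) (by unfold lo; split_ifs <;> omega)
            (by unfold lo; split_ifs <;> omega) (by unfold lo; split_ifs <;> omega) α (T b hb β)
          have T2 := (C.tower (m + 1) (coe_lt_succ _)).isT_fc (i := lo i a) (c := lo b a)
            (by unfold lo; split_ifs <;> omega) (by unfold lo; split_ifs <;> omega)
            (by unfold lo; split_ifs <;> omega) (by unfold lo; split_ifs <;> omega) β (T a ha α)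
          rw [r1] at T2
          have e : (C.layer (m + 1 + 1) (coe_lt_succ _)).fc (lo b a) β (A.1 a α) =
            (C.layer (m + 1 + 1) (coe_lt_succ _)).fc (lo a b) α (A.1 b β) :=
              (sh a b hab α β).symm
          rw [e] at T2
          exact (C.tower m _).isT_unique (by unfold lo; split_ifs <;> omega) T1 T2
  exact ⟨⟨F, shell⟩, fun α => (F2 α).symm, fun α => (F1 α).symm, fun j h α => T j h α⟩

theorem exists_act_boxT {l : List (Fin n)} {A : BoxCell C}
    (h : ∀ j α, ∃ x, Act (C.TRel n le_rfl) (listFace j l).toList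
      (A.1 (ract j (listBar (n := n + 1) l)) α) x) : ∃ B, Act (BoxT C) l A B := by
  induction l with
  | nil => exact ⟨A, rfl⟩
  | cons i l ih =>
    obtain ⟨P, hP⟩ := ih fun j α => by
      -- The transposition is an involution, so the faces needed for the shorter word are reached by
      -- starting from `j · T_i`.
      obtain ⟨x, hx⟩ := h (ract j (transp (n := n + 1) i)) α
      rw [listFace_cons, FreeMonoid.toList_mul, act_append, listBar_cons] at hx
      obtain ⟨y, hy, -⟩ := hx
      rw [ract_mul, ← ract_mul j, transp_mul_transp, ract_one] at hy
      exact ⟨y, hy⟩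
    obtain ⟨B, hB⟩ := exists_boxT (i := i) (A := P) fun j hj α => by
      obtain ⟨x, hx⟩ := h j α
      rw [listFace_cons, FreeMonoid.toList_mul, act_append, listBar_cons, ract_mul,
        ract_transp_of_not hj] at hx
      obtain ⟨y, hy, hx⟩ := hx
      obtain rfl := act_unique (fun _ _ _ _ => tRel_unique) hy (act_boxT_face hP j α)
      unfold genFace at hx
      rw [dif_neg hj] at hx
      obtain ⟨z, rfl, hz⟩ := hx
      exact ⟨x, hz⟩
    exact ⟨B, P, hP, hB⟩

end CubicalCategory

/-! ### Reduced words of a permutation -/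

section Matsumoto

variable {n : ℕ}

theorem reduced_cons_iff {i : Fin (n - 1)} {l : List (Fin (n - 1))} {σ : SymGroup n}
    (h : listBar l = transp i * σ) :
    Reduced (i :: l) ↔ Reduced l ∧ ract (rgt i) σ < ract (lft i) σ := by
  rw [Reduced, h, ract_mul, ract_mul, ract_lft, ract_rgt]

theorem listBar_tail {i : Fin (n - 1)} {l : List (Fin (n - 1))} {σ : SymGroup n}
    (h : listBar (i :: l) = σ) : listBar l = transp i * σ := by
  rw [← h, listBar_cons, transp_mul_cancel]

theorem length_eq_of_reduced {l l' : List (Fin (n - 1))} (h : Reduced l) (h' : Reduced l')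
    (e : listBar l = listBar l') : l.length = l'.length := by
  rw [← (reduced_iff l).1 h, ← (reduced_iff l').1 h', e]

/-- Two distant descents can both be removed, in either order; `w` is a reduced word of what
remains. -/
theorem exists_reduced_comm {i j : Fin (n - 1)} (hij : (i : ℕ) + 2 ≤ j) {σ : SymGroup n}
    (di : ract (rgt i) σ < ract (lft i) σ) (dj : ract (rgt j) σ < ract (lft j) σ) :
    ∃ w, listBar (j :: w) = transp i * σ ∧ Reduced (j :: w) ∧
      listBar (i :: w) = transp j * σ ∧ Reduced (i :: w) := by
  have hc := transp_comm i j (Or.inl hij)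
  obtain ⟨w, hw, rw⟩ := exists_reduced (transp j * (transp i * σ))
  have hw' : listBar w = transp i * (transp j * σ) := by rw [hw, ← mul_assoc, ← hc, mul_assoc]
  have r1 : ract (rgt j) (transp i) = rgt j :=
    ract_transp_of_ne _ _ (by simp [rgt]; omega) (by simp [rgt]; omega)
  have r2 : ract (lft j) (transp i) = lft j :=
    ract_transp_of_ne _ _ (by simp [lft]; omega) (by simp [lft]; omega)
  have r3 : ract (rgt i) (transp j) = rgt i :=
    ract_transp_of_ne _ _ (by simp [rgt]; omega) (by simp [rgt]; omega)
  have r4 : ract (lft i) (transp j) = lft i :=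
    ract_transp_of_ne _ _ (by simp [lft]; omega) (by simp [lft]; omega)
  refine ⟨w, by rw [listBar_cons, hw, transp_mul_cancel], (reduced_cons_iff hw).2 ⟨rw, ?_⟩,
    by rw [listBar_cons, hw', transp_mul_cancel], (reduced_cons_iff hw').2 ⟨rw, ?_⟩⟩
  · rwa [ract_mul, ract_mul, r1, r2]
  · rwa [ract_mul, ract_mul, r3, r4]

/-- Two adjacent descents mean that three consecutive values decrease, so the longest element on
three strings can be removed from `σ`; `w` is a reduced word of what remains. -/
theorem exists_reduced_braid {i j : Fin (n - 1)} (hij : (j : ℕ) = i + 1) {σ : SymGroup n}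
    (di : ract (rgt i) σ < ract (lft i) σ) (dj : ract (rgt j) σ < ract (lft j) σ) :
    ∃ w, listBar (j :: i :: w) = transp i * σ ∧ Reduced (j :: i :: w) ∧
      listBar (i :: j :: w) = transp j * σ ∧ Reduced (i :: j :: w) := by
  have hb := transp_braid i j hij
  have e : rgt i = lft j := by ext; simp [rgt, lft, hij]
  have r1 : ract (rgt j) (transp i) = rgt j :=
    ract_transp_of_ne _ _ (by simp [rgt]; omega) (by simp [rgt]; omega)
  have r2 : ract (lft i) (transp j) = lft i :=
    ract_transp_of_ne _ _ (by simp [lft]; omega) (by simp [lft]; omega)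
  have r3 : ract (lft j) (transp i) = lft i := by rw [← e, ract_rgt]
  have r4 : ract (rgt i) (transp j) = rgt j := by rw [e, ract_lft]
  obtain ⟨w, hw, rw⟩ := exists_reduced (transp i * (transp j * (transp i * σ)))
  have hw' : listBar w = transp j * (transp i * (transp j * σ)) := by
    rw [hw, ← mul_assoc, ← mul_assoc, ← mul_assoc, ← mul_assoc, hb]
  have h1 : listBar (i :: w) = transp j * (transp i * σ) := by
    rw [listBar_cons, hw, transp_mul_cancel]
  have h2 : listBar (j :: w) = transp i * (transp j * σ) := by
    rw [listBar_cons, hw', transp_mul_cancel]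
  rw [e] at di
  refine ⟨w, by rw [listBar_cons, h1, transp_mul_cancel],
    (reduced_cons_iff h1).2 ⟨(reduced_cons_iff hw).2 ⟨rw, ?_⟩, ?_⟩,
    by rw [listBar_cons, h2, transp_mul_cancel],
    (reduced_cons_iff h2).2 ⟨(reduced_cons_iff hw').2 ⟨rw, ?_⟩, ?_⟩⟩
  · rw [ract_mul, ract_mul, ract_mul, ract_mul, r4, r1, r2, ract_lft, e]
    exact dj
  · rw [ract_mul, ract_mul, r1, r3]
    exact dj.trans di
  · rw [ract_mul, ract_mul, ract_mul, ract_mul, r1, ract_rgt, r3, r2]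
    exact di
  · rw [ract_mul, ract_mul, r4, r2]
    exact dj.trans di

variable {X : Type u} {R : Fin (n - 1) → X → X → Prop}

/-- The partial action of reduced words is determined by permutations, if transpositions satisfy the
braid relations and if invertibility depends on permutations only. -/
theorem act_eq_of_reduced (hR : ∀ i A B B', R i A B → R i A B' → B = B')
    (hex : ∀ l l' A B, Reduced l → Reduced l' → listBar l = listBar l' → Act R l A B →
      ∃ B', Act R l' A B')
    (hcomm : ∀ (i j : Fin (n - 1)) A B D E, (i : ℕ) + 2 ≤ j → R i A B → R j A D → R i D E → R j B E)
    (hbraid : ∀ (i j : Fin (n - 1)) A B D E F G, (j : ℕ) = i + 1 → R i A B → R j B D →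
      R j A E → R i E F → R j F G → R i D G)
    {l l' : List (Fin (n - 1))} {A B B' : X} (hl : Reduced l) (hl' : Reduced l')
    (e : listBar l = listBar l') (h : Act R l A B) (h' : Act R l' A B') : B = B' := by
  induction hN : l.length using Nat.strong_induction_on generalizing l l' B B' with
  | _ N ih =>
  subst hN
  have hlen := length_eq_of_reduced hl hl' e
  obtain _ | ⟨i, u⟩ := l
  · obtain rfl := List.length_eq_zero_iff.1 hlen.symm
    exact h.symm.trans h'
  obtain _ | ⟨j, v⟩ := l'
  · simp at hlen
  have ih' {v w : List (Fin (n - 1))} {P Q : X} (hv : Reduced v) (hw : Reduced w)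
      (hvu : v.length = u.length) (e : listBar v = listBar w) (h : Act R v A P)
      (h' : Act R w A Q) : P = Q :=
    ih v.length (by rw [hvu]; exact Nat.lt_succ_self _) hv hw e h h' rfl
  -- The action is partial: `hex` supplies the existence of the action of the other word, and the
  -- induction hypothesis its value.
  have transfer {v w : List (Fin (n - 1))} {P : X} (hv : Reduced v) (hw : Reduced w)
      (hvu : v.length = u.length) (e : listBar v = listBar w) (h : Act R v A P) : Act R w A P := by
    obtain ⟨Q, hQ⟩ := hex v w A P hv hw e h
    rwa [ih' hv hw hvu e h hQ]
  simp only [List.length_cons, Nat.add_right_cancel_iff] at hlen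
  obtain ⟨P, hP, hB⟩ := h
  obtain ⟨P', hP', hB'⟩ := h'
  set σ := listBar (j :: v) with hσ
  have eu := listBar_tail e
  have ev := listBar_tail hσ.symm
  have di := ((reduced_cons_iff eu).1 hl).2
  have dj := ((reduced_cons_iff ev).1 hl').2
  have hu := hl.1
  have hv := hl'.1
  have comm (i j : Fin (n - 1)) (w : List (Fin (n - 1))) (hij : (i : ℕ) + 2 ≤ j) (P P' B B' : X)
      (h1 : Act R (j :: w) A P) (h2 : Act R (i :: w) A P') (hB : R i P B) (hB' : R j P' B') :
      B = B' := by
    obtain ⟨E, h1, r1⟩ := h1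
    obtain ⟨E', h2, r2⟩ := h2
    obtain rfl := act_unique hR h1 h2
    exact hR _ _ _ _ (hcomm i j E P' P B hij r2 r1 hB) hB'
  have braid (i j : Fin (n - 1)) (w : List (Fin (n - 1))) (hij : (j : ℕ) = i + 1) (P P' B B' : X)
      (h1 : Act R (j :: i :: w) A P) (h2 : Act R (i :: j :: w) A P') (hB : R i P B)
      (hB' : R j P' B') : B = B' := by
    obtain ⟨E1, ⟨E, h1, r1⟩, s1⟩ := h1
    obtain ⟨F1, ⟨E', h2, r2⟩, s2⟩ := h2
    obtain rfl := act_unique hR h1 h2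
    exact hR _ _ _ _ hB (hbraid i j E E1 P F1 P' B' hij r1 s1 r2 s2 hB')
  -- Both first letters are descents of the same permutation. If they differ, the tails are replaced
  -- by reduced words with a common end, and a single relation compares the results.
  have cases : (i : ℕ) = j ∨ (i : ℕ) + 2 ≤ j ∨ (j : ℕ) + 2 ≤ i ∨ (j : ℕ) = i + 1 ∨
      (i : ℕ) = j + 1 := by omega
  rcases cases with hij | hij | hij | hij | hij
  · obtain rfl := Fin.ext hij
    obtain rfl := ih' hu hv rfl (eu.trans ev.symm) hP hP'
    exact hR _ _ _ _ hB hB'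
  · obtain ⟨w, e1, r1, e2, r2⟩ := exists_reduced_comm hij di dj
    exact comm i j w hij P P' B B' (transfer hu r1 rfl (eu.trans e1.symm) hP)
      (transfer hv r2 hlen.symm (ev.trans e2.symm) hP') hB hB'
  · obtain ⟨w, e1, r1, e2, r2⟩ := exists_reduced_comm hij dj di
    exact (comm j i w hij P' P B' B (transfer hv r1 hlen.symm (ev.trans e1.symm) hP')
      (transfer hu r2 rfl (eu.trans e2.symm) hP) hB' hB).symm
  · obtain ⟨w, e1, r1, e2, r2⟩ := exists_reduced_braid hij di dj
    exact braid i j w hij P P' B B' (transfer hu r1 rfl (eu.trans e1.symm) hP)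
      (transfer hv r2 hlen.symm (ev.trans e2.symm) hP') hB hB'
  · obtain ⟨w, e1, r1, e2, r2⟩ := exists_reduced_braid hij dj di
    exact (braid j i w hij P' P B' B (transfer hv r1 hlen.symm (ev.trans e1.symm) hP')
      (transfer hu r2 rfl (eu.trans e2.symm) hP) hB' hB).symm

end Matsumoto

/-! ### Lifting actions from shells to cells, and independence of the reduced word. -/

namespace CubicalCategory
open Layer

variable {N : ℕ∞} {C : CubicalCategory.{u} N} {n : ℕ} (hn : ((n + 1 : ℕ) : ℕ∞) ≤ N)

/-- The shell of an `(n + 1)`-cell. -/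
def shellOf (A : C.cell (n + 1)) : BoxCell (C.tr n ((coe_lt_succ n).le.trans hn)) :=
  ⟨fun i α => (C.layer n ((coe_lt_succ n).trans_le hn)).face i α A, by
    cases n with
    | zero => trivial
    | succ n =>
      intro i j h α β
      exact (C.laws₂ n _ ((coe_lt_succ (n + 1)).trans_le hn)).face_face i j h α β A⟩

theorem shellOf_apply (A : C.cell (n + 1)) (i : Fin (n + 1)) (α : Bool) :
    (shellOf hn A).1 i α = (C.layer n ((coe_lt_succ n).trans_le hn)).fc i α A := fc_coe _ _ _ _

theorem TRel.boxT {i : Fin n} {A B : C.cell (n + 1)} (t : C.TRel (n + 1) hn i A B) :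
    BoxT (C.tr n ((coe_lt_succ n).le.trans hn)) i (shellOf hn A) (shellOf hn B) := by
  refine ⟨fun α => ?_, fun α => ?_, fun j hj α => ?_⟩
  · rw [shellOf_apply, shellOf_apply]; exact t.f12 α
  · rw [shellOf_apply, shellOf_apply]; exact t.f21 α
  · obtain _ | m := n
    · exact i.elim0
    · rw [shellOf_apply, shellOf_apply]
      have hi := i.2
      have hj' := j.2
      exact (C.tower m ((coe_lt_succ (m + 1)).trans_le hn)).isT_fc (i := i) (c := j) (by omega)
        (by omega)
        (fun e => hj (Or.inl (Fin.ext e))) (fun e => hj (Or.inr (Fin.ext e))) α t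

theorem TRel.symm {i : Fin n} {A B : C.cell (n + 1)} (t : C.TRel (n + 1) hn i A B) :
    C.TRel (n + 1) hn i B A := IsT.symm t

theorem TRel.hasInv {i : Fin n} {A B : C.cell (n + 1)} (t : C.TRel (n + 1) hn i A B) :
    C.HasInv n ((coe_lt_succ n).trans_le hn) 0 A :=
  HasT.hasInv _ i.2 (Nat.zero_le _) ⟨B, t⟩

/-- An invertible cell whose shell has a transposed shell has a transposed cell. -/
theorem BoxT.lift {i : Fin n} {A : C.cell (n + 1)}
    {S : BoxCell (C.tr n ((coe_lt_succ n).le.trans hn))}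
    (hA : C.HasInv n ((coe_lt_succ n).trans_le hn) 0 A)
    (t : BoxT (C.tr n ((coe_lt_succ n).le.trans hn)) i (shellOf hn A) S) :
    ∃ B, C.TRel (n + 1) hn i A B ∧ shellOf hn B = S := by
  obtain _ | m := n
  · exact i.elim0
  have hi := i.2
  obtain ⟨B, hB⟩ := (hasT_iff ((coe_lt_succ (m + 1)).trans_le hn) (i := i) (by omega)).2
    ⟨hA, fun c hc h1 h2 α => by
      have := t.2.2 ⟨c, by omega⟩ (by
        rintro (e | e)
        · exact h1 (congrArg Fin.val e)
        · exact h2 (congrArg Fin.val e)) α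
      rw [shellOf_apply] at this
      exact ⟨_, this⟩⟩
  have hB' : C.TRel (m + 1 + 1) hn i A B := hB
  exact ⟨B, hB', boxT_unique (TRel.boxT hn hB') t⟩

theorem act_shellOf {l : List (Fin n)} {A B : C.cell (n + 1)}
    (h : Act (C.TRel (n + 1) hn) l A B) :
    Act (BoxT (C.tr n ((coe_lt_succ n).le.trans hn))) l (shellOf hn A) (shellOf hn B) := by
  induction l generalizing B with
  | nil => exact congrArg (shellOf hn) h
  | cons i l ih =>
    obtain ⟨P, h1, h2⟩ := h
    exact ⟨_, ih h1, TRel.boxT hn h2⟩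

/-- Plain invertibility is carried along because it follows from having a transposed cell; thus it
is available again for the next letter. -/
theorem act_lift {l : List (Fin n)} {A : C.cell (n + 1)}
    {S : BoxCell (C.tr n ((coe_lt_succ n).le.trans hn))}
    (hA : C.HasInv n ((coe_lt_succ n).trans_le hn) 0 A)
    (h : Act (BoxT (C.tr n ((coe_lt_succ n).le.trans hn))) l (shellOf hn A) S) :
    ∃ B, Act (C.TRel (n + 1) hn) l A B ∧ shellOf hn B = S ∧
      C.HasInv n ((coe_lt_succ n).trans_le hn) 0 B := by
  induction l generalizing S with
  | nil => exact ⟨A, rfl, h, hA⟩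
  | cons i l ih =>
    obtain ⟨P, h1, h2⟩ := h
    obtain ⟨Q, hQ, rfl, iQ⟩ := ih h1
    obtain ⟨B, hB, e⟩ := h2.lift hn iQ
    exact ⟨B, ⟨Q, hQ, hB⟩, e, (hB.symm hn).hasInv hn⟩

/-- The last letter of the list acts first, directly on `A`. -/
theorem hasInv_of_act {l : List (Fin n)} {A B : C.cell (n + 1)} (hl : l ≠ [])
    (h : Act (C.TRel (n + 1) hn) l A B) : C.HasInv n ((coe_lt_succ n).trans_le hn) 0 A := by
  rw [← List.dropLast_append_getLast hl, act_append] at h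
  obtain ⟨P, ⟨Q, rfl, h⟩, -⟩ := h
  exact h.hasInv hn

theorem act_tr {k : ℕ} (h : (k : ℕ∞) ≤ N) {l : List (Fin (k - 1))} {A B : C.cell k} :
    Act ((C.tr k h).TRel k le_rfl) l A B ↔ Act (C.TRel k h) l A B := by
  cases k <;> rfl

theorem listBar_listFace_congr (j : Fin (n + 1)) {l l' : List (Fin n)}
    (e : listBar (n := n + 1) l = listBar (n := n + 1) l') :
    listBar (listFace j l).toList = listBar (listFace j l').toList :=
  bar_wordFace_congr j (v := FreeMonoid.ofList l) (w := FreeMonoid.ofList l') e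

/-- On shells the faces of the action are actions of reduced words one dimension lower, with equal
permutations for `l` and `l'`. -/
theorem act_boxT_of_reduced {C : CubicalCategory.{u} (n : ℕ∞)}
    (hC : ∀ (l l' : List (Fin (n - 1))) (A B : C.cell n), Reduced l → Reduced l' →
      listBar l = listBar l' → Act (C.TRel n le_rfl) l A B → Act (C.TRel n le_rfl) l' A B)
    {l l' : List (Fin n)} {A B : BoxCell C} (hl : Reduced (n := n + 1) l)
    (hl' : Reduced (n := n + 1) l') (e : listBar (n := n + 1) l = listBar (n := n + 1) l')
    (h : Act (BoxT C) l A B) : Act (BoxT C) l' A B := by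
  have key (j : Fin (n + 1)) (α : Bool) : Act (C.TRel n le_rfl) (listFace j l').toList
      (A.1 (ract j (listBar (n := n + 1) l')) α) (B.1 j α) := by
    rw [← e]
    exact hC _ _ _ _ (reduced_listFace l j hl) (reduced_listFace l' j hl')
      (listBar_listFace_congr j e) (act_boxT_face h j α)
  obtain ⟨B', h'⟩ := exists_act_boxT fun j α => ⟨_, key j α⟩
  obtain rfl : B' = B := boxCell_ext fun j α =>
    act_unique (fun _ _ _ _ => tRel_unique) (act_boxT_face h' j α) (key j α)
  exact h'

/-- Two reduced words with the same permutation have the same action. -/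
theorem act_of_reduced (k : ℕ) (hk : (k : ℕ∞) ≤ N) (l l' : List (Fin (k - 1))) (A B : C.cell k)
    (hl : Reduced l) (hl' : Reduced l') (e : listBar l = listBar l')
    (h : Act (C.TRel k hk) l A B) : Act (C.TRel k hk) l' A B := by
  induction k with
  | zero =>
    obtain _ | ⟨i, l⟩ := l
    · obtain _ | ⟨i, l'⟩ := l'
      · exact h
      · exact i.elim0
    · exact i.elim0
  | succ n ih =>
  -- Existence passes from `l` to `l'` through the shell: the induction hypothesis moves the action
  -- on shells, and `act_lift` brings it back to cells.
  have hex (l l' : List (Fin n)) (A B : C.cell (n + 1)) (hl : Reduced (n := n + 1) l)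
      (hl' : Reduced (n := n + 1) l') (e : listBar (n := n + 1) l = listBar (n := n + 1) l')
      (h : Act (C.TRel (n + 1) hk) l A B) : ∃ B', Act (C.TRel (n + 1) hk) l' A B' := by
    by_cases h0 : l = []
    · subst h0
      have := length_eq_of_reduced hl hl' e
      obtain rfl := List.length_eq_zero_iff.1 this.symm
      exact ⟨B, h⟩
    obtain ⟨B', hB', -⟩ := act_lift hk (hasInv_of_act hk h0 h)
      (act_boxT_of_reduced (fun l l' A B h1 h2 h3 h4 => (act_tr _).2
        (ih _ l l' A B h1 h2 h3 ((act_tr _).1 h4))) hl hl' e (act_shellOf hk h))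
    exact ⟨B', hB'⟩
  obtain ⟨B', h'⟩ := hex l l' A B hl hl' e h
  have eq : B = B' := by
    refine act_eq_of_reduced (n := n + 1) (R := C.TRel (n + 1) hk) (fun _ _ _ _ => tRel_unique) hex
      (fun i j A B D E hij h1 h2 h3 => ?_) (fun i j A B D E F G hij h1 h2 h3 h4 h5 => ?_)
      hl hl' e h h'
    · have hj := j.2
      obtain _ | _ | m := n
      · exact i.elim0
      · omega
      · exact (C.tower m _).isT_comm (C.tower (m + 1) _) hij (by omega) h1 h2 h3
    · have hj := j.2
      obtain _ | _ | m := n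
      · exact i.elim0
      · omega
      · have h2' : (C.layer (m + 1 + 1) ((coe_lt_succ _).trans_le hk)).IsT (i + 1) B D := hij ▸ h2
        have h3' : (C.layer (m + 1 + 1) ((coe_lt_succ _).trans_le hk)).IsT (i + 1) A E := hij ▸ h3
        have h5' : (C.layer (m + 1 + 1) ((coe_lt_succ _).trans_le hk)).IsT (i + 1) F G := hij ▸ h5
        exact (C.tower m _).isT_braid (C.tower (m + 1) _) (by omega) ⟨B, h1, h2'⟩ h3' ⟨F, h4, h5'⟩
  exact eq ▸ h'

end CubicalCategory

/-! ### The partial action of permutations -/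

/-- Once all reduced words act alike, the word chosen in `permAct` may be replaced by any prescribed
reduced word. -/
theorem mem_permAct_iff {n : ℕ} {X : Type u} {R : Fin (n - 1) → X → X → Prop}
    {t : Fin (n - 1) → X →. X} (ht : ∀ i A B, B ∈ t i A ↔ R i A B)
    (hR : ∀ i A B B', R i A B → R i A B' → B = B')
    (hred : ∀ l l' A B, Reduced l → Reduced l' → listBar l = listBar l' → Act R l A B →
      Act R l' A B)
    {l : List (Fin (n - 1))} (hl : Reduced l) {A B : X} :
    B ∈ permAct t (listBar l) A ↔ Act R l A B := by
  have key (w : Word n) (hw : IsMinRep w (listBar l)) (P : X) (h : P ∈ wordAct t w A) :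
      Act R l A P := by
    obtain ⟨e, hw⟩ := (isMinRep_iff w _).1 hw
    exact hred w.toList l A P hw hl e ((mem_listAct_iff ht).1 h)
  constructor
  · rintro ⟨h, rfl⟩
    exact key _ h.choose_spec.1 _ (Part.get_mem _)
  · intro h
    have d : ∃ w, IsMinRep w (listBar l) ∧ (wordAct t w A).Dom :=
      ⟨FreeMonoid.ofList l, (isMinRep_iff _ _).2 ⟨rfl, hl⟩,
        Part.dom_iff_mem.2 ⟨B, (mem_listAct_iff ht).2 h⟩⟩
    exact ⟨d, act_unique hR (key _ d.choose_spec.1 _ (Part.get_mem _)) h⟩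

namespace CubicalCategory
open Layer

theorem mem_act_iff {N : ℕ∞} {C : CubicalCategory.{u} N} {k : ℕ} {hk : (k : ℕ∞) ≤ N}
    {l : List (Fin (k - 1))} (hl : Reduced l) {A B : C.cell k} :
    B ∈ C.act k hk (listBar l) A ↔ Act (C.TRel k hk) l A B := by
  refine mem_permAct_iff (fun i A B => ?_) (fun _ _ _ _ => tRel_unique)
    (fun l l' A B => act_of_reduced k hk l l' A B) hl
  obtain _ | k := k
  · exact i.elim0
  · rw [← isTInverse_iff_tRel]
    exact mem_tMap_iff fun P Q h1 h2 =>
      tRel_unique (h := hk) (isTInverse_iff_tRel.1 h1) (isTInverse_iff_tRel.1 h2)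

theorem mem_boxAct_iff {n : ℕ} {C : CubicalCategory.{u} (n : ℕ∞)} {l : List (Fin n)}
    (hl : Reduced (n := n + 1) l) {A B : BoxCell C} :
    B ∈ C.boxAct (listBar (n := n + 1) l) A ↔ Act (BoxT C) l A B := by
  refine mem_permAct_iff (n := n + 1) (R := BoxT C) (fun i A B => ?_)
    (fun _ _ _ _ => boxT_unique)
    (fun l l' A B => act_boxT_of_reduced (fun l l' A B => act_of_reduced n le_rfl l l' A B)) hl
  rw [← box_isTInverse_iff]
  exact mem_tMap_iff fun P Q h1 h2 =>
    boxT_unique (box_isTInverse_iff.1 h1) (box_isTInverse_iff.1 h2)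

/-- Since `listFace j l` is again reduced, it computes the action of `∂_j σ`; this passes from words
to permutations. -/
theorem mem_act_permFace_iff {n : ℕ} {C : CubicalCategory.{u} (n : ℕ∞)} {l : List (Fin n)}
    (hl : Reduced (n := n + 1) l) (j : Fin (n + 1)) {A B : C.cell n} :
    B ∈ C.act n le_rfl (permFace n j (listBar (n := n + 1) l)) A ↔
      Act (C.TRel n le_rfl) (listFace j l).toList A B := by
  rw [← mem_act_iff (reduced_listFace l j hl)]
  have e : permFace n j (listBar (n := n + 1) l) = listBar (listFace j l).toList :=
    permFace_bar n j (FreeMonoid.ofList l)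
  rw [e]

theorem boxAct_dom_iff {n : ℕ} (C : CubicalCategory.{u} (n : ℕ∞)) (σ : SymGroup (n + 1))
    (A : BoxCell C) : (C.boxAct σ A).Dom ↔ ∀ (j : Fin (n + 1)) (α : Bool),
      (C.act n le_rfl (permFace n j σ) (A.1 (ract j σ) α)).Dom := by
  obtain ⟨l, rfl, hl⟩ := exists_reduced σ
  simp only [Part.dom_iff_mem, mem_boxAct_iff hl]
  exact ⟨fun ⟨B, h⟩ j α => ⟨_, (mem_act_permFace_iff hl j).2 (act_boxT_face h j α)⟩,
    fun h => exists_act_boxT fun j α =>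
      let ⟨x, hx⟩ := h j α
      ⟨x, (mem_act_permFace_iff hl j).1 hx⟩⟩

theorem face_mem_of_mem_boxAct {n : ℕ} {C : CubicalCategory.{u} (n : ℕ∞)} {σ : SymGroup (n + 1)}
    {A B : BoxCell C} (h : B ∈ C.boxAct σ A) (j : Fin (n + 1)) (α : Bool) :
    B.1 j α ∈ C.act n le_rfl (permFace n j σ) (A.1 (ract j σ) α) := by
  obtain ⟨l, rfl, hl⟩ := exists_reduced σ
  exact (mem_act_permFace_iff hl j).2 (act_boxT_face ((mem_boxAct_iff hl).1 h) j α)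

theorem act_dom_iff (C : CubicalOmegaCategory.{u}) {n : ℕ} {σ : SymGroup (n + 1)}
    (A : C.cell (n + 1)) (hσ : σ ≠ 1) : (C.act (n + 1) le_top σ A).Dom ↔
      C.Invertible A ∧ ((C.tr n le_top).boxAct σ (C.shell A)).Dom := by
  obtain ⟨l, rfl, hl⟩ := exists_reduced σ
  -- The empty word would act on every cell, invertible or not; this is where `σ ≠ 1` enters.
  have h0 : l ≠ [] := by
    rintro rfl
    exact hσ rfl
  have inv : C.Invertible A ↔ C.HasInv n ((coe_lt_succ n).trans_le le_top) 0 A :=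
    Layer.invertible_iff _ _ _
  simp only [Part.dom_iff_mem, inv]
  constructor
  · rintro ⟨B, h⟩
    have h' := (mem_act_iff hl).1 h
    exact ⟨hasInv_of_act le_top h0 h', _, (mem_boxAct_iff hl).2 (act_shellOf le_top h')⟩
  · rintro ⟨hA, S, h⟩
    obtain ⟨B, hB, -⟩ := act_lift le_top hA ((mem_boxAct_iff hl).1 h)
    exact ⟨B, (mem_act_iff hl).2 hB⟩

end CubicalCategory

theorem permFace_one (n : ℕ) (i : Fin (n + 1)) : permFace n i 1 = 1 := permFace_bar n i 1

theorem permFace_transp (n : ℕ) (i : Fin (n + 1)) (j : Fin n) :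
    permFace n i (transp (n := n + 1) j) =
      if h : i = j.castSucc ∨ i = j.succ then 1 else transp (lowGen j i h) := by
  rw [← bar_genFace, ← wordFace_of, ← permFace_bar]
  simp [bar]

theorem permFace_mul (n : ℕ) (i : Fin (n + 1)) (σ τ : SymGroup (n + 1)) :
    permFace n i (σ * τ) = permFace n i σ * permFace n (ract i σ) τ := by
  obtain ⟨u, rfl⟩ := bar_surjective σ
  obtain ⟨v, rfl⟩ := bar_surjective τ
  rw [← map_mul, permFace_bar, permFace_bar, permFace_bar, wordFace_mul, map_mul]

end Cubical

theorem proposition5p1p13 :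
    -- the maps `∂_i` on words, followed by the projection, respect the relations of `S_n`
    (∀ (n : ℕ) (i : Fin (n + 1)) (v w : Word (n + 1)),
      conGen (CoxeterRel (n + 1)) v w → bar (wordFace i v) = bar (wordFace i w)) ∧
    -- hence they induce maps `d n i = ∂_i : S_{n+1} → S_n`, in a unique way
    ∃ d : ∀ n : ℕ, Fin (n + 1) → SymGroup (n + 1) → SymGroup n,
      (∀ n i (w : Word (n + 1)), d n i (bar w) = bar (wordFace i w)) ∧
      (∀ d' : ∀ n : ℕ, Fin (n + 1) → SymGroup (n + 1) → SymGroup n,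
        (∀ n i (w : Word (n + 1)), d' n i (bar w) = bar (wordFace i w)) → d' = d) ∧
      -- the values on products
      (∀ n i, d n i 1 = 1) ∧
      (∀ (n : ℕ) (i : Fin (n + 1)) (j : Fin n), d n i (transp j) =
        if h : i = j.castSucc ∨ i = j.succ then 1 else transp (lowGen j i h)) ∧
      (∀ n i (σ τ : SymGroup (n + 1)), d n i (σ * τ) = d n i σ * d n (ract i σ) τ) ∧
      -- the characterization `j · ∂_i σ = (j^i · σ)_{i · σ}`
      (∀ n i (σ : SymGroup (n + 1)) (ρ : SymGroup n),
        (∀ j : Fin n, ract j ρ = low (ract (i.succAbove j) σ) (ract i σ) (ract_ne i σ j)) ↔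
          ρ = d n i σ) ∧
      -- `σ`-invertibility of the `(n + 1)`-cells of `□C`
      (∀ (n : ℕ) (C : CubicalCategory.{u} (n : ℕ∞)) (σ : SymGroup (n + 1)) (A : C.BoxCell),
        ((C.boxAct σ A).Dom ↔
          ∀ (j : Fin (n + 1)) (α : Bool),
            (C.act n le_rfl (d n j σ) (A.1 (ract j σ) α)).Dom) ∧
        ∀ B ∈ C.boxAct σ A, ∀ (j : Fin (n + 1)) (α : Bool),
          B.1 j α ∈ C.act n le_rfl (d n j σ) (A.1 (ract j σ) α)) ∧
      -- `σ`-invertibility of the cells of a cubical `ω`-category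
      (∀ (C : CubicalOmegaCategory.{u}) (n : ℕ) (σ : SymGroup (n + 1)) (A : C.cell (n + 1)),
        σ ≠ 1 →
          ((C.act (n + 1) le_top σ A).Dom ↔
            C.Invertible A ∧ ((C.tr n le_top).boxAct σ (C.shell A)).Dom)) := by
  refine ⟨fun n i v w h => bar_wordFace_congr i (bar_eq_of_conGen h), permFace, permFace_bar, ?_,
    permFace_one, permFace_transp, permFace_mul, ?_, ?_, ?_⟩
  · intro d hd
    funext n i σ
    obtain ⟨w, rfl⟩ := bar_surjective σ
    rw [hd, permFace_bar]
  · intro n i σ ρ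
    constructor
    · exact fun h => symGroup_ext fun j => (h j).trans (ract_permFace n i σ j).symm
    · rintro rfl j
      exact ract_permFace n i σ j
  · exact fun n C σ A => ⟨CubicalCategory.boxAct_dom_iff C σ A,
      fun B hB j α => CubicalCategory.face_mem_of_mem_boxAct hB j α⟩
  · exact fun C n σ A hσ => CubicalCategory.act_dom_iff C A hσ
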